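/- \textbf{Setup.} Let $[\overline n]=\{1<2<\dots<n<\overline n<\dots<\overline 1\}$ with $\overline{\overline\imath}=i$ and $|\overline\imath|=i$. Let $W$ be the group of signed permutations: bijections $w$ of $[\overline n]$ with $w(\overline\imath)=\overline{w(i)}$. Its length function is $\ell(w)=\#\{(k,l)\in[n]\times[\overline n]: k\le |l|,\ w(k)>w(l)\}$. For $1\le i<j\le n$ write $(i,j)$, $(i,\overline\jmath)$ and, for $1\le i\le n$, $(i,\overline\imath)$ for the positive roots $\varepsilon_i-\varepsilon_j$, $\varepsilon_i+\varepsilon_j$, $2\varepsilon_i$ of type $C_n$. Their reflections are $t_{ij}t_{\overline\jmath\,\overline\imath}$, $t_{i\overline\jmath}t_{j\overline\imath}$, $t_{i\overline\imath}$ respectively, where $t_{ab}$ is the transposition of $a$ and $b$. Put $\rho=(n,n-1,\dots,1)$ and $\beta^\vee=2\beta/\langle\beta,\beta\rangle$. The symbol $<$ on $W$ denotes the Bruhat order. Let $\mu=(\mu_1\ge\dots\ge\mu_n\ge 0)$ be a partition with conjugate $\mu'$. For $1\le k\le n$ let $\Gamma(k)=\Gamma_r(k)\Gamma_l(k)$,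 where $\Gamma_r(k)=\Gamma_2\cdots\Gamma_k$ and $\Gamma_l(k)=\Gamma_{k1}\cdots\Gamma_{kk}$, with $$\Gamma_i=((1,\overline\imath),\dots,(i-1,\overline\imath)),$$ $$\Gamma_{ki}=((1,\overline\imath),\dots,(i-1,\overline\imath),\,(i,\overline{k+1}),\dots,(i,\overline n),\,(i,\overline\imath),\,(i,n),(i,n-1),\dots,(i,k+1)).$$ Let $\Gamma=\Gamma^{\mu_1}\cdots\Gamma^1=(\beta_1,\dots,\beta_m)$ with $\Gamma^j=\Gamma(\mu'_j)$. \textbf{Folding pairs.} For $w\in W$ and $J=\{j_1<\dots<j_s\}\subseteq\{1,\dots,m\}$, let $T$ be the subsequence of $\Gamma$ in positions $J$. Let $w_i=w s_{\beta_{j_1}}\cdots s_{\beta_{j_i}}$, ${\rm end}(w,T)=w_s$ and $J^-=\{j_i: w_{i-1}<w_i\}$. Let $\overline{\mathcal F}(\mu)$ be the set of pairs $(w,T)$ with $$\tfrac12\bigl(\ell(w)+\ell({\rm end}(w,T))-\#J\bigr)+\sum_{j\in J^-}\langle\rho,\beta_j^\vee\rangle=0 .$$ Let ${\rm level}(w,T)=\sum_{j\in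 J^-}l_j$, where $l_j=\#\{i\le j:\beta_i=\beta_j\}$. \textbf{Fillings.} Factor $T=T^{\mu_1}\cdots T^1$ and $T^j=T^j_rT^j_l$ according to $\Gamma^j=\Gamma_r(\mu'_j)\Gamma_l(\mu'_j)$. Put $\pi^j_r=wT^{\mu_1}\cdots T^{j+1}$ and $\pi^j_l=\pi^j_rT^j_r$. Let $f(w,T)$ be the filling of the shape $2\mu$ with columns $C_r^{\mu_1}C_l^{\mu_1}\cdots C_r^1C_l^1$, displayed from left to right (shortest to longest), where $C^j_r$ and $C^j_l$ consist of the first $\mu'_j$ entries of $\pi^j_r(1)\cdots\pi^j_r(n)$ and of $\pi^j_l(1)\cdots\pi^j_l(n)$. The map ${\rm ord}$ sorts each column increasingly. A cell of a filling is a descent if the column immediately to its left has a cell in the same row and the entry of the given cell is larger than the entry of that cell. ${\rm Des}(\sigma)$ is the set of descents of $\sigma$, and ${\rm arm}(c)$ is the number of cells to the left of $c$ in its row. \textbf{Charge.} Label the columns from longest to shortest (right to left) by $1,1',2,2',\dots$, so that $C^j_l$ has label $j$ and $C^j_r$ has label $j'$; order the labels by $1<1'<2<2'<\cdots$. For a filling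 $\tau$ take all biletters $\binom{k}{j}$, one for each entry $k$ in the column labelled $j$. Order them by decreasing $k$ and, for equal $k$, by decreasing $j$; the word of lower letters is ${\rm cw}_2(\tau)$. Let $u$ be a word in the letters $1,1',2,2',\dots$ with as many $j$ as $j'$ and at least as many $j$ as $j+1$, for all $j$. Scan $u$ from right to left and select $1,1',2,2',\dots$ in this order as long as possible. Each time take the first available letter to the left of the previously selected one or, if there is none, the first one from the right end of $u$. If the selected letters are $1,1',\dots,k,k'$, this iteration contributes the sum of $k-j$ over those $j$ for which the selected $j+1$ is to the right of the selected $j'$. Remove the selected letters and repeat until $u$ is empty. If in every iteration each selected $j'$ is to the left of the selected $j$, then ${\rm charge}(u)$ is defined, as the sum of all contributions. \textbf{Theorem.} Let $(w,T)\in\overline{\mathcal F}(\mu)$, $\sigma=f(w,T)$ and $\tau={\rm ord}(\sigma)$. Then ${\rm charge}({\rm cw}_2(\tau))$ is defined (that is, ${\rm cw}_2(\tau)$ satisfies the conditions above), and $${\rm level}(w,T)=\frac12\sum_{c\in{\rm Des}(\sigma)}{\rm arm}(c)={\rm charge}({\rm cw}_2(\tau)).$$ -/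

import Mathlib

namespace TypeC

/-! ### Signed permutations and the root system of type `C_n` -/

/-- The ordered alphabet `1 < 2 < ⋯ < n < n̄ < ⋯ < 2̄ < 1̄`, as `Fin (2 * n)`: the value `v < n` is
the unbarred letter `v + 1`, and the bar involution is the order reversal `Fin.rev`. -/
abbrev Letter (n : ℕ) := Fin (2 * n)

/-- The unbarred letter `i` (rows and coordinates are indexed by `Fin n`). -/
def pos {n : ℕ} (i : Fin n) : Letter n := Fin.castLE (by omega) i

/-- The barred letter `ī`. -/
def bar {n : ℕ} (i : Fin n) : Letter n := Fin.rev (pos i)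

/-- The absolute value of a letter, as an unbarred letter. -/
def absLetter {n : ℕ} (l : Letter n) : Letter n := min l (Fin.rev l)

/-- The Weyl group `B_n` of type `C_n`: the signed permutations, i.e. the permutations `w` of the
alphabet with `w(ī) = \overline{w(i)}`. -/
def W (n : ℕ) : Subgroup (Equiv.Perm (Letter n)) where
  carrier := {w | ∀ i, w (Fin.rev i) = Fin.rev (w i)}
  mul_mem' := by
    intro a b ha hb i
    simp only [Equiv.Perm.mul_apply]
    rw [hb i, ha (b i)]
  one_mem' := by
    intro i
    rfl
  inv_mem' := by
    intro a ha i
    rw [Equiv.Perm.inv_eq_iff_eq, ha, ← Equiv.Perm.mul_apply, mul_inv_cancel, Equiv.Perm.one_apply]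

/-- The length of a signed permutation:
`ℓ(w) = #{(k, l) ∈ [n] × [n̄] : k ≤ |l|, w(k) > w(l)}`. -/
def length {n : ℕ} (w : W n) : ℕ :=
  (Finset.univ.filter fun p : Fin n × Letter n =>
    pos p.1 ≤ absLetter p.2 ∧ w.1 p.2 < w.1 (pos p.1)).card

/-- Names of roots by pairs of letters: `(i, j)`, `(i, j̄)`, `(i, ī)` stand for `ε_i - ε_j`,
`ε_i + ε_j`, `2 ε_i`. -/
abbrev Root (n : ℕ) := Letter n × Letter n

/-- The pairs `(i, j)`, `(i, j̄)` with `i < j` and `(i, ī)`, which name each positive root once. -/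
def IsPosRoot {n : ℕ} (β : Root n) : Prop := β.1 < β.2 ∧ β.1 ≤ Fin.rev β.2

/-- The vector `ε_a`, where `ε_{ī} = - ε_i`. -/
def eps {n : ℕ} (a : Letter n) : Fin n → ℚ := fun i =>
  if a = pos i then 1 else if a = bar i then -1 else 0

/-- The root named by a pair of letters, as a vector in `ℚ^n`. -/
def rootVec {n : ℕ} (β : Root n) : Fin n → ℚ := eps β.1 - eps β.2

/-- The coroot `2 α / ⟨α, α⟩`. -/
def coroot {n : ℕ} (β : Root n) : Fin n → ℚ :=
  (2 / (rootVec β ⬝ᵥ rootVec β)) • rootVec β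

/-- `ρ = (n, n - 1, …, 1)`. -/
def rho (n : ℕ) : Fin n → ℚ := fun i => (n : ℚ) - (i : ℕ)

/-- The reflection of a root as a permutation of the alphabet: `t_{ij} t_{j̄ ī}` for `(i, j)`,
`t_{i j̄} t_{j ī}` for `(i, j̄)`, and `t_{i ī}` for `(i, ī)`. -/
def reflPerm {n : ℕ} (β : Root n) : Equiv.Perm (Letter n) :=
  if β.2 = Fin.rev β.1 then Equiv.swap β.1 β.2
  else Equiv.swap β.1 β.2 * Equiv.swap (Fin.rev β.2) (Fin.rev β.1)

theorem reflPerm_mem {n : ℕ} (β : Root n) : reflPerm β ∈ W n := by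
  obtain ⟨a, b⟩ := β
  intro i
  have ha := a.isLt
  have hb := b.isLt
  have hi := i.isLt
  unfold reflPerm
  split_ifs with h
  · simp only [Equiv.swap_apply_def, Fin.ext_iff, Fin.val_rev] at h ⊢
    grind
  · simp only [Equiv.Perm.mul_apply, Equiv.swap_apply_def, Fin.ext_iff, Fin.val_rev] at h ⊢
    grind

/-- The reflection `s_β` in the Weyl group. -/
def refl {n : ℕ} (β : Root n) : W n := ⟨reflPerm β, reflPerm_mem β⟩

/-- The (strict) Bruhat order: the transitive closure of the relations `u < u s_β`, for positive
roots `β` with `ℓ(u) < ℓ(u s_β)`. -/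
def BruhatLT {n : ℕ} : W n → W n → Prop :=
  Relation.TransGen fun u v => ∃ β, IsPosRoot β ∧ v = u * refl β ∧ length u < length v

/-! ### Folding pairs for a chain of roots -/

section Folding

variable {n : ℕ} (Γ : List (Root n)) (w : W n) (J : Finset (Fin Γ.length))

/-- `w` multiplied on the right by the reflections in the roots of `Γ` at those positions of `J`
which are among the first `p` positions of `Γ`, from left to right. -/
def partialProd (p : ℕ) : W n :=
  w * (((List.finRange Γ.length).filter fun i => i ∈ J ∧ i.val < p).map
    fun i => refl (Γ.get i)).prod

/-- `end(w, J)`. -/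
def endpoint : W n := partialProd Γ w J Γ.length

open Classical in
/-- The set `J⁻` of negative foldings: those `j = j_i ∈ J` with `w_{i-1} < w_i`, where
`w_{i-1}` and `w_i` are the elements before and after multiplication by the reflection of `j`. -/
noncomputable def negFoldings : Finset (Fin Γ.length) :=
  J.filter fun j => BruhatLT (partialProd Γ w J j.val) (partialProd Γ w J (j.val + 1))

/-- The affine level `l_j = #{i ≤ j : β_i = β_j}`. -/
def affineLevel (j : Fin Γ.length) : ℕ :=
  (Finset.univ.filter fun i : Fin Γ.length => i ≤ j ∧ Γ.get i = Γ.get j).card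

/-- `level(w, J)`, the sum of the affine levels of the negative foldings. -/
noncomputable def level : ℕ := ∑ j ∈ negFoldings Γ w J, affineLevel Γ j

/-- The folding pairs that index the terms of the Ram-Yip formula at `t = 0`:
`(ℓ(w) + ℓ(end(w, J)) - #J) / 2 + ∑_{j ∈ J⁻} ⟨ρ, β_j^∨⟩ = 0`. -/
def IsAdmissible : Prop :=
  (1 / 2 : ℚ) * ((length w : ℚ) + (length (endpoint Γ w J) : ℚ) - (J.card : ℚ))
    + ∑ j ∈ negFoldings Γ w J, rho n ⬝ᵥ coroot (Γ.get j) = 0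

end Folding

/-! ### The chain of roots attached to a partition -/

/-- `Γ_i = ((1, ī), (2, ī), …, (i-1, ī))`. -/
def gammaRow {n : ℕ} (i : Fin n) : List (Root n) :=
  ((List.finRange n).filter fun j => j < i).map fun j => (pos j, bar i)

/-- `Γ_r(k) = Γ_2 ⋯ Γ_k` (here with the empty segment `Γ_1` added). -/
def gammaR (n k : ℕ) : List (Root n) :=
  ((List.finRange n).filter fun i => i.val < k).flatMap gammaRow

/-- `Γ_{ki}`: the roots `(1, ī), …, (i-1, ī)`, then `(i, \overline{k+1}), …, (i, n̄)`, then `(i, ī)`,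
then `(i, n), (i, n-1), …, (i, k+1)`. -/
def gammaKI {n : ℕ} (k : ℕ) (i : Fin n) : List (Root n) :=
  gammaRow i
    ++ ((List.finRange n).filter fun j => k ≤ j.val).map (fun j => (pos i, bar j))
    ++ [(pos i, bar i)]
    ++ ((List.finRange n).filter fun j => k ≤ j.val).reverse.map (fun j => (pos i, pos j))

/-- `Γ_l(k) = Γ_{k1} ⋯ Γ_{kk}`. -/
def gammaL (n k : ℕ) : List (Root n) :=
  ((List.finRange n).filter fun i => i.val < k).flatMap (gammaKI k)

/-- The `ω_k`-chain `Γ(k) = Γ_r(k) Γ_l(k)`. -/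
def gamma (n k : ℕ) : List (Root n) := gammaR n k ++ gammaL n k

/-- The height `μ'_{j+1}` of the column number `j + 1` of `μ` (so `j` starts at `0`). -/
def colHeight {n : ℕ} (μ : Fin n → ℕ) (j : ℕ) : ℕ :=
  (Finset.univ.filter fun i => j < μ i).card

/-- The largest part `μ_1`, i.e. the number of columns. -/
def numCols {n : ℕ} (μ : Fin n → ℕ) : ℕ := Finset.univ.sup μ

/-- The `μ`-chain `Γ = Γ^{μ_1} ⋯ Γ^2 Γ^1`, where `Γ^j = Γ(μ'_j)`. -/
def muChain {n : ℕ} (μ : Fin n → ℕ) : List (Root n) :=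
  (List.range (numCols μ)).reverse.flatMap fun j => gamma n (colHeight μ j)

/-- The initial part `Γ^{μ_1} ⋯ Γ^{j+2}` of `muChain μ`, to the left of `Γ^{j+1}`. -/
def chainBefore {n : ℕ} (μ : Fin n → ℕ) (j : ℕ) : List (Root n) :=
  ((List.range (numCols μ)).reverse.filter fun m => j < m).flatMap
    fun m => gamma n (colHeight μ m)

/-! ### Fillings, descents and arms -/

/-- A filling, as the list of its columns from longest to shortest, i.e. from right to left in the
display; each column is read from top to bottom. -/
abbrev Filling (n : ℕ) := List (List (Letter n))

/-- `u[1, k]`: the first `k` entries of a signed permutation in window notation. -/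
def window {n : ℕ} (u : W n) (k : ℕ) : List (Letter n) :=
  ((List.finRange n).filter fun i => i.val < k).map fun i => u.1 (pos i)

section Fill

variable {n : ℕ} (μ : Fin n → ℕ) (w : W n) (J : Finset (Fin (muChain μ).length))

/-- The column `C_r^{j+1} = π_r^{j+1}[1, μ'_{j+1}]`, with `π_r^j = w T^{μ_1} ⋯ T^{j+1}`. -/
def colR (j : ℕ) : List (Letter n) :=
  window (partialProd (muChain μ) w J (chainBefore μ j).length) (colHeight μ j)

/-- The column `C_l^{j+1} = π_l^{j+1}[1, μ'_{j+1}]`, with `π_l^j = π_r^j T_r^j`. -/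
def colL (j : ℕ) : List (Letter n) :=
  window (partialProd (muChain μ) w J
    ((chainBefore μ j).length + (gammaR n (colHeight μ j)).length)) (colHeight μ j)

/-- The filling map: `f(w, T)` is the filling `C_r^{μ_1} C_l^{μ_1} ⋯ C_r^1 C_l^1` of `2 μ`. -/
def fillingMap : Filling n :=
  (List.range (numCols μ)).flatMap fun j => [colL μ w J j, colR μ w J j]

end Fill

/-- Sorting every column increasingly. -/
def ord {n : ℕ} (σ : Filling n) : Filling n := σ.map fun C => C.insertionSort (· ≤ ·)

/-- The cells `(c, i)` of a filling: row `i` of the column `c` (both starting at `0`). -/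
def cells {n : ℕ} (σ : Filling n) : Finset (Σ _ : ℕ, ℕ) :=
  (Finset.range σ.length).sigma fun c => Finset.range (σ.getD c []).length

/-- The entry in column `c` and row `i` is larger than the entry in the next column and row `i`,
and the latter is defined. -/
def IsDescent {n : ℕ} (σ : Filling n) (c i : ℕ) : Prop :=
  ∃ a b, (σ.getD c [])[i]? = some a ∧ (σ.getD (c + 1) [])[i]? = some b ∧ b < a

open Classical in
/-- The set of descents of a filling. -/
noncomputable def Des {n : ℕ} (σ : Filling n) : Finset (Σ _ : ℕ, ℕ) :=
  (cells σ).filter fun x => IsDescent σ x.1 x.2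

/-- The arm length: the number of cells in the same row and further columns (these are displayed
to the left). -/
def arm {n : ℕ} (σ : Filling n) (x : Σ _ : ℕ, ℕ) : ℕ :=
  ((cells σ).filter fun y => y.2 = x.2 ∧ x.1 < y.1).card

/-! ### The charge word and the charge

The alphabet `1 < 1' < 2 < 2' < ⋯` is coded by `0 < 1 < 2 < 3 < ⋯`: the letter `j` is `2 (j - 1)`
and the letter `j'` is `2 (j - 1) + 1`. The column number `c` of a filling (starting at `0`) has
the label coded by `c`. -/

/-- The biletters `(k, c)` of a filling, one for each entry `k` in column `c`. -/
def biletters {n : ℕ} (τ : Filling n) : List (Letter n × ℕ) :=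
  τ.zipIdx.flatMap fun x => x.1.map fun k => (k, x.2)

/-- The charge word `cw(τ)`: the biletters in decreasing order of the entries, and for equal
entries in decreasing order of the column labels. -/
def cw {n : ℕ} (τ : Filling n) : List (Letter n × ℕ) :=
  (biletters τ).insertionSort fun x y => y.1 < x.1 ∨ (y.1 = x.1 ∧ y.2 ≤ x.2)

/-- The word of the column labels in the charge word. -/
def cw₂ {n : ℕ} (τ : Filling n) : List ℕ := (cw τ).map Prod.snd

/-- The first position with letter `x`, scanning from right to left, among the available positions
satisfying `P`. -/
def scan (u : List ℕ) (A : Finset (Fin u.length)) (x : ℕ) (P : Fin u.length → Bool) :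
    Option (Fin u.length) :=
  (List.finRange u.length).reverse.find? fun q => q ∈ A ∧ u.get q = x ∧ P q

/-- One iteration of the selection, continued from the letter `x`, where `prev` is the previously
selected position (if any): select the first available `x` to the left of `prev`, or, if there is
none, the first available `x` from the right end of the word; then go on with the next letter,
until no letter can be selected. The first argument bounds the number of selections. -/
def selectFrom (u : List ℕ) (A : Finset (Fin u.length)) :
    ℕ → Option (Fin u.length) → ℕ → List (Fin u.length)
  | 0, _, _ => []
  | m + 1, prev, x =>
    match (scan u A x fun q => ∀ p ∈ prev, q < p).or (scan u A x fun _ => true) with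
    | none => []
    | some q => q :: selectFrom u A m (some q) (x + 1)

/-- The positions selected in one iteration (a selection of distinct letters has at most
`u.length` steps). -/
def selection (u : List ℕ) (A : Finset (Fin u.length)) : List (Fin u.length) :=
  selectFrom u A u.length none 0

/-- The selections of the successive iterations, the selected positions being removed after each
iteration, until no position is left. The first argument bounds the number of iterations. -/
def iterationsFrom (u : List ℕ) : ℕ → Finset (Fin u.length) → List (List (Fin u.length))
  | 0, _ => []
  | m + 1, A =>
    if A = ∅ then [] else selection u A :: iterationsFrom u m (A \ (selection u A).toFinset)

/-- The selections made by the charge algorithm on the word `u`. -/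
def iterations (u : List ℕ) : List (List (Fin u.length)) :=
  iterationsFrom u u.length Finset.univ

/-- The conditions under which the charge of a word is defined: it has as many letters `j` as `j'`,
at least as many letters `j` as `j + 1`, and in the charge algorithm a selected `j'` is always to
the left of the previously selected `j`. -/
def HasCharge (u : List ℕ) : Prop :=
  (∀ j, u.count (2 * j) = u.count (2 * j + 1)) ∧
  (∀ j, u.count (2 * (j + 1)) ≤ u.count (2 * j)) ∧
  ∀ s ∈ iterations u, ∀ j (h : 2 * j + 1 < s.length), s[2 * j + 1] < s[2 * j]

/-- The contribution of an iteration selecting `1, 1', …, k, k'`: the sum of `k - j` over the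
selected `j + 1` to the right of the previously selected `j'` (below, `j` is shifted by one). -/
def contribution {m : ℕ} (s : List (Fin m)) : ℕ :=
  ∑ j ∈ Finset.range (s.length / 2),
    if ∃ h : 2 * j + 2 < s.length, s[2 * j + 1] < s[2 * j + 2] then s.length / 2 - (j + 1) else 0

/-- The type `C` charge of a word. -/
def charge (u : List ℕ) : ℕ := ((iterations u).map contribution).sum

end TypeC

/-! The admissibility condition is extremal. Every reflection satisfies 1 ≤ |ℓ(x s_β) - ℓ(x)| ≤
2⟨ρ,β^∨⟩ - 1. Twice the left side of the condition therefore splits into 2ℓ(end) plus one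
nonnegative defect for each folding. Hence end(w,T) = 1, and the foldings read backwards form a path
from 1 to w in the quantum Bruhat graph; its quantum (length-decreasing) steps are the negative
foldings (`IsAdmissible.key`, `IsAdmissible.exists_rpath`). Only a necessary, circular-order
condition for edges is needed (`Edge`, `length_change`). In particular, roots (i, j̄) with i ≠ j
label only upward, sign-preserving steps.

The core is an analysis of such a path on one reversed block Γ_l(k), leading from u to y
(`RPath.gammaL`). Rows are settled from k up to 1. In circular order starting at u(p), the entry
y(p) is the first among y(p), …, y(k), and the row p owns one quantum step if y(p) < u(p) and none
otherwise. The difficulty is that the roots (j, ī) at the end of the segment of row i also move rows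
j < i whose turn has not come. The invariants `Pending`, `Core`, `Marked` and `Visible` control
this: an interval around u(p) is kept free of the relevant entries, and its ends are guarded by
values in positions which later edges cannot jump over. A block Γ_r(k) is a subword of Γ_l(k)
without quantum steps, so the same rule holds there and entries cannot decrease (`RPath.gammaR`).

This greedy circular rule is exactly the selection rule of charge. In the charge word, positions to
the left carry larger entries, so scanning leftwards with wraparound finds the first entry in
circular order. The i-th iteration therefore recovers row i of the unsorted filling
(`IsChargeWord.iterations_spec`), even though sorting has forgotten the rows. The transitions from
C_l to C_r never descend, which makes the charge defined.

Finally, all three quantities equal the sum of `blockLevel`: a descent in row p from C_r^t to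
C_l^{t+1} has arm 2(μ_p - t), contributes μ_p - t to the charge, and corresponds to one quantum
step. The root of that step occurs once in Γ_l for each column of index t+1, …, μ_p and never in
Γ_r, so its affine level is also μ_p - t (`affineLevel_eq`). -/

namespace TypeC

/-! ### Inversions and the length function -/

/-- The number of inversions of a map between finite linear orders. -/
def inversions {α β : Type*} [Fintype α] [LinearOrder α] [LinearOrder β] (f : α → β) : ℤ :=
  ∑ x, ∑ y, if x < y ∧ f y < f x then 1 else 0

theorem sum_eq_add_add_sum_erase {α : Type*} [Fintype α] [DecidableEq α] {a b : α} (hab : a ≠ b)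
    (h : α → ℤ) : ∑ x, h x = h a + h b + ∑ x ∈ (Finset.univ.erase a).erase b, h x := by
  rw [add_assoc, Finset.add_sum_erase _ _ (by simp [hab.symm]),
    Finset.add_sum_erase _ _ (Finset.mem_univ a)]

/-- Only pairs meeting {a, b} can change. The pair (a, b) becomes an inversion; a third position c
gains two inversions if its position and its value both lie between those of a and b, and none on
balance otherwise. -/
theorem inversions_comp_swap {α β : Type*} [Fintype α] [LinearOrder α] [LinearOrder β]
    {f : α → β} (hf : Function.Injective f) {a b : α} (hab : a < b) (h : f a < f b) :
    inversions (f ∘ Equiv.swap a b) = inversions f + 1 +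
      2 * ((Finset.univ.filter fun c => (a < c ∧ c < b) ∧ (f a < f c ∧ f c < f b)).card : ℤ) := by
  set s := Equiv.swap a b with hs
  -- Reindexing along s leaves the values f x, f y in place and alters only the comparison of
  -- positions, so pairs disjoint from {a, b} cancel termwise.
  have h1 : inversions (f ∘ s) = ∑ x, ∑ y, if s x < s y ∧ f y < f x then (1 : ℤ) else 0 := by
    unfold inversions
    rw [← Equiv.sum_comp s]
    refine Finset.sum_congr rfl fun x _ => ?_
    rw [← Equiv.sum_comp s]
    simp [hs]
  set g : α → α → ℤ := fun x y =>
    (if s x < s y ∧ f y < f x then (1 : ℤ) else 0) - if x < y ∧ f y < f x then 1 else 0 with hg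
  have h2 : inversions (f ∘ s) - inversions f = ∑ x, ∑ y, g x y := by
    rw [h1, inversions, ← Finset.sum_sub_distrib]
    refine Finset.sum_congr rfl fun x _ => ?_
    rw [← Finset.sum_sub_distrib]
  set R := (Finset.univ.erase a).erase b with hR
  have hmem : ∀ c ∈ R, c ≠ a ∧ c ≠ b := by
    intro c hc
    simp only [hR, Finset.mem_erase] at hc
    tauto
  have sa : s a = b := by simp [hs]
  have sb : s b = a := by simp [hs]
  have sc : ∀ c ∈ R, s c = c := fun c hc => Equiv.swap_apply_of_ne_of_ne (hmem c hc).1 (hmem c hc).2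
  have h3 : ∑ x, ∑ y, g x y = g a a + g a b + g b a + g b b +
      ∑ c ∈ R, (g a c + g c a + g b c + g c b) := by
    rw [sum_eq_add_add_sum_erase hab.ne fun x => ∑ y, g x y,
      sum_eq_add_add_sum_erase hab.ne (g a), sum_eq_add_add_sum_erase hab.ne (g b)]
    have : ∑ x ∈ R, ∑ y, g x y = ∑ x ∈ R, (g x a + g x b) := by
      refine Finset.sum_congr rfl fun x hx => ?_
      rw [sum_eq_add_add_sum_erase hab.ne (g x)]
      have : ∑ y ∈ R, g x y = 0 := by
        refine Finset.sum_eq_zero fun y hy => ?_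
        simp only [hg, sc x hx, sc y hy, sub_self]
      rw [this, add_zero]
    rw [this]
    simp only [Finset.sum_add_distrib]
    ring
  have h4 : g a a + g a b + g b a + g b b = 1 := by
    simp only [hg, sa, sb]
    simp [hab, h, hab.not_gt, h.not_gt]
  have h5 : ∑ c ∈ R, (g a c + g c a + g b c + g c b) =
      ∑ c ∈ R, 2 * (if (a < c ∧ c < b) ∧ (f a < f c ∧ f c < f b) then (1 : ℤ) else 0) := by
    refine Finset.sum_congr rfl fun c hc => ?_
    obtain ⟨hca, hcb⟩ := hmem c hc
    have hfa := hf.ne hca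
    have hfb := hf.ne hcb
    simp only [hg, sa, sb, sc c hc]
    rcases lt_or_gt_of_ne hca with h1 | h1 <;> rcases lt_or_gt_of_ne hcb with h2 | h2 <;>
    rcases lt_or_gt_of_ne hfa with h3 | h3 <;> rcases lt_or_gt_of_ne hfb with h4 | h4 <;>
    simp [h1, h2, h3, h4, h1.not_gt, h2.not_gt, h3.not_gt, h4.not_gt]
    all_goals order
  have h6 : ∑ c ∈ R, (if (a < c ∧ c < b) ∧ (f a < f c ∧ f c < f b) then (1 : ℤ) else 0) =
      ((Finset.univ.filter fun c => (a < c ∧ c < b) ∧ (f a < f c ∧ f c < f b)).card : ℤ) := by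
    rw [Finset.card_filter, Nat.cast_sum, sum_eq_add_add_sum_erase hab.ne]
    simp [hR]
  rw [h3, h4, h5, ← Finset.mul_sum, h6] at h2
  linarith

/-- The number of `i` with `w(i)` barred. -/
def negCount {n : ℕ} (w : W n) : ℤ :=
  ∑ x : Letter n, if x.val < n ∧ n ≤ (w.1 x).val then 1 else 0

theorem apply_rev {n : ℕ} (w : W n) (i : Letter n) : w.1 (Fin.rev i) = Fin.rev (w.1 i) := w.2 i

theorem sum_pos_ite {n : ℕ} (P : Letter n → Prop) [DecidablePred P] :
    ∑ i : Fin n, (if P (pos i) then (1 : ℤ) else 0) =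
      ∑ x : Letter n, if x.val < n ∧ P x then 1 else 0 := by
  simp only [← Finset.sum_filter, Finset.sum_const, nsmul_eq_mul, mul_one]
  congr 1
  refine Finset.card_bij (fun i _ => pos i) ?_ ?_ ?_
  · intro i hi
    rw [Finset.mem_filter] at hi ⊢
    exact ⟨Finset.mem_univ _, i.isLt, hi.2⟩
  · intro i _ j _ h
    simpa [pos] using h
  · intro x hx
    simp only [Finset.mem_filter, Finset.mem_univ, true_and] at hx
    exact ⟨⟨x.val, hx.1⟩, by rw [Finset.mem_filter]; exact ⟨Finset.mem_univ _, hx.2⟩, rfl⟩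

/-- Inversions with `x + y ≤ 2n - 1` are those counted by ℓ, and (x, y) ↦ (ȳ, x̄) carries them to
those with `x + y ≥ 2n - 1`. The overlap consists of the inverted pairs (x, x̄), of which there are
`negCount w`. -/
theorem two_mul_length {n : ℕ} (w : W n) :
    2 * (length w : ℤ) = inversions w.1 + negCount w := by
  have h1 : (length w : ℤ) = ∑ x : Letter n, ∑ y : Letter n,
      if x < y ∧ w.1 y < w.1 x ∧ x.val + y.val ≤ 2 * n - 1 then 1 else 0 := by
    rw [length, Finset.card_filter, Nat.cast_sum, Fintype.sum_prod_type]
    have : ∀ y : Letter n, ∑ i : Fin n,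
        (if pos i ≤ absLetter y ∧ w.1 y < w.1 (pos i) then (1 : ℤ) else 0) =
        ∑ x : Letter n, if x < y ∧ w.1 y < w.1 x ∧ x.val + y.val ≤ 2 * n - 1 then 1 else 0 := by
      intro y
      rw [sum_pos_ite fun x => x ≤ absLetter y ∧ w.1 y < w.1 x]
      refine Finset.sum_congr rfl fun x _ => if_congr ?_ rfl rfl
      have hx := x.isLt
      have hy := y.isLt
      have : x = y → ¬ w.1 y < w.1 x := by rintro rfl; simp
      simp only [absLetter, le_min_iff, Fin.le_def, Fin.lt_def, Fin.val_rev, Fin.ext_iff] at this ⊢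
      constructor
      · rintro ⟨h1, ⟨h2, h3⟩, h4⟩
        refine ⟨?_, h4, by omega⟩
        by_contra h
        exact this (by omega) h4
      · rintro ⟨h1, h2, h3⟩
        exact ⟨by omega, ⟨by omega, by omega⟩, h2⟩
    push_cast
    rw [Finset.sum_comm, Finset.sum_congr rfl fun y _ => this y, Finset.sum_comm]
  have h2 : (length w : ℤ) = ∑ x : Letter n, ∑ y : Letter n,
      if x < y ∧ w.1 y < w.1 x ∧ 2 * n - 1 ≤ x.val + y.val then 1 else 0 := by
    rw [h1, ← Equiv.sum_comp Fin.revPerm, Finset.sum_comm, ← Equiv.sum_comp Fin.revPerm]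
    refine Finset.sum_congr rfl fun x _ => Finset.sum_congr rfl fun y _ => if_congr ?_ rfl rfl
    have hx := x.isLt
    have hy := y.isLt
    simp only [Fin.revPerm_apply, apply_rev, Fin.rev_lt_rev, Fin.val_rev]
    refine and_congr Iff.rfl (and_congr Iff.rfl ?_)
    omega
  have h3 : negCount w = ∑ x : Letter n, ∑ y : Letter n,
      if x < y ∧ w.1 y < w.1 x ∧ x.val + y.val = 2 * n - 1 then 1 else 0 := by
    unfold negCount
    refine Finset.sum_congr rfl fun x _ => ?_
    rw [Finset.sum_eq_single (Fin.rev x)]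
    · refine if_congr ?_ rfl rfl
      have hx := x.isLt
      have hy := (w.1 x).isLt
      simp only [apply_rev, Fin.lt_def, Fin.val_rev]
      omega
    · intro y _ hy
      rw [if_neg]
      rintro ⟨-, -, h⟩
      apply hy
      have hx := x.isLt
      ext
      simp only [Fin.val_rev]
      omega
    · simp
  have h4 : 2 * (length w : ℤ) = length w + length w := by ring
  rw [h4]
  nth_rewrite 1 [h1]
  rw [h2, h3, inversions, ← Finset.sum_add_distrib, ← Finset.sum_add_distrib]
  refine Finset.sum_congr rfl fun x _ => ?_
  rw [← Finset.sum_add_distrib, ← Finset.sum_add_distrib]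
  refine Finset.sum_congr rfl fun y _ => ?_
  by_cases h1 : x < y ∧ w.1 y < w.1 x
  · simp only [h1, and_self, true_and, if_true]
    split_ifs <;> omega
  · simp [← and_assoc, h1]

theorem eq_one_of_length_eq_zero {n : ℕ} {w : W n} (h : length w = 0) : w = 1 := by
  have h1 := two_mul_length w
  have h2 : 0 ≤ negCount w := Finset.sum_nonneg fun _ _ => by split_ifs <;> simp
  have h3 : 0 ≤ inversions w.1 :=
    Finset.sum_nonneg fun _ _ => Finset.sum_nonneg fun _ _ => by split_ifs <;> simp
  have h4 : inversions w.1 = 0 := by rw [h] at h1; push_cast at h1; linarith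
  have h5 : StrictMono w.1 := by
    intro x y hxy
    by_contra hlt
    have hlt' : w.1 y < w.1 x := lt_of_le_of_ne (not_lt.1 hlt) (w.1.injective.ne hxy.ne')
    have h6 := (Finset.sum_eq_zero_iff_of_nonneg (fun x _ => Finset.sum_nonneg fun y _ => by
      split_ifs <;> simp)).1 h4 x (Finset.mem_univ _)
    have h7 := (Finset.sum_eq_zero_iff_of_nonneg (fun y _ => by
      split_ifs <;> simp)).1 h6 y (Finset.mem_univ _)
    simp [hxy, hlt'] at h7
  have h8 : ∀ x, w.1 x = x := by
    intro x
    have := Subsingleton.elim (StrictMono.orderIsoOfSurjective w.1 h5 w.1.surjective)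
      (OrderIso.refl (Letter n))
    have := DFunLike.congr_fun this x
    simpa using this
  ext x
  simp [h8]

/-! ### The action of a reflection -/

theorem mul_refl_apply {n : ℕ} (x : W n) {a b : Letter n} (hab : a ≠ b) (q : Letter n) :
    (x * refl (a, b)).1 q = if q = a then x.1 b else if q = b then x.1 a else
      if q = Fin.rev a then x.1 (Fin.rev b) else if q = Fin.rev b then x.1 (Fin.rev a)
      else x.1 q := by
  simp only [refl, reflPerm, Subgroup.coe_mul, Equiv.Perm.mul_apply]
  rw [← apply_ite x.1, ← apply_ite x.1, ← apply_ite x.1, ← apply_ite x.1]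
  congr 1
  have ha := a.isLt
  have hb := b.isLt
  have hq := q.isLt
  by_cases h : b = Fin.rev a
  · subst h
    simp only [if_true, Equiv.swap_apply_def, Fin.rev_rev]
    grind
  · rw [if_neg h, Equiv.Perm.mul_apply]
    simp only [Equiv.swap_apply_def, Fin.ext_iff, Fin.val_rev] at h hab ⊢
    grind

theorem mul_refl_refl {n : ℕ} (x : W n) (β : Root n) (hβ : β.1 ≠ β.2) :
    x * refl β * refl β = x := by
  obtain ⟨a, b⟩ := β
  simp only [ne_eq] at hβ
  ext q
  have ha := a.isLt
  have hb := b.isLt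
  have hq := q.isLt
  congr 1
  rw [mul_refl_apply _ hβ]
  simp only [mul_refl_apply _ hβ]
  simp only [Fin.ext_iff, Fin.val_rev] at hβ ⊢
  grind

/-! ### Length changes under reflections -/

/-- The number of positions strictly between `a` and `b` with value strictly between `x a`
and `x b`. -/
def between {n : ℕ} (x : W n) (a b : Letter n) : ℕ :=
  (Finset.univ.filter fun c => (a < c ∧ c < b) ∧ (x.1 a < x.1 c ∧ x.1 c < x.1 b)).card

theorem between_rev {n : ℕ} (x : W n) (a b : Letter n) :
    between x (Fin.rev b) (Fin.rev a) = between x a b := by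
  refine Finset.card_equiv Fin.revPerm fun c => ?_
  simp only [Finset.mem_filter, Finset.mem_univ, true_and, Fin.revPerm_apply, apply_rev,
    Fin.lt_def, Fin.val_rev]
  have := a.isLt
  have := b.isLt
  have := c.isLt
  have := (x.1 a).isLt
  have := (x.1 b).isLt
  have := (x.1 c).isLt
  omega

theorem between_le {n : ℕ} (x : W n) (a b : Letter n) : between x a b ≤ b.val - a.val - 1 := by
  rw [← Fin.card_Ioo]
  refine Finset.card_le_card fun c hc => ?_
  simp only [Finset.mem_filter, Finset.mem_univ, true_and] at hc
  exact Finset.mem_Ioo.2 hc.1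

theorem not_between {n : ℕ} {x : W n} {a b : Letter n} (h : between x a b = 0) {c : Letter n}
    (hac : a < c) (hcb : c < b) : ¬ (x.1 a < x.1 c ∧ x.1 c < x.1 b) := by
  intro hc
  rw [between, Finset.card_eq_zero, Finset.filter_eq_empty_iff] at h
  exact h (Finset.mem_univ c) ⟨⟨hac, hcb⟩, hc⟩

theorem lt_of_between_eq {n : ℕ} {x : W n} {a b : Letter n}
    (h : between x a b = b.val - a.val - 1) {c : Letter n}
    (hac : a < c) (hcb : c < b) : x.1 a < x.1 c ∧ x.1 c < x.1 b := by
  have h1 : (Finset.univ.filter fun c => (a < c ∧ c < b) ∧ (x.1 a < x.1 c ∧ x.1 c < x.1 b)) =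
      Finset.Ioo a b := by
    refine Finset.eq_of_subset_of_card_le (fun c hc => ?_) ?_
    · simp only [Finset.mem_filter, Finset.mem_univ, true_and] at hc
      exact Finset.mem_Ioo.2 hc.1
    · rw [Fin.card_Ioo, ← h, between]
  have h2 : c ∈ Finset.Ioo a b := Finset.mem_Ioo.2 ⟨hac, hcb⟩
  rw [← h1] at h2
  exact (Finset.mem_filter.1 h2).2.2

/-- If b is unbarred, two values are exchanged between unbarred positions. If b is barred, the
unbarred positions a and b̄ receive x(b) and the bar of x(a); the count then changes only when x(a)
is unbarred and x(b) barred. -/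
theorem negCount_mul_refl {n : ℕ} (x : W n) {a b : Letter n} (hab : a < b) (ha : a < Fin.rev b)
    (h : x.1 a < x.1 b) :
    negCount (x * refl (a, b)) = negCount x +
      if n ≤ b.val ∧ (x.1 a).val < n ∧ n ≤ (x.1 b).val then 2 else 0 := by
  have ha' := a.isLt
  have hb' := b.isLt
  have hxa' := (x.1 a).isLt
  have hxb' := (x.1 b).isLt
  have hd : ∀ c : Letter n, a ≠ c → (∀ q : Letter n, q ≠ a → q ≠ c → q.val < n →
      (x * refl (a, b)).1 q = x.1 q) → negCount (x * refl (a, b)) - negCount x =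
      ((if a.val < n ∧ n ≤ ((x * refl (a, b)).1 a).val then 1 else 0)
        + (if c.val < n ∧ n ≤ ((x * refl (a, b)).1 c).val then 1 else 0))
      - ((if a.val < n ∧ n ≤ (x.1 a).val then 1 else 0)
        + (if c.val < n ∧ n ≤ (x.1 c).val then 1 else 0)) := by
    intro c hac hq
    unfold negCount
    rw [sum_eq_add_add_sum_erase hac, sum_eq_add_add_sum_erase hac fun q =>
      if q.val < n ∧ n ≤ (x.1 q).val then (1 : ℤ) else 0]
    rw [Finset.sum_congr (g := fun q => if q.val < n ∧ n ≤ (x.1 q).val then (1 : ℤ) else 0) rfl]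
    · ring
    · intro q hqm
      simp only [Finset.mem_erase, Finset.mem_univ, and_true] at hqm
      by_cases hqn : q.val < n
      · rw [hq q hqm.2 hqm.1 hqn]
      · simp [hqn]
  simp only [Fin.lt_def, Fin.val_rev] at hab ha h
  by_cases hb : n ≤ b.val
  · have hne : a ≠ Fin.rev b := by simp only [ne_eq, Fin.ext_iff, Fin.val_rev]; omega
    have h1 := hd (Fin.rev b) hne fun q h1 h2 h3 => by
      rw [mul_refl_apply _ (by rw [ne_eq, Fin.ext_iff]; omega), if_neg h1, if_neg, if_neg, if_neg h2]
      · simp only [Fin.ext_iff, Fin.val_rev]; omega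
      · simp only [Fin.ext_iff]; omega
    have hab' : a ≠ b := by rw [ne_eq, Fin.ext_iff]; omega
    have e1 : (x * refl (a, b)).1 a = x.1 b := by rw [mul_refl_apply _ hab', if_pos rfl]
    have e2 : (x * refl (a, b)).1 (Fin.rev b) = Fin.rev (x.1 a) := by
      rw [mul_refl_apply _ hab', if_neg hne.symm, if_neg, if_neg, if_pos rfl, apply_rev]
      · simpa using hab'.symm
      · simp only [Fin.ext_iff, Fin.val_rev]; omega
    rw [e1, e2, apply_rev] at h1
    simp only [Fin.val_rev] at h1
    split_ifs at h1 ⊢ <;> omega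
  · have hne : a ≠ b := by rw [ne_eq, Fin.ext_iff]; omega
    have h1 := hd b hne fun q h1 h2 h3 => by
      rw [mul_refl_apply _ hne, if_neg h1, if_neg h2, if_neg, if_neg]
      · simp only [Fin.ext_iff, Fin.val_rev]; omega
      · simp only [Fin.ext_iff, Fin.val_rev]; omega
    simp only [mul_refl_apply _ hne, hne.symm, if_true, if_false] at h1
    split_ifs at h1 ⊢ <;> omega

theorem length_mul_refl_rev {n : ℕ} (x : W n) {a : Letter n} (ha : a.val < n)
    (h : x.1 a < x.1 (Fin.rev a)) :
    length (x * refl (a, Fin.rev a)) = length x + 1 + between x a (Fin.rev a) := by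
  have ha' := a.isLt
  have hxa' := (x.1 a).isLt
  have hab : a < Fin.rev a := by simp only [Fin.lt_def, Fin.val_rev]; omega
  have h1 : ((x * refl (a, Fin.rev a)).1 : Letter n → Letter n) =
      x.1 ∘ Equiv.swap a (Fin.rev a) := by
    funext q
    simp [refl, reflPerm]
  have h2 := inversions_comp_swap x.1.injective hab h
  have h3 : negCount (x * refl (a, Fin.rev a)) = negCount x + 1 := by
    unfold negCount
    rw [← Finset.add_sum_erase _ _ (Finset.mem_univ a),
      ← Finset.add_sum_erase (Finset.univ) (fun q : Letter n =>
        if q.val < n ∧ n ≤ (x.1 q).val then (1 : ℤ) else 0) (Finset.mem_univ a)]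
    rw [Finset.sum_congr (g := fun q => if q.val < n ∧ n ≤ (x.1 q).val then (1 : ℤ) else 0) rfl]
    · rw [mul_refl_apply _ hab.ne, if_pos rfl]
      simp only [apply_rev, Fin.lt_def, Fin.val_rev] at h ⊢
      split_ifs <;> omega
    · intro q hqm
      simp only [Finset.mem_erase, Finset.mem_univ, and_true] at hqm
      by_cases hqn : q.val < n
      · have : q ≠ Fin.rev a := by simp only [ne_eq, Fin.ext_iff, Fin.val_rev]; omega
        rw [mul_refl_apply _ hab.ne, if_neg hqm, if_neg this, if_neg this, Fin.rev_rev, if_neg hqm]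
      · simp [hqn]
  have h4 := two_mul_length x
  have h5 := two_mul_length (x * refl (a, Fin.rev a))
  rw [h1, h2] at h5
  unfold between
  omega

/-- The reflection is a product of two disjoint transpositions, and `inversions_comp_swap` applies
to each in turn. When the second acts, position b already carries x(a), whence the conditional in
the last count; position a lies to the left of the range. -/
theorem inversions_mul_refl {n : ℕ} (x : W n) {a b : Letter n} (hab : a < b) (ha : a < Fin.rev b)
    (h : x.1 a < x.1 b) : inversions (x * refl (a, b)).1 = inversions x.1 + 2 + 2 * between x a b +
      2 * ((Finset.univ.filter fun c => (Fin.rev b < c ∧ c < Fin.rev a) ∧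
        (x.1 (Fin.rev b) < x.1 (if c = b then a else c) ∧
          x.1 (if c = b then a else c) < x.1 (Fin.rev a))).card : ℤ) := by
  have ha' := a.isLt
  have hb' := b.isLt
  have hxa' := (x.1 a).isLt
  have hxb' := (x.1 b).isLt
  have h1 : ((x * refl (a, b)).1 : Letter n → Letter n) =
      (x.1 ∘ Equiv.swap a b) ∘ Equiv.swap (Fin.rev b) (Fin.rev a) := by
    funext q
    simp only [refl, Subgroup.coe_mul]
    unfold reflPerm
    rw [if_neg]
    · simp
    · simp only [Fin.ext_iff, Fin.lt_def, Fin.val_rev] at ha ⊢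
      omega
  have h2 := inversions_comp_swap x.1.injective hab h
  have e1 : Equiv.swap a b (Fin.rev b) = Fin.rev b := by
    apply Equiv.swap_apply_of_ne_of_ne <;> simp only [ne_eq, Fin.ext_iff, Fin.lt_def, Fin.val_rev] at ha ⊢ <;> omega
  have e2 : Equiv.swap a b (Fin.rev a) = Fin.rev a := by
    apply Equiv.swap_apply_of_ne_of_ne <;> simp only [ne_eq, Fin.ext_iff, Fin.lt_def, Fin.val_rev] at ha hab ⊢ <;> omega
  have h3 := inversions_comp_swap (f := x.1 ∘ Equiv.swap a b) (a := Fin.rev b) (b := Fin.rev a)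
    (x.1.injective.comp (Equiv.injective _)) (Fin.rev_lt_rev.2 hab)
    (by simpa [e1, e2, apply_rev] using h)
  rw [h1, h3, h2]
  simp only [Function.comp_apply, e1, e2]
  have h4 : (Finset.univ.filter fun c => (Fin.rev b < c ∧ c < Fin.rev a) ∧
        (x.1 (Fin.rev b) < x.1 (Equiv.swap a b c) ∧ x.1 (Equiv.swap a b c) < x.1 (Fin.rev a))) =
      (Finset.univ.filter fun c => (Fin.rev b < c ∧ c < Fin.rev a) ∧
        (x.1 (Fin.rev b) < x.1 (if c = b then a else c) ∧
          x.1 (if c = b then a else c) < x.1 (Fin.rev a))) := by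
    refine Finset.filter_congr fun c _ => and_congr_right fun hc => ?_
    have : Equiv.swap a b c = if c = b then a else c := by
      rw [Equiv.swap_apply_def, if_neg]
      rintro rfl
      exact absurd (ha.trans hc.1) (lt_irrefl _)
    rw [this]
  rw [h4]
  unfold between
  ring

theorem length_mul_refl_of_lt {n : ℕ} (x : W n) {a b : Letter n} (hab : a < b) (hb : b.val < n)
    (h : x.1 a < x.1 b) : length (x * refl (a, b)) = length x + 1 + 2 * between x a b := by
  have ha : a < Fin.rev b := by simp only [Fin.lt_def, Fin.val_rev] at hab ⊢; omega
  have h1 := inversions_mul_refl x hab ha h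
  have h2 := negCount_mul_refl x hab ha h
  rw [if_neg (by omega)] at h2
  have h3 : (Finset.univ.filter fun c => (Fin.rev b < c ∧ c < Fin.rev a) ∧
        (x.1 (Fin.rev b) < x.1 (if c = b then a else c) ∧
          x.1 (if c = b then a else c) < x.1 (Fin.rev a))).card =
      between x (Fin.rev b) (Fin.rev a) := by
    unfold between
    congr 1
    refine Finset.filter_congr fun c _ => and_congr_right fun hc => ?_
    rw [if_neg]
    rintro rfl
    simp only [Fin.lt_def, Fin.val_rev] at hc
    omega
  rw [h3, between_rev] at h1
  have h4 := two_mul_length x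
  have h5 := two_mul_length (x * refl (a, b))
  omega

theorem length_mul_refl_of_ge {n : ℕ} (x : W n) {a b : Letter n} (hb : n ≤ b.val)
    (ha : a < Fin.rev b) (h : x.1 a < x.1 b) (hs : (x.1 a).val < n ↔ (x.1 b).val < n) :
    length (x * refl (a, b)) = length x + 1 + 2 * between x a b := by
  have ha' := a.isLt
  have hb' := b.isLt
  have hab : a < b := by simp only [Fin.lt_def, Fin.val_rev] at ha ⊢; omega
  have h1 := inversions_mul_refl x hab ha h
  have h2 := negCount_mul_refl x hab ha h
  rw [if_neg (by omega)] at h2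
  have h3 : (Finset.univ.filter fun c => (Fin.rev b < c ∧ c < Fin.rev a) ∧
        (x.1 (Fin.rev b) < x.1 (if c = b then a else c) ∧
          x.1 (if c = b then a else c) < x.1 (Fin.rev a))).card =
      between x (Fin.rev b) (Fin.rev a) := by
    unfold between
    congr 1
    refine Finset.filter_congr fun c _ => and_congr_right fun hc => ?_
    have hxa' := (x.1 a).isLt
    have hxb' := (x.1 b).isLt
    -- At c = b the count sees x(a) in place of x(b). As the two have equal sign, neither lies
    -- between the bars of x(b) and x(a).
    split_ifs with hcb
    · subst hcb
      simp only [apply_rev, Fin.lt_def, Fin.val_rev] at h ⊢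
      omega
    · rfl
  rw [h3, between_rev] at h1
  have h4 := two_mul_length x
  have h5 := two_mul_length (x * refl (a, b))
  omega

/-- The bounds exclude both extreme changes 1 and 2⟨ρ,β^∨⟩ - 1 = 2(b - a) + 1, so no edge labelled
by ε_i + ε_j changes the sign. -/
theorem length_mul_refl_of_sign {n : ℕ} (x : W n) {a b : Letter n} (hb : n ≤ b.val)
    (ha : a < Fin.rev b) (h : x.1 a < x.1 b) (hs : ¬ ((x.1 a).val < n ↔ (x.1 b).val < n)) :
    length x + 2 ≤ length (x * refl (a, b)) ∧
      length (x * refl (a, b)) ≤ length x + 2 * (b.val - a.val) := by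
  have ha' := a.isLt
  have hb' := b.isLt
  have hab : a < b := by simp only [Fin.lt_def, Fin.val_rev] at ha ⊢; omega
  have h1 := inversions_mul_refl x hab ha h
  have h2 := negCount_mul_refl x hab ha h
  simp only [Fin.lt_def] at h hab
  rw [if_pos (by omega)] at h2
  have h3 : (Finset.univ.filter fun c => (Fin.rev b < c ∧ c < Fin.rev a) ∧
        (x.1 (Fin.rev b) < x.1 (if c = b then a else c) ∧
          x.1 (if c = b then a else c) < x.1 (Fin.rev a))).card ≤ b.val - a.val - 1 := by
    have : b.val - a.val - 1 = (Finset.Ioo (Fin.rev b) (Fin.rev a)).card := by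
      rw [Fin.card_Ioo, Fin.val_rev, Fin.val_rev]
      omega
    rw [this]
    refine Finset.card_le_card fun c hc => ?_
    simp only [Finset.mem_filter, Finset.mem_univ, true_and] at hc
    exact Finset.mem_Ioo.2 hc.1
  have h6 := between_le x a b
  have h4 := two_mul_length x
  have h5 := two_mul_length (x * refl (a, b))
  omega

/-! ### Edges of the quantum Bruhat graph -/

/-- `c` is strictly between `a` and `b` in the circular order. -/
def Circ {n : ℕ} (a c b : Letter n) : Prop := if a < b then a < c ∧ c < b else a < c ∨ c < b

/-- The criterion for `x → x s_β` to be an edge of the quantum Bruhat graph. -/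
def Edge {n : ℕ} (x : W n) (β : Root n) : Prop :=
  (∀ q, β.1 < q → q < β.2 → ¬ Circ (x.1 β.1) (x.1 q) (x.1 β.2)) ∧
  (n ≤ β.2.val → β.2 ≠ Fin.rev β.1 →
    x.1 β.1 < x.1 β.2 ∧ ((x.1 β.1).val < n ↔ (x.1 β.2).val < n))

/-- The number `2 ⟨ρ, β^∨⟩ - 1`. -/
def reflLength {n : ℕ} (β : Root n) : ℤ :=
  if β.2.val < n then 2 * ((β.2.val : ℤ) - β.1.val) - 1
  else if β.2 = Fin.rev β.1 then (β.2.val : ℤ) - β.1.val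
  else 2 * ((β.2.val : ℤ) - β.1.val) + 1

theorem between_mul_refl {n : ℕ} (x : W n) {a b : Letter n} (hab : a < b)
    (h : b.val < n ∨ b = Fin.rev a) {c : Letter n} (hac : a < c) (hcb : c < b) :
    (x * refl (a, b)).1 c = x.1 c := by
  have := a.isLt
  have := b.isLt
  have := c.isLt
  simp only [Fin.lt_def, Fin.ext_iff, Fin.val_rev] at hab hac hcb h
  rw [mul_refl_apply _ (by rw [ne_eq, Fin.ext_iff]; omega), if_neg, if_neg, if_neg, if_neg] <;>
    simp only [Fin.ext_iff, Fin.val_rev] <;> omega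

/-- A gain of 1 forces the box of positions and values between a and b to be empty. A maximal drop,
read from the longer element, forces it to be full, so the complementary circular gap is empty. For
ε_i + ε_j with i ≠ j the maximum is never reached, since the box contributes at most 2(b - a) - 1
when signs agree. -/
theorem length_change {n : ℕ} (x : W n) {β : Root n} (hβ : IsPosRoot β) (h : x.1 β.1 < x.1 β.2) :
    length x < length (x * refl β) ∧
    (length (x * refl β) : ℤ) ≤ length x + reflLength β ∧
    (length (x * refl β) = length x + 1 → Edge x β) ∧
    ((length (x * refl β) : ℤ) = length x + reflLength β → Edge (x * refl β) β) := by
  obtain ⟨a, b⟩ := β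
  obtain ⟨hab, har⟩ := hβ
  simp only at hab har h
  have ha' := a.isLt
  have hb' := b.isLt
  have hab' : a.val < b.val := hab
  have har' : a.val + b.val ≤ 2 * n - 1 := by
    simp only [Fin.le_def, Fin.val_rev] at har; omega
  have ya : (x * refl (a, b)).1 a = x.1 b := by rw [mul_refl_apply _ hab.ne, if_pos rfl]
  have yb : (x * refl (a, b)).1 b = x.1 a := by
    rw [mul_refl_apply _ hab.ne, if_neg hab.ne', if_pos rfl]
  have hle := between_le x a b
  have hA : between x a b = 0 → ∀ q, a < q → q < b → ¬ Circ (x.1 a) (x.1 q) (x.1 b) := by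
    intro h0 q h1 h2
    rw [Circ, if_pos h]
    exact not_between h0 h1 h2
  have hB : (b.val < n ∨ b = Fin.rev a) → between x a b = b.val - a.val - 1 →
      ∀ q, a < q → q < b → ¬ Circ ((x * refl (a, b)).1 a) ((x * refl (a, b)).1 q)
        ((x * refl (a, b)).1 b) := by
    intro h0 h1 q h2 h3
    rw [ya, yb, between_mul_refl x hab h0 h2 h3, Circ, if_neg h.not_gt]
    have := lt_of_between_eq h1 h2 h3
    rw [not_or]
    exact ⟨this.2.not_gt, this.1.not_gt⟩
  by_cases hbn : b.val < n
  · have h1 := length_mul_refl_of_lt x hab hbn h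
    simp only [reflLength, hbn, if_true]
    refine ⟨by omega, by omega, fun h2 => ⟨hA (by omega), fun h3 => absurd h3 hbn.not_ge⟩,
      fun h2 => ⟨hB (Or.inl hbn) (by omega), fun h3 => absurd h3 hbn.not_ge⟩⟩
  by_cases hbr : b = Fin.rev a
  · subst hbr
    have h1 := length_mul_refl_rev x (by omega) h
    simp only [reflLength, hbn, if_true, if_false]
    refine ⟨by omega, by omega, fun h2 => ⟨hA (by omega), fun _ h3 => absurd rfl h3⟩,
      fun h2 => ⟨hB (Or.inr rfl) (by omega), fun _ h3 => absurd rfl h3⟩⟩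
  have har : a < Fin.rev b := by
    simp only [Fin.ext_iff, Fin.lt_def, Fin.val_rev] at hbr ⊢
    omega
  simp only [reflLength, hbn, hbr, if_false]
  by_cases hs : (x.1 a).val < n ↔ (x.1 b).val < n
  · have h1 := length_mul_refl_of_ge x (by omega) har h hs
    exact ⟨by omega, by omega, fun h2 => ⟨hA (by omega), fun _ _ => ⟨h, hs⟩⟩, fun h2 => by omega⟩
  · have h1 := length_mul_refl_of_sign x (by omega) har h hs
    exact ⟨by omega, by omega, fun h2 => by omega, fun h2 => by omega⟩

theorem length_change_rev {n : ℕ} (x : W n) {β : Root n} (hβ : IsPosRoot β)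
    (h : x.1 β.2 < x.1 β.1) :
    length (x * refl β) < length x ∧
    (length x : ℤ) ≤ length (x * refl β) + reflLength β ∧
    ((length x : ℤ) = length (x * refl β) + reflLength β → Edge x β) := by
  have h1 : (x * refl β).1 β.1 = x.1 β.2 := by rw [mul_refl_apply _ hβ.1.ne, if_pos rfl]
  have h2 : (x * refl β).1 β.2 = x.1 β.1 := by
    rw [mul_refl_apply _ hβ.1.ne, if_neg hβ.1.ne', if_pos rfl]
  have := length_change (x * refl β) hβ (by rw [h1, h2]; exact h)
  rw [mul_refl_refl _ _ hβ.1.ne] at this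
  exact ⟨this.1, this.2.1, this.2.2.2⟩

theorem rho_dot_eps {n : ℕ} (a : Letter n) :
    rho n ⬝ᵥ eps a = if a.val < n then (n : ℚ) - a.val else (n : ℚ) - 1 - a.val := by
  have ha := a.isLt
  simp only [dotProduct, rho, eps]
  split_ifs with h
  · rw [Finset.sum_eq_single ⟨a.val, h⟩]
    · simp [pos]
    · intro i _ hi
      rw [if_neg, if_neg]
      · simp
      · simp only [bar, pos, Fin.ext_iff, Fin.val_rev, Fin.val_castLE]; omega
      · simp only [pos, ne_eq, Fin.ext_iff, Fin.val_castLE] at hi ⊢; omega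
    · simp
  · rw [Finset.sum_eq_single ⟨(Fin.rev a).val, by rw [Fin.val_rev]; omega⟩]
    · rw [if_neg, if_pos]
      · simp only [Fin.val_rev]
        rw [Nat.cast_sub (by omega)]
        push_cast
        ring
      · simp [bar, pos, Fin.ext_iff, Fin.val_rev]; omega
      · simp [pos, Fin.ext_iff, Fin.val_rev]; omega
    · intro i _ hi
      rw [if_neg, if_neg]
      · simp
      · simp only [bar, pos, ne_eq, Fin.ext_iff, Fin.val_rev, Fin.val_castLE] at hi ⊢; omega
      · simp only [pos, Fin.ext_iff, Fin.val_castLE]; omega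
    · simp

theorem eps_dot_eps {n : ℕ} (a b : Letter n) :
    eps a ⬝ᵥ eps b = if a = b then 1 else if a = Fin.rev b then -1 else 0 := by
  have ha := a.isLt
  have hb := b.isLt
  simp only [dotProduct, eps]
  have key : ∀ i : Fin n, (a = pos i ∨ a = bar i) → ∀ j, j ≠ i → (if a = pos j then (1 : ℚ)
      else if a = bar j then -1 else 0) = 0 := by
    intro i hi j hj
    simp only [bar, pos, ne_eq, Fin.ext_iff, Fin.val_rev, Fin.val_castLE] at hi hj ⊢
    rw [if_neg (by omega), if_neg (by omega)]
  obtain ⟨i, hi⟩ : ∃ i : Fin n, a = pos i ∨ a = bar i := by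
    by_cases h : a.val < n
    · exact ⟨⟨a.val, h⟩, Or.inl rfl⟩
    · refine ⟨⟨(Fin.rev a).val, by rw [Fin.val_rev]; omega⟩, Or.inr ?_⟩
      simp only [bar, pos, Fin.ext_iff, Fin.val_rev, Fin.val_castLE]; omega
  rw [Finset.sum_eq_single i (fun j _ hj => by rw [key i hi j hj, zero_mul]) (by simp)]
  simp only [bar, pos, Fin.ext_iff, Fin.val_rev, Fin.val_castLE] at hi ⊢
  split_ifs <;> first | omega | norm_num

theorem reflLength_eq {n : ℕ} {β : Root n} (hβ : IsPosRoot β) :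
    (reflLength β : ℚ) = 2 * (rho n ⬝ᵥ coroot β) - 1 := by
  obtain ⟨a, b⟩ := β
  obtain ⟨hab, har⟩ := hβ
  have ha := a.isLt
  have hb := b.isLt
  simp only [Fin.lt_def, Fin.le_def, Fin.val_rev] at hab har
  simp only [coroot, rootVec, dotProduct_smul, dotProduct_sub, sub_dotProduct, eps_dot_eps,
    rho_dot_eps, reflLength, smul_eq_mul, if_true]
  have h1 : a ≠ b := by rw [ne_eq, Fin.ext_iff]; omega
  have h2 : a.val < n := by omega
  simp only [h1, h1.symm, if_false, h2, if_true]
  by_cases hbn : b.val < n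
  · have h3 : ¬ a = Fin.rev b := by simp only [Fin.ext_iff, Fin.val_rev]; omega
    have h4 : ¬ b = Fin.rev a := by simp only [Fin.ext_iff, Fin.val_rev]; omega
    simp only [h3, h4, if_false]
    simp only [hbn, if_true]
    push_cast
    ring
  simp only [hbn, if_false]
  by_cases hbr : b = Fin.rev a
  · have h3 : a = Fin.rev b := by rw [hbr, Fin.rev_rev]
    simp only [← hbr, ← h3, if_true]
    have : (b.val : ℚ) = 2 * n - 1 - a.val := by
      rw [hbr, Fin.val_rev, Nat.cast_sub (by omega)]
      push_cast
      ring
    push_cast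
    rw [this]
    ring
  · have h3 : ¬ a = Fin.rev b := by rw [← Fin.rev_eq_iff]; exact fun h => hbr h.symm
    simp only [hbr, h3, if_false]
    push_cast
    ring

/-! ### Paths in the quantum Bruhat graph -/

/-- `RPath L x y q`: some of the roots of `L` label, in this order, a path from `x` to `y` in the
quantum Bruhat graph, and `q` is the list of the labels of its quantum steps. -/
inductive RPath {n : ℕ} : List (Root n) → W n → W n → List (Root n) → Prop
  | nil (x : W n) : RPath [] x x []
  | skip {L : List (Root n)} {x y : W n} {q : List (Root n)} (β : Root n) (h : RPath L x y q) :
      RPath (β :: L) x y q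
  | step {L : List (Root n)} {x y : W n} {q : List (Root n)} {β : Root n} (he : Edge x β)
      (hβ : ¬ x.1 β.2 < x.1 β.1) (h : RPath L (x * refl β) y q) : RPath (β :: L) x y q
  | quantum {L : List (Root n)} {x y : W n} {q : List (Root n)} {β : Root n} (he : Edge x β)
      (hβ : x.1 β.2 < x.1 β.1) (h : RPath L (x * refl β) y q) : RPath (β :: L) x y (β :: q)

theorem RPath.append {n : ℕ} {L L' : List (Root n)} {x y z : W n} {q q' : List (Root n)}
    (h : RPath L x y q) (h' : RPath L' y z q') : RPath (L ++ L') x z (q ++ q') := by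
  induction h with
  | nil => exact h'
  | skip β _ ih => exact .skip β (ih h')
  | step he hβ _ ih => exact .step he hβ (ih h')
  | quantum he hβ _ ih => exact .quantum he hβ (ih h')

theorem RPath.split {n : ℕ} {L L' : List (Root n)} {x z : W n} {q : List (Root n)}
    (h : RPath (L ++ L') x z q) :
    ∃ y q₁ q₂, RPath L x y q₁ ∧ RPath L' y z q₂ ∧ q = q₁ ++ q₂ := by
  induction L generalizing x q with
  | nil => exact ⟨x, [], q, .nil x, h, rfl⟩
  | cons β L ih =>
    cases h with
    | skip _ h =>
      obtain ⟨y, q₁, q₂, h₁, h₂, rfl⟩ := ih h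
      exact ⟨y, q₁, q₂, .skip β h₁, h₂, rfl⟩
    | step he hβ h =>
      obtain ⟨y, q₁, q₂, h₁, h₂, rfl⟩ := ih h
      exact ⟨y, q₁, q₂, .step he hβ h₁, h₂, rfl⟩
    | quantum he hβ h =>
      obtain ⟨y, q₁, q₂, h₁, h₂, rfl⟩ := ih h
      exact ⟨y, β :: q₁, q₂, .quantum he hβ h₁, h₂, rfl⟩

theorem RPath.mono {n : ℕ} {L L' : List (Root n)} {x y : W n} {q : List (Root n)}
    (h : RPath L x y q) (hL : L.Sublist L') : RPath L' x y q := by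
  induction hL generalizing x q with
  | slnil => exact h
  | cons β _ ih => exact .skip β (ih h)
  | cons_cons β _ ih =>
    cases h with
    | skip _ h => exact .skip β (ih h)
    | step he hβ h => exact .step he hβ (ih h)
    | quantum he hβ h => exact .quantum he hβ (ih h)

/-- An invariant of states, remaining labels and the number of quantum steps, which is preserved
under forgetting a label and under every step, holds at the end of a path. -/
theorem RPath.invariant {n : ℕ} {I : List (Root n) → W n → ℕ → Prop}
    (hskip : ∀ β L x c, I (β :: L) x c → I L x c)
    (hstep : ∀ β L x c, I (β :: L) x c → Edge x β →
      I L (x * refl β) (c + if x.1 β.2 < x.1 β.1 then 1 else 0))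
    {L : List (Root n)} {x y : W n} {q : List (Root n)} (h : RPath L x y q) {c : ℕ}
    (hI : I L x c) : I [] y (c + q.length) := by
  induction h generalizing c with
  | nil => exact hI
  | skip β _ ih => exact ih (hskip _ _ _ _ hI)
  | step he hβ _ ih =>
    have := hstep _ _ _ _ hI he
    rw [if_neg hβ] at this
    exact ih this
  | quantum he hβ _ ih =>
    have := hstep _ _ _ _ hI he
    rw [if_pos hβ] at this
    have := ih this
    rwa [add_assoc, add_comm 1] at this

theorem RPath.mem_quantum {n : ℕ} {L : List (Root n)} {x y : W n} {q : List (Root n)}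
    (h : RPath L x y q) : ∀ β ∈ q, β ∈ L ∧ ∃ z : W n, Edge z β ∧ z.1 β.2 < z.1 β.1 := by
  induction h with
  | nil => simp
  | skip β _ ih => exact fun γ hγ => ⟨List.mem_cons_of_mem _ (ih γ hγ).1, (ih γ hγ).2⟩
  | step he hβ _ ih => exact fun γ hγ => ⟨List.mem_cons_of_mem _ (ih γ hγ).1, (ih γ hγ).2⟩
  | @quantum L x y q β he hβ _ ih =>
    intro γ hγ
    rcases List.mem_cons.1 hγ with rfl | hγ
    · exact ⟨List.mem_cons_self, x, he, hβ⟩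
    · exact ⟨List.mem_cons_of_mem _ (ih γ hγ).1, (ih γ hγ).2⟩

/-! ### Folding pairs are paths in the quantum Bruhat graph -/

section Folding

variable {n : ℕ} (Γ : List (Root n)) (w : W n) (J : Finset (Fin Γ.length))

theorem filter_finRange_lt_succ {m : ℕ} (P : Fin m → Prop) [DecidablePred P] (p : Fin m) :
    ((List.finRange m).filter fun i => P i ∧ i.val < p.val + 1) =
      ((List.finRange m).filter fun i => P i ∧ i.val < p.val) ++ if P p then [p] else [] := by
  have h1 : List.finRange m = (List.finRange m).take p.val ++
      p :: (List.finRange m).drop (p.val + 1) := by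
    conv_lhs => rw [← List.take_append_drop p.val (List.finRange m)]
    rw [List.drop_eq_getElem_cons (by simp)]
    simp
  have h2 : ∀ i ∈ (List.finRange m).take p.val, i.val < p.val := by
    intro i hi
    obtain ⟨t, ht, rfl⟩ := List.mem_iff_getElem.1 hi
    simp at ht ⊢
    omega
  have h3 : ∀ i ∈ (List.finRange m).drop (p.val + 1), p.val + 1 ≤ i.val := by
    intro i hi
    obtain ⟨t, ht, rfl⟩ := List.mem_iff_getElem.1 hi
    simp at ht ⊢
  rw [h1]
  simp only [List.filter_append, List.filter_cons]
  have h4 : ((List.finRange m).drop (p.val + 1)).filter (fun i => decide (P i ∧ i.val < p.val)) =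
      [] := by
    rw [List.filter_eq_nil_iff]
    intro i hi
    have := h3 i hi
    simp
    omega
  have h5 : ((List.finRange m).drop (p.val + 1)).filter
      (fun i => decide (P i ∧ i.val < p.val + 1)) = [] := by
    rw [List.filter_eq_nil_iff]
    intro i hi
    have := h3 i hi
    simp
    omega
  have h6 : ((List.finRange m).take p.val).filter (fun i => decide (P i ∧ i.val < p.val + 1)) =
      ((List.finRange m).take p.val).filter (fun i => decide (P i ∧ i.val < p.val)) := by
    refine List.filter_congr fun i hi => ?_
    have := h2 i hi
    exact decide_eq_decide.2 (and_congr_right fun _ => by omega)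
  rw [h4, h5, h6]
  by_cases hp : P p <;> simp [hp]

theorem partialProd_zero : partialProd Γ w J 0 = w := by
  simp [partialProd]

theorem partialProd_succ_of_mem {p : Fin Γ.length} (hp : p ∈ J) :
    partialProd Γ w J (p.val + 1) = partialProd Γ w J p.val * refl (Γ.get p) := by
  have := filter_finRange_lt_succ (· ∈ J) p
  rw [if_pos hp] at this
  simp only [partialProd, this]
  simp [mul_assoc]

theorem partialProd_succ_of_notMem {p : Fin Γ.length} (hp : p ∉ J) :
    partialProd Γ w J (p.val + 1) = partialProd Γ w J p.val := by
  have := filter_finRange_lt_succ (· ∈ J) p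
  rw [if_neg hp] at this
  simp only [partialProd, this]
  simp

theorem BruhatLT.length_lt {u v : W n} (h : BruhatLT u v) : length u < length v := by
  induction h with
  | single h => exact h.choose_spec.2.2
  | tail _ h ih => exact ih.trans h.choose_spec.2.2

variable {Γ w J}

/-- Elements that differ by a reflection are Bruhat comparable according to their lengths alone. -/
theorem mem_negFoldings {p : Fin Γ.length} (hΓ : ∀ β ∈ Γ, IsPosRoot β) :
    p ∈ negFoldings Γ w J ↔
      p ∈ J ∧ length (partialProd Γ w J p.val) < length (partialProd Γ w J (p.val + 1)) := by
  classical
  simp only [negFoldings, Finset.mem_filter]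
  refine and_congr_right fun hp => ⟨BruhatLT.length_lt, fun h => ?_⟩
  exact Relation.TransGen.single
    ⟨Γ.get p, hΓ _ (List.get_mem _ _), partialProd_succ_of_mem Γ w J hp, h⟩

theorem length_partialProd_telescope (p : ℕ) (hp : p ≤ Γ.length) :
    (length (partialProd Γ w J p) : ℤ) = length w + ∑ j ∈ J.filter fun j => j.val < p,
      ((length (partialProd Γ w J (j.val + 1)) : ℤ) - length (partialProd Γ w J j.val)) := by
  induction p with
  | zero => simp [partialProd_zero]
  | succ p ih =>
    have ih := ih (by omega)
    by_cases hpJ : (⟨p, hp⟩ : Fin Γ.length) ∈ J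
    · have : (J.filter fun j => j.val < p + 1) =
          insert ⟨p, hp⟩ (J.filter fun j => j.val < p) := by
        ext j
        simp only [Finset.mem_filter, Finset.mem_insert, Fin.ext_iff]
        constructor
        · rintro ⟨h1, h2⟩
          by_cases h : j.val = p
          · exact Or.inl h
          · exact Or.inr ⟨h1, by omega⟩
        · rintro (h | h)
          · exact ⟨by rwa [show j = ⟨p, hp⟩ from Fin.ext h], by omega⟩
          · exact ⟨h.1, by omega⟩
      rw [this, Finset.sum_insert (by simp)]
      simp only
      linarith
    · have : (J.filter fun j => j.val < p + 1) = (J.filter fun j => j.val < p) := by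
        refine Finset.filter_congr fun j hj => ?_
        have : j.val ≠ p := fun h => hpJ (by rwa [show j = ⟨p, hp⟩ from Fin.ext h] at hj)
        omega
      rw [this, ← ih, ← partialProd_succ_of_notMem Γ w J hpJ]

/-- The defect e of a folding measures how far its length change is from the extreme: 2⟨ρ,β^∨⟩ - 1
for negative foldings, -1 for the others. Twice the admissibility identity reads 2ℓ(end) + ∑ e = 0,
so all terms vanish. The edge is based at the element after the folding because the path is read
backwards. -/
theorem IsAdmissible.key (hΓ : ∀ β ∈ Γ, IsPosRoot β) (h : IsAdmissible Γ w J) :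
    endpoint Γ w J = 1 ∧ ∀ p ∈ J, Edge (partialProd Γ w J (p.val + 1)) (Γ.get p) ∧
      (p ∈ negFoldings Γ w J ↔ (partialProd Γ w J (p.val + 1)).1 (Γ.get p).2 <
        (partialProd Γ w J (p.val + 1)).1 (Γ.get p).1) := by
  classical
  have hpos : ∀ p : Fin Γ.length, IsPosRoot (Γ.get p) := fun p => hΓ _ (List.get_mem _ _)
  set N := negFoldings Γ w J with hN
  set d : Fin Γ.length → ℤ := fun j =>
    (length (partialProd Γ w J (j.val + 1)) : ℤ) - length (partialProd Γ w J j.val) with hd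
  set e : Fin Γ.length → ℤ := fun j =>
    if j ∈ N then reflLength (Γ.get j) - d j else - d j - 1 with he
  have hback : ∀ p ∈ J, partialProd Γ w J p.val =
      partialProd Γ w J (p.val + 1) * refl (Γ.get p) := fun p hp => by
    rw [partialProd_succ_of_mem Γ w J hp, mul_refl_refl _ _ (hpos p).1.ne]
  have hNJ : N ⊆ J := Finset.filter_subset _ _
  have hfact : ∀ p ∈ J, 0 ≤ e p ∧ (e p = 0 → Edge (partialProd Γ w J (p.val + 1)) (Γ.get p)) ∧
      (p ∈ N ↔ (partialProd Γ w J (p.val + 1)).1 (Γ.get p).2 <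
        (partialProd Γ w J (p.val + 1)).1 (Γ.get p).1) := by
    intro p hp
    set x := partialProd Γ w J (p.val + 1) with hx
    have hy : partialProd Γ w J p.val = x * refl (Γ.get p) := hback p hp
    have hpN : p ∈ N ↔ length (partialProd Γ w J p.val) < length x := by
      rw [hN, mem_negFoldings hΓ]
      exact and_iff_right hp
    rw [hy] at hpN
    rcases lt_or_gt_of_ne (x.1.injective.ne (hpos p).1.ne) with hlt | hgt
    · have h1 := length_change x (hpos p) hlt
      have hpn : p ∉ N := by rw [hpN]; omega
      simp only [he, hd, if_neg hpn, ← hx, hy]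
      refine ⟨by omega, fun h2 => h1.2.2.1 (by omega), ?_⟩
      exact ⟨fun h => absurd h hpn, fun h => absurd h hlt.not_gt⟩
    · have h1 := length_change_rev x (hpos p) hgt
      have hpn : p ∈ N := by rw [hpN]; omega
      simp only [he, hd, if_pos hpn, ← hx, hy]
      exact ⟨by omega, fun h2 => h1.2.2 (by omega), iff_of_true hpn hgt⟩
  -- Telescoping eliminates ℓ(w), which is why ℓ(end) appears with coefficient 2 below.
  have htel := length_partialProd_telescope (w := w) (J := J) Γ.length le_rfl
  rw [Finset.filter_true_of_mem fun j _ => j.isLt] at htel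
  change (length (endpoint Γ w J) : ℤ) = length w + ∑ j ∈ J, d j at htel
  have hsum : ∑ j ∈ J, e j = (∑ j ∈ N, (reflLength (Γ.get j) + 1)) - ∑ j ∈ J, d j - J.card := by
    have h1 : ∀ j ∈ J, e j = (if j ∈ N then reflLength (Γ.get j) + 1 else 0) - d j - 1 := by
      intro j _
      simp only [he]
      split_ifs <;> ring
    rw [Finset.sum_congr rfl h1, Finset.sum_sub_distrib, Finset.sum_sub_distrib,
      Finset.sum_ite_mem, Finset.inter_eq_right.2 hNJ]
    simp
  have hzero : 2 * (length (endpoint Γ w J) : ℤ) + ∑ j ∈ J, e j = 0 := by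
    have h1 : ∑ j ∈ N, rho n ⬝ᵥ coroot (Γ.get j) =
        ((∑ j ∈ N, (reflLength (Γ.get j) + 1) : ℤ) : ℚ) / 2 := by
      push_cast
      rw [Finset.sum_div]
      refine Finset.sum_congr rfl fun j _ => ?_
      rw [reflLength_eq (hpos j)]
      ring
    rw [IsAdmissible, ← hN, h1] at h
    have h2 : ((length w + length (endpoint Γ w J) - J.card +
        ∑ j ∈ N, (reflLength (Γ.get j) + 1) : ℤ) : ℚ) = 0 := by
      push_cast at h ⊢
      linarith
    have h3 := Int.cast_eq_zero.1 h2
    linarith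
  have hnn : 0 ≤ ∑ j ∈ J, e j := Finset.sum_nonneg fun j hj => (hfact j hj).1
  have he0 := (Finset.sum_eq_zero_iff_of_nonneg fun j hj => (hfact j hj).1).1
    (show ∑ j ∈ J, e j = 0 by omega)
  exact ⟨eq_one_of_length_eq_zero (by omega),
    fun p hp => ⟨(hfact p hp).2.1 (he0 p hp), (hfact p hp).2.2⟩⟩

/-- Backwards, a negative folding becomes a length-decreasing, hence quantum, step. The weights g
are arbitrary so that both the number and the levels of the quantum steps can be read off the
labels. -/
theorem IsAdmissible.exists_rpath (hΓ : ∀ β ∈ Γ, IsPosRoot β) (h : IsAdmissible Γ w J)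
    (A L B : List (Root n)) (hL : Γ = A ++ L ++ B) :
    ∃ q, RPath L.reverse (partialProd Γ w J (A.length + L.length)) (partialProd Γ w J A.length) q ∧
      ∀ g : Root n → ℕ, ∑ j ∈ (negFoldings Γ w J).filter (fun j => A.length ≤ j.val ∧
        j.val < A.length + L.length), g (Γ.get j) = (q.map g).sum := by
  classical
  induction L generalizing A with
  | nil =>
    refine ⟨[], .nil _, fun g => ?_⟩
    rw [Finset.filter_false_of_mem]
    · simp
    · intro j _
      simp
  | cons β L ih =>
    obtain ⟨q, h1, h2⟩ := ih (A ++ [β]) (by rw [hL]; simp)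
    have hlen : A.length < Γ.length := by rw [hL]; simp
    set p : Fin Γ.length := ⟨A.length, hlen⟩ with hp
    have hget : Γ.get p = β := by simp [hp, hL]
    have hl1 : (A ++ [β]).length = p.val + 1 := by simp [hp]
    have hl2 : A.length + (β :: L).length = (A ++ [β]).length + L.length := by simp; omega
    have hfil : (negFoldings Γ w J).filter (fun j => A.length ≤ j.val ∧
        j.val < A.length + (β :: L).length) = ((negFoldings Γ w J).filter fun j =>
          (A ++ [β]).length ≤ j.val ∧ j.val < (A ++ [β]).length + L.length) ∪
        ((negFoldings Γ w J).filter (· = p)) := by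
      ext j
      rw [hl2]
      simp only [Finset.mem_filter, Finset.mem_union, hl1, Fin.ext_iff, hp]
      constructor
      · rintro ⟨h1, h2, h3⟩
        by_cases h : j.val = A.length
        · exact Or.inr ⟨h1, h⟩
        · exact Or.inl ⟨h1, by omega, by omega⟩
      · rintro (⟨h1, h2, h3⟩ | ⟨h1, h2⟩) <;> exact ⟨h1, by omega, by omega⟩
    have hdis : Disjoint ((negFoldings Γ w J).filter fun j =>
        (A ++ [β]).length ≤ j.val ∧ j.val < (A ++ [β]).length + L.length)
        ((negFoldings Γ w J).filter (· = p)) := by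
      rw [Finset.disjoint_filter]
      rintro j _ h rfl
      omega
    have hsum : ∀ g : Root n → ℕ, ∑ j ∈ (negFoldings Γ w J).filter (fun j => A.length ≤ j.val ∧
        j.val < A.length + (β :: L).length), g (Γ.get j) =
        (q.map g).sum + if p ∈ negFoldings Γ w J then g β else 0 := by
      intro g
      rw [hfil, Finset.sum_union hdis, h2, Finset.filter_eq']
      split_ifs
      · rw [Finset.sum_singleton, hget]
      · simp
    rw [List.reverse_cons]
    rw [hl1] at h1
    rw [hl2, hl1]
    by_cases hpJ : p ∈ J
    · obtain ⟨he, hiff⟩ := (h.key hΓ).2 p hpJ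
      have hback : partialProd Γ w J A.length = partialProd Γ w J (p.val + 1) * refl β := by
        rw [partialProd_succ_of_mem Γ w J hpJ, hget,
          mul_refl_refl _ _ (hΓ β (by rw [hL]; simp)).1.ne]
      rw [hget] at he hiff
      by_cases hpN : p ∈ negFoldings Γ w J
      · refine ⟨q ++ [β], h1.append (.quantum he (hiff.1 hpN) ?_), fun g => ?_⟩
        · rw [hback]
          exact .nil _
        · rw [← hl1, ← hl2, hsum, if_pos hpN]
          simp
      · refine ⟨q ++ [], h1.append (.step he (fun h => hpN (hiff.2 h)) ?_), fun g => ?_⟩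
        · rw [hback]
          exact .nil _
        · rw [← hl1, ← hl2, hsum, if_neg hpN]
          simp
    · refine ⟨q ++ [], h1.append (.skip β ?_), fun g => ?_⟩
      · rw [partialProd_succ_of_notMem Γ w J hpJ]
        exact .nil _
      · rw [← hl1, ← hl2, hsum, if_neg fun h => hpJ (((mem_negFoldings hΓ).1 h).1)]
        simp

end Folding

/-! ### Values of signed permutations -/

/-- The value of a signed permutation as a natural number less than `2 n`. -/
def val {n : ℕ} (x : W n) (q : Letter n) : ℕ := (x.1 q).val

theorem val_rev_add {n : ℕ} (x : W n) (q : Letter n) : val x (Fin.rev q) + val x q + 1 = 2 * n := by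
  have := (x.1 q).isLt
  rw [val, val, apply_rev, Fin.val_rev]
  omega

theorem val_ne {n : ℕ} (x : W n) {p q : Letter n} (h : p ≠ q) : val x p ≠ val x q :=
  fun h' => h (x.1.injective (Fin.ext h'))

/-- The circular half-open interval from `u` to `c` contains `e`. -/
def InArc (u c e : ℕ) : Prop := if u ≤ c then u ≤ e ∧ e < c else u ≤ e ∨ e < c

/-- The circular move from `a` to `b` does not reach `u`. -/
def Avoids (u a b : ℕ) : Prop := if a < b then ¬ (a < u ∧ u ≤ b) else u ≤ a ∧ b < u

theorem Edge.val_between {n : ℕ} {x : W n} {a b q : Letter n} (h : Edge x (a, b)) (ha : a < q)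
    (hb : q < b) : (val x a < val x b → ¬ (val x a < val x q ∧ val x q < val x b)) ∧
      (val x b < val x a → val x q ≤ val x a ∧ val x b ≤ val x q) := by
  have h1 := h.1 q ha hb
  simp only [Circ, Fin.lt_def] at h1
  simp only [val]
  split_ifs at h1 <;> omega

theorem Edge.val_sign {n : ℕ} {x : W n} {a b : Letter n} (h : Edge x (a, b)) (hb : n ≤ b.val)
    (hab : b ≠ Fin.rev a) : val x a < val x b ∧ (val x a < n ↔ val x b < n) := h.2 hb hab

theorem val_mul_refl {n : ℕ} (x : W n) {a b : Letter n} (hab : a < b) :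
    val (x * refl (a, b)) a = val x b ∧ val (x * refl (a, b)) b = val x a ∧
    ∀ q, q ≠ a → q ≠ b → q ≠ Fin.rev a → q ≠ Fin.rev b → val (x * refl (a, b)) q = val x q := by
  refine ⟨?_, ?_, fun q h1 h2 h3 h4 => ?_⟩
  · rw [val, mul_refl_apply _ hab.ne, if_pos rfl, val]
  · rw [val, mul_refl_apply _ hab.ne, if_neg hab.ne', if_pos rfl, val]
  · rw [val, mul_refl_apply _ hab.ne, if_neg h1, if_neg h2, if_neg h3, if_neg h4, val]

/-! ### Rows that are not yet processed -/

/-- The invariant of a row `p` which is not yet processed: if its value has moved up, then the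
interval it has passed, extended down to the value in some barred position `ḡ`, does not meet the
values in the positions strictly between `p` and `k̄`. -/
def Pending {n : ℕ} (k t : ℕ) (u x : W n) (p : Letter n) : Prop :=
  val x p = val u p ∨ ∃ g : Letter n, t ≤ g.val ∧ g.val < k ∧ val x (Fin.rev g) ≤ val u p ∧
    val u p < val x p ∧ (val x (Fin.rev g) < n ↔ val x p < n) ∧
    ∀ q, p < q → q.val < 2 * n - k → ¬ (val x (Fin.rev g) ≤ val x q ∧ val x q ≤ val x p)

theorem Pending.mono {n k t t' : ℕ} {u x : W n} {p : Letter n} (h : Pending k t u x p)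
    (ht : t' ≤ t) : Pending k t' u x p := by
  rcases h with h | ⟨g, h1, h2⟩
  · exact Or.inl h
  · exact Or.inr ⟨g, ht.trans h1, h2⟩

theorem ne_of_val_ne {m : ℕ} {a b : Fin m} (h : a.val ≠ b.val) : a ≠ b := fun h' => h (h' ▸ rfl)

/-- The forbidden interval from x(ḡ) to x(p) must stay empty while row i < g moves. The positions
below k̄ exchange values among themselves, except that x(ī) comes in from outside; the guard g keeps
it out of the interval. -/
theorem Pending.step_middle {n k : ℕ} (hk : k ≤ n) {u x : W n} {p i b : Letter n} (hp : p < i)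
    (hi : i.val < k) (hb : (k ≤ b.val ∧ b.val < 2 * n - k) ∨ b = Fin.rev i)
    (h : Pending k (i.val + 1) u x p) (he : Edge x (i, b)) :
    Pending k (i.val + 1) u (x * refl (i, b)) p := by
  have hib : i < b := by
    rw [Fin.lt_def]
    rcases hb with hb | rfl
    · omega
    · rw [Fin.val_rev]; omega
  obtain ⟨za, zb, zq⟩ := val_mul_refl x hib
  have hp' : p.val < i.val := hp
  have hbv : k ≤ b.val ∧ (b.val < 2 * n - k ∨ b.val = 2 * n - 1 - i.val) := by
    rcases hb with hb | rfl
    · omega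
    · rw [Fin.val_rev]; omega
  have zp : val (x * refl (i, b)) p = val x p := by
    have := b.isLt
    apply zq <;> apply ne_of_val_ne <;> (try rw [Fin.val_rev]) <;> omega
  rcases h with h | ⟨g, h1, h2, h3, h4, h5, h6⟩
  · exact Or.inl (by rw [zp, h])
  have zg : val (x * refl (i, b)) (Fin.rev g) = val x (Fin.rev g) := by
    have := b.isLt
    have := g.isLt
    apply zq <;> apply ne_of_val_ne <;> (try rw [Fin.val_rev]) <;> (try rw [Fin.val_rev]) <;> omega
  refine Or.inr ⟨g, h1, h2, ?_⟩
  rw [zp, zg]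
  refine ⟨h3, h4, h5, ?_⟩
  have hbl := b.isLt
  -- The position g is strictly between i and b, so the step cannot jump over x(g), which is the top
  -- of the barred interval. If x(ī) lay in the interval, x(i) would leave the barred interval
  -- across this top.
  have hg := he.val_between (q := g) (by rw [Fin.lt_def]; omega) (by rw [Fin.lt_def]; omega)
  have r1 := val_rev_add x i
  have r2 := val_rev_add x g
  have r3 := val_rev_add x b
  have n1 := val_ne x hib.ne
  have n2 := val_ne x (show i ≠ g from ne_of_val_ne (by omega))
  have hi6 := h6 i hp (by omega)
  have hgood : ¬ (val x (Fin.rev g) ≤ val x b ∧ val x b ≤ val x p) ∧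
      ¬ (val x (Fin.rev g) ≤ val x (Fin.rev i) ∧ val x (Fin.rev i) ≤ val x p) ∧
      ¬ (val x (Fin.rev g) ≤ val x (Fin.rev b) ∧ val x (Fin.rev b) ≤ val x p) := by
    rcases hb with hb | rfl
    · have h7 := h6 b (by rw [Fin.lt_def]; omega) (by omega)
      have h8 := h6 (Fin.rev b) (by rw [Fin.lt_def, Fin.val_rev]; omega) (by rw [Fin.val_rev]; omega)
      omega
    · rw [Fin.rev_rev] at r3 ⊢
      omega
  intro q hq1 hq2
  by_cases q1 : q = i
  · rw [q1, za]; exact hgood.1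
  by_cases q2 : q = b
  · rw [q2, zb]; exact hi6
  by_cases q3 : q = Fin.rev i
  · subst q3
    have := val_rev_add (x * refl (i, b)) i
    omega
  by_cases q4 : q = Fin.rev b
  · subst q4
    have := val_rev_add (x * refl (i, b)) b
    omega
  rw [zq q q1 q2 q3 q4]
  exact h6 q hq1 hq2

/-! ### Pending rows under the roots (j, ī) -/

section LastPhase

variable {n k : ℕ} {u x : W n} {i j : Letter n}

theorem val_mul_refl_last (hk : k ≤ n) (hj : j < i) (hi : i.val < k) :
    val (x * refl (j, Fin.rev i)) j = val x (Fin.rev i) ∧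
    val (x * refl (j, Fin.rev i)) i = val x (Fin.rev j) ∧
    val (x * refl (j, Fin.rev i)) (Fin.rev i) = val x j ∧
    ∀ q, q ≠ i → q ≠ j → q ≠ Fin.rev i → q ≠ Fin.rev j →
      val (x * refl (j, Fin.rev i)) q = val x q := by
  have hj' : j.val < i.val := hj
  obtain ⟨za, zb, zq⟩ := val_mul_refl x
    (show j < Fin.rev i by rw [Fin.lt_def, Fin.val_rev]; omega)
  refine ⟨za, ?_, zb, fun q h1 h2 h3 h4 => zq q h2 h3 h4 (by rwa [Fin.rev_rev])⟩
  have r1 := val_rev_add (x * refl (j, Fin.rev i)) i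
  have r2 := val_rev_add x j
  omega

/-- The root (j, ī) with j < i is of the form ε_j + ε_i, so its edges go up and preserve signs. -/
theorem Edge.last_between (hk : k ≤ n) (hj : j < i) (hi : i.val < k)
    (he : Edge x (j, Fin.rev i)) : val x j < val x (Fin.rev i) ∧
      (val x j < n ↔ val x (Fin.rev i) < n) ∧
      ∀ q : Letter n, j.val < q.val → q.val < 2 * n - 1 - i.val →
        ¬ (val x j < val x q ∧ val x q < val x (Fin.rev i)) := by
  have hj' : j.val < i.val := hj
  have h1 := he.val_sign (by rw [Fin.val_rev]; omega)
    (ne_of_val_ne (by rw [Fin.val_rev, Fin.val_rev]; omega))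
  refine ⟨h1.1, h1.2, fun q h2 h3 => (he.val_between (q := q) h2 ?_).1 h1.1⟩
  rw [Fin.lt_def, Fin.val_rev]
  omega

/-- The values in rows i and j rise, so they could enter the forbidden interval only across its
lower end x(ḡ). As g > i, both g and ḡ lie strictly between j and ī, and the edge condition there
excludes a crossing by row j, respectively (after barring) by row i. -/
theorem Pending.step_last_lt (hk : k ≤ n) (hj : j < i) (hi : i.val < k) {p : Letter n} (hp : p < j)
    (h : Pending k (i.val + 1) u x p) (he : Edge x (j, Fin.rev i)) :
    Pending k (i.val + 1) u (x * refl (j, Fin.rev i)) p := by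
  obtain ⟨zj, zi, zi', zq⟩ := val_mul_refl_last (x := x) hk hj hi
  obtain ⟨e1, e2, e3⟩ := he.last_between hk hj hi
  have hj' : j.val < i.val := hj
  have hp' : p.val < j.val := hp
  have zp : val (x * refl (j, Fin.rev i)) p = val x p := by
    apply zq <;> apply ne_of_val_ne <;> (try rw [Fin.val_rev]) <;> omega
  rcases h with h | ⟨g, h1, h2, h3, h4, h5, h6⟩
  · exact Or.inl (by rw [zp, h])
  have hgl := g.isLt
  have zg : val (x * refl (j, Fin.rev i)) (Fin.rev g) = val x (Fin.rev g) := by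
    apply zq <;> apply ne_of_val_ne <;> (try rw [Fin.val_rev]) <;> (try rw [Fin.val_rev]) <;> omega
  refine Or.inr ⟨g, h1, h2, ?_⟩
  rw [zp, zg]
  refine ⟨h3, h4, h5, ?_⟩
  have hg1 := e3 g (by omega) (by omega)
  have hg2 := e3 (Fin.rev g) (by rw [Fin.val_rev]; omega) (by rw [Fin.val_rev]; omega)
  have r1 := val_rev_add x i
  have r2 := val_rev_add x g
  have r3 := val_rev_add x j
  have h7 := h6 i (by rw [Fin.lt_def]; omega) (by omega)
  have h8 := h6 j hp (by omega)
  have n1 := val_ne x (show Fin.rev i ≠ Fin.rev g from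
    ne_of_val_ne (by rw [Fin.val_rev, Fin.val_rev]; omega))
  have n2 := val_ne x (show Fin.rev j ≠ Fin.rev g from
    ne_of_val_ne (by rw [Fin.val_rev, Fin.val_rev]; omega))
  intro q hq1 hq2
  by_cases q1 : q = i
  · rw [q1, zi]; omega
  by_cases q2 : q = j
  · rw [q2, zj]; omega
  rw [zq q q1 q2]
  · exact h6 q hq1 hq2
  · apply ne_of_val_ne; rw [Fin.val_rev]; omega
  · apply ne_of_val_ne; rw [Fin.val_rev]; omega

/-- When row j moves for the first time, ī receives exactly u(j), so i itself becomes the guard;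
hence the index drops from i + 1 to i. On later moves the old guard stays and the interval grows
upwards through an empty gap. -/
theorem Pending.step_last_eq (hk : k ≤ n) (hj : j < i) (hi : i.val < k)
    (h : Pending k (i.val + 1) u x j) (he : Edge x (j, Fin.rev i)) :
    Pending k i.val u (x * refl (j, Fin.rev i)) j := by
  obtain ⟨zj, zi, zi', zq⟩ := val_mul_refl_last (x := x) hk hj hi
  obtain ⟨e1, e2, e3⟩ := he.last_between hk hj hi
  have hj' : j.val < i.val := hj
  have hil := i.isLt
  have r1 := val_rev_add x i
  have r3 := val_rev_add x j
  rcases h with h | ⟨g, h1, h2, h3, h4, h5, h6⟩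
  · refine Or.inr ⟨i, le_rfl, hi, ?_⟩
    rw [zi', zj, h]
    rw [h] at e1 e2
    refine ⟨le_rfl, e1, e2, ?_⟩
    intro q hq1 hq2
    have hq1' : j.val < q.val := hq1
    by_cases q1 : q = i
    · rw [q1, zi]; omega
    have n1 := val_ne x (show q ≠ j from ne_of_val_ne (by omega))
    have n2 := val_ne x (show q ≠ Fin.rev i from ne_of_val_ne (by rw [Fin.val_rev]; omega))
    rw [zq q q1]
    · have := e3 q hq1 (by omega)
      omega
    · apply ne_of_val_ne; omega
    · apply ne_of_val_ne; rw [Fin.val_rev]; omega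
    · apply ne_of_val_ne; rw [Fin.val_rev]; omega
  · have hgl := g.isLt
    have zg : val (x * refl (j, Fin.rev i)) (Fin.rev g) = val x (Fin.rev g) := by
      apply zq <;> apply ne_of_val_ne <;> (try rw [Fin.val_rev]) <;> (try rw [Fin.val_rev]) <;>
        omega
    refine Or.inr ⟨g, by omega, h2, ?_⟩
    rw [zg, zj]
    refine ⟨h3, by omega, by omega, ?_⟩
    intro q hq1 hq2
    have hq1' : j.val < q.val := hq1
    by_cases q1 : q = i
    · rw [q1, zi]; omega
    have n1 := val_ne x (show q ≠ j from ne_of_val_ne (by omega))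
    have n2 := val_ne x (show q ≠ Fin.rev i from ne_of_val_ne (by rw [Fin.val_rev]; omega))
    rw [zq q q1]
    · have := e3 q hq1 (by omega)
      have := h6 q hq1 hq2
      omega
    · apply ne_of_val_ne; omega
    · apply ne_of_val_ne; rw [Fin.val_rev]; omega
    · apply ne_of_val_ne; rw [Fin.val_rev]; omega

/-- Row p was passed earlier in the same segment, so its guard may be i. Then ī drops to x(j) and
the interval grows downwards through an empty gap. With any other guard only the value in row i
changes within the range. -/
theorem Pending.step_last_gt (hk : k ≤ n) (hj : j < i) (hi : i.val < k) {p : Letter n} (hp : j < p)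
    (hpi : p < i) (h : Pending k i.val u x p) (he : Edge x (j, Fin.rev i)) :
    Pending k i.val u (x * refl (j, Fin.rev i)) p := by
  obtain ⟨zj, zi, zi', zq⟩ := val_mul_refl_last (x := x) hk hj hi
  obtain ⟨e1, e2, e3⟩ := he.last_between hk hj hi
  have hj' : j.val < i.val := hj
  have hp' : j.val < p.val := hp
  have hpi' : p.val < i.val := hpi
  have hil := i.isLt
  have r1 := val_rev_add x i
  have r3 := val_rev_add x j
  have zp : val (x * refl (j, Fin.rev i)) p = val x p := by
    apply zq <;> apply ne_of_val_ne <;> (try rw [Fin.val_rev]) <;> omega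
  rcases h with h | ⟨g, h1, h2, h3, h4, h5, h6⟩
  · exact Or.inl (by rw [zp, h])
  have hgl := g.isLt
  by_cases hgi : g = i
  · subst hgi
    refine Or.inr ⟨g, le_rfl, h2, ?_⟩
    rw [zi', zp]
    refine ⟨by omega, h4, by omega, ?_⟩
    intro q hq1 hq2
    have hq1' : p.val < q.val := hq1
    by_cases q1 : q = g
    · rw [q1, zi]; omega
    have n1 := val_ne x (show q ≠ j from ne_of_val_ne (by omega))
    have n2 := val_ne x (show q ≠ Fin.rev g from ne_of_val_ne (by rw [Fin.val_rev]; omega))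
    rw [zq q q1]
    · have := e3 q (by omega) (by omega)
      have := h6 q hq1 hq2
      omega
    · apply ne_of_val_ne; omega
    · apply ne_of_val_ne; rw [Fin.val_rev]; omega
    · apply ne_of_val_ne; rw [Fin.val_rev]; omega
  · have hgi' : g.val ≠ i.val := fun h => hgi (Fin.ext h)
    have zg : val (x * refl (j, Fin.rev i)) (Fin.rev g) = val x (Fin.rev g) := by
      apply zq <;> apply ne_of_val_ne <;> (try rw [Fin.val_rev]) <;> (try rw [Fin.val_rev]) <;>
        omega
    refine Or.inr ⟨g, h1, h2, ?_⟩
    rw [zg, zp]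
    refine ⟨h3, h4, h5, ?_⟩
    have hg1 := e3 g (by omega) (by omega)
    have r2 := val_rev_add x g
    have h7 := h6 i hpi (by omega)
    have n2 := val_ne x (show Fin.rev j ≠ Fin.rev g from
      ne_of_val_ne (by rw [Fin.val_rev, Fin.val_rev]; omega))
    intro q hq1 hq2
    have hq1' : p.val < q.val := hq1
    by_cases q1 : q = i
    · rw [q1, zi]; omega
    rw [zq q q1]
    · exact h6 q hq1 hq2
    · apply ne_of_val_ne; omega
    · apply ne_of_val_ne; rw [Fin.val_rev]; omega
    · apply ne_of_val_ne; rw [Fin.val_rev]; omega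

end LastPhase

/-! ### The row which is being processed -/

/-- The arc from the original value `u(p)` to the current value `x(p)` contains no value in the rows
`p < l < k`, and `c` tells whether it wraps around. -/
def Progress {n : ℕ} (k : ℕ) (u x : W n) (p : Letter n) (c : ℕ) : Prop :=
  (∀ l : Letter n, p < l → l.val < k → ¬ InArc (val u p) (val x p) (val x l)) ∧
    c = if val x p < val u p then 1 else 0

/-- The arc is prolonged by a stretch that the edge condition keeps free of later rows. As the move
does not pass u(p), the arc wraps at most once, and it does so at a downward step. -/
theorem Progress.step {n k : ℕ} {u x z : W n} {p b : Letter n} {c : ℕ} (h : Progress k u x p c)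
    (hpb : p ≠ b) (hz : val z p = val x b)
    (hl : ∀ l : Letter n, p < l → l.val < k → val z l = val x l)
    (hav : Avoids (val u p) (val x p) (val x b))
    (hbet : ∀ l : Letter n, p < l → l.val < k →
      (val x p < val x b → ¬ (val x p < val x l ∧ val x l < val x b)) ∧
      (val x b < val x p → val x l ≤ val x p ∧ val x b ≤ val x l)) :
    Progress k u z p (c + if x.1 b < x.1 p then 1 else 0) := by
  have hne := val_ne x hpb
  have hiff : x.1 b < x.1 p ↔ val x b < val x p := Iff.rfl
  refine ⟨fun l h1 h2 => ?_, ?_⟩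
  · have h3 := h.1 l h1 h2
    have h4 := hbet l h1 h2
    have h5 := val_ne x h1.ne
    rw [hz, hl l h1 h2]
    simp only [InArc, Avoids] at h3 hav ⊢
    split_ifs at h3 hav ⊢ <;> omega
  · rw [h.2, hz]
    simp only [hiff]
    simp only [Avoids] at hav
    split_ifs at hav ⊢ <;> omega

/-- The part of the invariant of the segment of the row `p` that is common to all its phases. -/
structure Core {n : ℕ} (k : ℕ) (u x₀ x : W n) (p : Letter n) (f c₀ c : ℕ) : Prop where
  low_le : f ≤ val u p
  le_high : val u p ≤ c₀
  sign : f < n ↔ c₀ < n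
  low : f = c₀ ∨ ∃ g : Letter n, p < g ∧ g.val < k ∧ val x (Fin.rev g) = f
  progress : Progress k u x p c
  fixed : ∀ l : Letter n, p < l → l.val < k → val x l = val x₀ l

/-- Apart from not passing u(p), everything follows from the edge condition and from the positions
touched; the phases below differ only in how they establish `Avoids`. -/
theorem Core.step_middle {n k : ℕ} (hk : k ≤ n) {u x₀ x : W n} {p b : Letter n} {f c₀ c : ℕ}
    (h : Core k u x₀ x p f c₀ c) (hp : p.val < k)
    (hb : (k ≤ b.val ∧ b.val < 2 * n - k) ∨ b = Fin.rev p) (he : Edge x (p, b))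
    (hav : Avoids (val u p) (val x p) (val x b)) :
    Core k u x₀ (x * refl (p, b)) p f c₀ (c + if x.1 b < x.1 p then 1 else 0) := by
  have hpb : p < b := by
    rw [Fin.lt_def]
    rcases hb with hb | rfl
    · omega
    · rw [Fin.val_rev]; omega
  obtain ⟨za, zb, zq⟩ := val_mul_refl x hpb
  have hbv : k ≤ b.val ∧ (b.val < 2 * n - k ∨ b.val = 2 * n - 1 - p.val) := by
    rcases hb with hb | rfl
    · omega
    · rw [Fin.val_rev]; omega
  have hbl := b.isLt
  have hfix : ∀ l : Letter n, p < l → l.val < k → val (x * refl (p, b)) l = val x l := by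
    intro l h1 h2
    have h1' : p.val < l.val := h1
    apply zq <;> apply ne_of_val_ne <;> (try rw [Fin.val_rev]) <;> omega
  refine ⟨h.low_le, h.le_high, h.sign, ?_, ?_, fun l h1 h2 => ?_⟩
  · rcases h.low with h1 | ⟨g, h1, h2, h3⟩
    · exact Or.inl h1
    · refine Or.inr ⟨g, h1, h2, ?_⟩
      have hgl := g.isLt
      have h1' : p.val < g.val := h1
      rw [← h3]
      apply zq <;> apply ne_of_val_ne <;> (try rw [Fin.val_rev]) <;> (try rw [Fin.val_rev]) <;>
        omega
  · refine h.progress.step hpb.ne za hfix hav fun l h1 h2 => ?_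
    exact he.val_between h1 (by rw [Fin.lt_def]; omega)
  · rw [hfix l h1 h2, h.fixed l h1 h2]

/-- The row `p` has not moved in its own segment. -/
def Unmoved {n : ℕ} (k : ℕ) (x : W n) (p : Letter n) (f c₀ : ℕ) : Prop :=
  val x p = c₀ ∧ ∀ q : Letter n, p < q → q.val < 2 * n - k → ¬ (f ≤ val x q ∧ val x q ≤ c₀)

/-- The value which the row `p` had at the beginning of its segment is now in the row `m ≥ k`. -/
def Marked {n : ℕ} (k : ℕ) (x : W n) (p : Letter n) (f c₀ : ℕ) (m : Letter n) : Prop :=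
  k ≤ m.val ∧ m.val < n ∧ val x m = c₀ ∧ ¬ (f ≤ val x p ∧ val x p ≤ c₀) ∧
    ¬ (f ≤ val x (Fin.rev p) ∧ val x (Fin.rev p) ≤ c₀) ∧
    ∀ q : Letter n, p < q → q.val < 2 * n - k → ¬ (f ≤ val x q ∧ val x q < c₀)

/-- The row `p` has a value of the opposite sign, or has moved up without changing the sign. -/
def Settled {n : ℕ} (u x : W n) (p : Letter n) : Prop :=
  (val x p < n ↔ val u p < n) → val u p ≤ val x p

/-- The target lies outside [f, c₀], which contains u(p), so passing u(p) would mean passing c₀. -/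
theorem Core.avoids {n k : ℕ} {u x₀ x : W n} {p : Letter n} {f c₀ c a b : ℕ}
    (h : Core k u x₀ x p f c₀ c) (hb : ¬ (f ≤ b ∧ b ≤ c₀))
    (hab : a ≠ b)
    (h1 : a < b → ¬ (a < c₀ ∧ c₀ < b)) (h2 : b < a → c₀ ≤ a ∧ b ≤ c₀) :
    Avoids (val u p) a b := by
  have := h.low_le
  have := h.le_high
  simp only [Avoids]
  split_ifs <;> omega

/-! ### Moves of the row being processed -/

section Phases

variable {n k : ℕ} {u x₀ x : W n} {p b : Letter n} {f c₀ c : ℕ}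

/-- The first move hands c₀ over to row b, which becomes the marker. No edge condition is needed:
the row starts at the top of [f, c₀], and the target lies outside this interval. -/
theorem Unmoved.step_first (hk : k ≤ n) (hp : p.val < k) (hb : k ≤ b.val) (hbn : b.val < n)
    (h : Core k u x₀ x p f c₀ c) (hu : Unmoved k x p f c₀) :
    Avoids (val u p) (val x p) (val x b) ∧ Marked k (x * refl (p, b)) p f c₀ b := by
  have hpb : p < b := by rw [Fin.lt_def]; omega
  obtain ⟨za, zb, zq⟩ := val_mul_refl x hpb
  have h1 := h.low_le
  have h2 := h.le_high
  have h3 := h.sign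
  have h4 := hu.1
  have h5 := hu.2 b hpb (by omega)
  have h6 := hu.2 (Fin.rev b) (by rw [Fin.lt_def, Fin.val_rev]; omega) (by rw [Fin.val_rev]; omega)
  have r1 := val_rev_add x p
  have r2 := val_rev_add x b
  have r3 := val_rev_add (x * refl (p, b)) p
  have r4 := val_rev_add (x * refl (p, b)) b
  refine ⟨?_, hb, hbn, by rw [zb, h4], by omega, by omega, fun q q1 q2 => ?_⟩
  · simp only [Avoids]
    split_ifs <;> omega
  · have q1' : p.val < q.val := q1
    by_cases q3 : q = b
    · rw [q3]; omega
    by_cases q4 : q = Fin.rev b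
    · rw [q4]; omega
    rw [zq q q1.ne' q3 _ q4]
    · have := hu.2 q q1 q2
      omega
    · apply ne_of_val_ne; rw [Fin.val_rev]; omega

/-- The marker m lies strictly between p and b and holds c₀, so the edge cannot jump over c₀. -/
theorem Marked.step_first (hp : p.val < k) (hb : k ≤ b.val) (hbn : b.val < n)
    {m : Letter n} (hmb : m < b) (he : Edge x (p, b))
    (h : Core k u x₀ x p f c₀ c) (hu : Marked k x p f c₀ m) :
    Avoids (val u p) (val x p) (val x b) ∧ Marked k (x * refl (p, b)) p f c₀ m := by
  have hpb : p < b := by rw [Fin.lt_def]; omega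
  have hmb' : m.val < b.val := hmb
  obtain ⟨za, zb, zq⟩ := val_mul_refl x hpb
  obtain ⟨u1, u2, u3, u4, u5, u6⟩ := hu
  have h5 := u6 b hpb (by omega)
  have h6 := u6 (Fin.rev b) (by rw [Fin.lt_def, Fin.val_rev]; omega) (by rw [Fin.val_rev]; omega)
  have r1 := val_rev_add x p
  have r2 := val_rev_add x b
  have r3 := val_rev_add (x * refl (p, b)) p
  have r4 := val_rev_add (x * refl (p, b)) b
  have hm := he.val_between (q := m) (by rw [Fin.lt_def]; omega) hmb
  have n1 := val_ne x hmb.ne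
  have n2 := val_ne x hpb.ne
  have n3 := val_ne x (show m ≠ Fin.rev b from ne_of_val_ne (by rw [Fin.val_rev]; omega))
  have zm : val (x * refl (p, b)) m = val x m := by
    apply zq <;> apply ne_of_val_ne <;> (try rw [Fin.val_rev]) <;> omega
  refine ⟨?_, u1, u2, by rw [zm, u3], by omega, by omega, fun q q1 q2 => ?_⟩
  · exact h.avoids (by omega) n2 (by omega) (by omega)
  · have q1' : p.val < q.val := q1
    by_cases q3 : q = b
    · rw [q3]; omega
    by_cases q4 : q = Fin.rev b
    · rw [q4]; omega
    rw [zq q q1.ne' q3 _ q4]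
    · exact u6 q q1 q2
    · apply ne_of_val_ne; rw [Fin.val_rev]; omega

/-- All of [f, c₀] has one sign, so the bar of c₀ is outside it. The new value has the sign opposite
to u(p), which makes `Settled` vacuous. -/
theorem Unmoved.step_rev (hk : k ≤ n) (hp : p.val < k)
    (h : Core k u x₀ x p f c₀ c) (hu : Unmoved k x p f c₀) :
    Avoids (val u p) (val x p) (val x (Fin.rev p)) ∧
      Settled u (x * refl (p, Fin.rev p)) p := by
  have hpb : p < Fin.rev p := by rw [Fin.lt_def, Fin.val_rev]; omega
  obtain ⟨za, zb, zq⟩ := val_mul_refl x hpb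
  have h1 := h.low_le
  have h2 := h.le_high
  have h3 := h.sign
  have h4 := hu.1
  have r1 := val_rev_add x p
  refine ⟨?_, ?_⟩
  · simp only [Avoids]
    split_ifs <;> omega
  · intro h5
    omega

theorem Marked.step_rev (hk : k ≤ n) (hp : p.val < k)
    {m : Letter n} (he : Edge x (p, Fin.rev p))
    (h : Core k u x₀ x p f c₀ c) (hu : Marked k x p f c₀ m) :
    Avoids (val u p) (val x p) (val x (Fin.rev p)) ∧
      Marked k (x * refl (p, Fin.rev p)) p f c₀ m := by
  have hpb : p < Fin.rev p := by rw [Fin.lt_def, Fin.val_rev]; omega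
  obtain ⟨za, zb, zq⟩ := val_mul_refl x hpb
  obtain ⟨u1, u2, u3, u4, u5, u6⟩ := hu
  have hm := he.val_between (q := m) (by rw [Fin.lt_def]; omega)
    (by rw [Fin.lt_def, Fin.val_rev]; omega)
  have n2 := val_ne x hpb.ne
  have zz : ∀ q : Letter n, p < q → q.val < 2 * n - k →
      val (x * refl (p, Fin.rev p)) q = val x q := by
    intro q h1 h2
    have h1' : p.val < q.val := h1
    apply zq <;> apply ne_of_val_ne <;> (try rw [Fin.val_rev]) <;> (try rw [Fin.val_rev]) <;> omega
  refine ⟨?_, u1, u2, ?_, by omega, by omega, fun q q1 q2 => ?_⟩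
  · exact h.avoids u5 n2 (by omega) (by omega)
  · rw [zz m (by rw [Fin.lt_def]; omega) (by omega), u3]
  · rw [zz q q1 q2]
    exact u6 q q1 q2

theorem Unmoved.settled (h : Core k u x₀ x p f c₀ c) (hu : Unmoved k x p f c₀) : Settled u x p := by
  intro _
  rw [hu.1]
  exact h.le_high

/-- An upward move without sign change can pass u(p) only from below and within its sign, and a
settled row is never there. -/
theorem Settled.avoids (hu : Settled u x p) {d : ℕ} (h1 : val x p < d) (h2 : val x p < n ↔ d < n) :
    Avoids (val u p) (val x p) d := by
  simp only [Settled] at hu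
  simp only [Avoids]
  split_ifs
  omega

theorem Settled.step {z : W n} (hu : Settled u x p) (h1 : val x p < val z p)
    (h2 : val x p < n ↔ val z p < n) : Settled u z p := by
  intro h
  have := hu (h2.trans h)
  omega

/-- If b is the bar of the marker, row p receives the bar of c₀: the marker is lost, but the row now
has the sign opposite to u(p). Otherwise the marker survives and acts as before. -/
theorem Marked.step_third (hk : k ≤ n) (hp : p.val < k) (hb : n ≤ b.val) (hbn : b.val < 2 * n - k)
    {m : Letter n} (he : Edge x (p, b))
    (h : Core k u x₀ x p f c₀ c) (hu : Marked k x p f c₀ m) :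
    Avoids (val u p) (val x p) (val x b) ∧
      (Marked k (x * refl (p, b)) p f c₀ m ∨ Settled u (x * refl (p, b)) p) := by
  have hpb : p < b := by rw [Fin.lt_def]; omega
  obtain ⟨za, zb, zq⟩ := val_mul_refl x hpb
  obtain ⟨u1, u2, u3, u4, u5, u6⟩ := hu
  have h5 := u6 b hpb (by omega)
  have h6 := u6 (Fin.rev b) (by rw [Fin.lt_def, Fin.val_rev]; omega) (by rw [Fin.val_rev]; omega)
  have r1 := val_rev_add x p
  have r2 := val_rev_add x b
  have r3 := val_rev_add (x * refl (p, b)) p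
  have r4 := val_rev_add (x * refl (p, b)) b
  have hm := he.val_between (q := m) (by rw [Fin.lt_def]; omega) (by rw [Fin.lt_def]; omega)
  have n1 := val_ne x (show m ≠ b from ne_of_val_ne (by omega))
  have n2 := val_ne x hpb.ne
  refine ⟨h.avoids (by omega) n2 (by omega) (by omega), ?_⟩
  by_cases hmb : m = Fin.rev b
  · right
    intro hs
    have h1 := h.low_le
    have h2 := h.le_high
    have h3 := h.sign
    rw [hmb] at u3
    omega
  · left
    have n3 := val_ne x hmb
    have zm : val (x * refl (p, b)) m = val x m := by
      apply zq _ _ _ _ hmb <;> apply ne_of_val_ne <;> (try rw [Fin.val_rev]) <;> omega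
    refine ⟨u1, u2, by rw [zm, u3], by omega, by omega, fun q q1 q2 => ?_⟩
    have q1' : p.val < q.val := q1
    by_cases q3 : q = b
    · rw [q3]; omega
    by_cases q4 : q = Fin.rev b
    · rw [q4]; omega
    rw [zq q q1.ne' q3 _ q4]
    · exact u6 q q1 q2
    · apply ne_of_val_ne; rw [Fin.val_rev]; omega

/-- The invariant of the row `p` in the last phase of its segment. -/
def Visible {n : ℕ} (k : ℕ) (u x : W n) (p : Letter n) (f c₀ : ℕ) : Prop :=
  Settled u x p ∨ (¬ (f ≤ val x p ∧ val x p ≤ c₀) ∧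
    ∃ m : Letter n, k ≤ m.val ∧ m.val < n ∧ val x m = c₀)

/-- Row p rises from x(p) to x(j̄). If it is not settled, m̄ lies strictly between j and ī for i =
p, so c₀ is not jumped over; and the interval is not entered from below, since its lower end f is
held by some ḡ whose row g is also strictly between. This is why f must be either c₀ or such a
value. -/
theorem Core.step_last (hk : k ≤ n) (hp : p.val < k) {j : Letter n} (hj : j < p)
    (h : Core k u x₀ x p f c₀ c) (hv : Visible k u x p f c₀) (he : Edge x (j, Fin.rev p)) :
    Core k u x₀ (x * refl (j, Fin.rev p)) p f c₀ c ∧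
      Visible k u (x * refl (j, Fin.rev p)) p f c₀ := by
  obtain ⟨zj, zi, zi', zq⟩ := val_mul_refl_last (x := x) hk hj hp
  obtain ⟨e1, e2, e3⟩ := he.last_between hk hj hp
  have hj' : j.val < p.val := hj
  have hpl := p.isLt
  have r1 := val_rev_add x p
  have r2 := val_rev_add x j
  have h1 := h.low_le
  have h2 := h.le_high
  have h3 := h.sign
  have hvv : Avoids (val u p) (val x p) (val x (Fin.rev j)) ∧
      Visible k u (x * refl (j, Fin.rev p)) p f c₀ := by
    rcases hv with hv | ⟨hv, m, m1, m2, m3⟩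
    · exact ⟨hv.avoids (by omega) (by omega), Or.inl (hv.step (by omega) (by omega))⟩
    · have em := e3 (Fin.rev m) (by rw [Fin.val_rev]; omega) (by rw [Fin.val_rev]; omega)
      have r3 := val_rev_add x m
      have n1 := val_ne x (show m ≠ Fin.rev j from ne_of_val_ne (by rw [Fin.val_rev]; omega))
      have zm : val (x * refl (j, Fin.rev p)) m = val x m := by
        apply zq <;> apply ne_of_val_ne <;> (try rw [Fin.val_rev]) <;> omega
      have hb : ¬ (f ≤ val x (Fin.rev j) ∧ val x (Fin.rev j) ≤ c₀) := by
        rcases h.low with h4 | ⟨g, g1, g2, g3⟩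
        · omega
        · have g1' : p.val < g.val := g1
          have eg := e3 g (by omega) (by omega)
          have r4 := val_rev_add x g
          have n2 := val_ne x (show Fin.rev g ≠ Fin.rev j from
            ne_of_val_ne (by rw [Fin.val_rev, Fin.val_rev]; omega))
          omega
      refine ⟨h.avoids hb (by omega) (by omega) (by omega), Or.inr ⟨?_, m, m1, m2, ?_⟩⟩
      · rw [zi]; exact hb
      · rw [zm, m3]
  have hfix : ∀ l : Letter n, p < l → l.val < k →
      val (x * refl (j, Fin.rev p)) l = val x l := by
    intro l l1 l2
    have l1' : p.val < l.val := l1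
    apply zq <;> apply ne_of_val_ne <;> (try rw [Fin.val_rev]) <;> omega
  refine ⟨⟨h1, h2, h3, ?_, ?_, fun l l1 l2 => ?_⟩, hvv.2⟩
  · rcases h.low with h4 | ⟨g, g1, g2, g3⟩
    · exact Or.inl h4
    · refine Or.inr ⟨g, g1, g2, ?_⟩
      have hgl := g.isLt
      have g1' : p.val < g.val := g1
      rw [← g3]
      apply zq <;> apply ne_of_val_ne <;> (try rw [Fin.val_rev]) <;> (try rw [Fin.val_rev]) <;>
        omega
  · have := h.progress.step (b := Fin.rev j) (z := x * refl (j, Fin.rev p))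
      (ne_of_val_ne (by rw [Fin.val_rev]; omega)) zi hfix hvv.1 fun l l1 l2 => by
        have l1' : p.val < l.val := l1
        have el := e3 (Fin.rev l) (by rw [Fin.val_rev]; omega) (by rw [Fin.val_rev]; omega)
        have r3 := val_rev_add x l
        exact ⟨by omega, by omega⟩
    rwa [if_neg (by
      change ¬ val x (Fin.rev j) < val x p
      omega), add_zero] at this
  · rw [hfix l l1 l2, h.fixed l l1 l2]

end Phases

/-- At the start of its segment the row is at c₀ = x(p). The lower end f is c₀ itself if earlier
segments left the row where it was, and the guard's value x(ḡ) otherwise. -/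
theorem Pending.exists_core {n k : ℕ} (hk : k ≤ n) {u x : W n} {p : Letter n}
    (h : Pending k (p.val + 1) u x p) :
    ∃ f, Core k u x x p f (val x p) 0 ∧ Unmoved k x p f (val x p) := by
  rcases h with h | ⟨g, h1, h2, h3, h4, h5, h6⟩
  · refine ⟨val x p, ⟨h.le, h.ge, Iff.rfl, Or.inl rfl, ⟨fun l h1 h2 => ?_, ?_⟩, fun _ _ _ => rfl⟩,
      rfl, fun q h1 h2 => ?_⟩
    · rw [h, InArc, if_pos le_rfl]
      omega
    · rw [h, if_neg (lt_irrefl _)]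
    · have := val_ne x h1.ne
      omega
  · refine ⟨val x (Fin.rev g), ⟨h3, h4.le, h5, Or.inr ⟨g, h1, h2, rfl⟩,
      ⟨fun l h1 h2 => ?_, ?_⟩, fun _ _ _ => rfl⟩, rfl, h6⟩
    · have := h6 l h1 (by omega)
      rw [InArc, if_pos h4.le]
      omega
    · rw [if_neg h4.not_gt]

/-! ### Segments of the chain -/

theorem pos_val {n : ℕ} (i : Fin n) : (pos i).val = i.val := rfl

theorem bar_val {n : ℕ} (i : Fin n) : (bar i).val = 2 * n - 1 - i.val := by
  rw [bar, Fin.val_rev, pos_val]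
  omega

section Segment

variable {n k : ℕ} {u x₀ y : W n} {i : Fin n} {q : List (Root n)}

theorem pairwise_filter_finRange (n : ℕ) (P : Fin n → Bool) :
    ((List.finRange n).filter P).Pairwise (· < ·) :=
  (List.pairwise_lt_finRange n).filter P

/-- The second letters increase along the list, so a marker created at b lies to the left of every
later partner; this is the clause on `m < β.2` in the invariant. -/
theorem RPath.first_phase (hk : k ≤ n) (hi : i.val < k) {f c₀ : ℕ}
    (h : RPath (((List.finRange n).filter fun j => k ≤ j.val).map fun j => (pos i, pos j)) x₀ y q)
    (hp : ∀ p < pos i, Pending k (i.val + 1) u x₀ p)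
    (hc : Core k u x₀ x₀ (pos i) f c₀ 0) (hu : Unmoved k x₀ (pos i) f c₀) :
    (∀ p < pos i, Pending k (i.val + 1) u y p) ∧ Core k u x₀ y (pos i) f c₀ q.length ∧
      (Unmoved k y (pos i) f c₀ ∨ ∃ m, Marked k y (pos i) f c₀ m) := by
  have key := h.invariant (c := 0) (I := fun L x c =>
    L.Pairwise (fun β γ => β.2 < γ.2) ∧ (∀ β ∈ L, β.1 = pos i ∧ k ≤ β.2.val ∧ β.2.val < n) ∧
    (∀ p < pos i, Pending k (i.val + 1) u x p) ∧ Core k u x₀ x (pos i) f c₀ c ∧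
    (Unmoved k x (pos i) f c₀ ∨ ∃ m, Marked k x (pos i) f c₀ m ∧ ∀ β ∈ L, m < β.2)) ?_ ?_ ?_
  · obtain ⟨-, -, h1, h2, h3⟩ := key
    rw [zero_add] at h2
    exact ⟨h1, h2, h3.imp id fun ⟨m, hm⟩ => ⟨m, hm.1⟩⟩
  · rintro β L x c ⟨h1, h2, h3, h4, h5⟩
    refine ⟨h1.of_cons, fun γ hγ => h2 γ (List.mem_cons_of_mem _ hγ), h3, h4, ?_⟩
    exact h5.imp id fun ⟨m, hm⟩ => ⟨m, hm.1, fun γ hγ => hm.2 γ (List.mem_cons_of_mem _ hγ)⟩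
  · rintro ⟨a, b⟩ L x c ⟨h1, h2, h3, h4, h5⟩ he
    obtain ⟨ha, hb, hbn⟩ := h2 _ List.mem_cons_self
    simp only at ha hb hbn he
    subst ha
    rw [List.pairwise_cons] at h1
    have hb' : (k ≤ b.val ∧ b.val < 2 * n - k) ∨ b = Fin.rev (pos i) := Or.inl ⟨hb, by omega⟩
    refine ⟨h1.2, fun γ hγ => h2 γ (List.mem_cons_of_mem _ hγ),
      fun p hp => (h3 p hp).step_middle hk hp hi hb' he, ?_⟩
    rcases h5 with h5 | ⟨m, hm, hmb⟩
    · obtain ⟨h6, h7⟩ := h5.step_first hk hi hb hbn h4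
      exact ⟨h4.step_middle hk hi hb' he h6, Or.inr ⟨b, h7, h1.1⟩⟩
    · obtain ⟨h6, h7⟩ := hm.step_first hi hb hbn (hmb _ List.mem_cons_self) he h4
      exact ⟨h4.step_middle hk hi hb' he h6,
        Or.inr ⟨m, h7, fun γ hγ => hmb γ (List.mem_cons_of_mem _ hγ)⟩⟩
  · refine ⟨?_, ?_, hp, hc, Or.inl hu⟩
    · rw [List.pairwise_map]
      exact pairwise_filter_finRange n _
    · intro β hβ
      simp only [List.mem_map, List.mem_filter, decide_eq_true_eq] at hβ
      obtain ⟨j, ⟨-, hj⟩, rfl⟩ := hβ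
      exact ⟨rfl, hj, j.isLt⟩

theorem RPath.middle_phase (hk : k ≤ n) (hi : i.val < k) {f c₀ c : ℕ} {x : W n}
    (h : RPath ([(pos i, bar i)] ++
      (((List.finRange n).filter fun j => k ≤ j.val).map fun j => (pos i, bar j)).reverse) x y q)
    (hp : ∀ p < pos i, Pending k (i.val + 1) u x p)
    (hc : Core k u x₀ x (pos i) f c₀ c)
    (hu : Unmoved k x (pos i) f c₀ ∨ ∃ m, Marked k x (pos i) f c₀ m) :
    (∀ p < pos i, Pending k (i.val + 1) u y p) ∧
      Core k u x₀ y (pos i) f c₀ (c + q.length) ∧ Visible k u y (pos i) f c₀ := by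
  -- The last clause says that only the head of the remaining list can be (i, ī). Hence once a step
  -- has been taken only barred partners remain, and a settled row meets only upward,
  -- sign-preserving steps.
  have key := h.invariant (c := c) (I := fun L x c =>
    (∀ β ∈ L, β.1 = pos i ∧
      ((n ≤ β.2.val ∧ β.2.val < 2 * n - k) ∨ β.2 = Fin.rev (pos i))) ∧
    (∀ p < pos i, Pending k (i.val + 1) u x p) ∧ Core k u x₀ x (pos i) f c₀ c ∧
    (Unmoved k x (pos i) f c₀ ∨ (∃ m, Marked k x (pos i) f c₀ m) ∨
      (Settled u x (pos i) ∧ ∀ β ∈ L, n ≤ β.2.val ∧ β.2.val < 2 * n - k)) ∧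
    L.Pairwise (fun _ γ => n ≤ γ.2.val ∧ γ.2.val < 2 * n - k)) ?_ ?_ ?_
  · obtain ⟨-, h1, h2, h3, -⟩ := key
    refine ⟨h1, h2, ?_⟩
    rcases h3 with h3 | ⟨m, h3⟩ | h3
    · exact Or.inl (h3.settled h2)
    · exact Or.inr ⟨h3.2.2.2.1, m, h3.1, h3.2.1, h3.2.2.1⟩
    · exact Or.inl h3.1
  · rintro β L x c ⟨h2, h3, h4, h5, h6⟩
    refine ⟨fun γ hγ => h2 γ (List.mem_cons_of_mem _ hγ), h3, h4, ?_, h6.of_cons⟩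
    exact h5.imp id fun h => h.imp id fun h =>
      ⟨h.1, fun γ hγ => h.2 γ (List.mem_cons_of_mem _ hγ)⟩
  · rintro ⟨a, b⟩ L x c ⟨h2, h3, h4, h5, h8⟩ he
    obtain ⟨ha, hb⟩ := h2 _ List.mem_cons_self
    simp only at ha hb he
    subst ha
    rw [List.pairwise_cons] at h8
    have hb' : (k ≤ b.val ∧ b.val < 2 * n - k) ∨ b = Fin.rev (pos i) :=
      hb.imp (fun h => ⟨by omega, h.2⟩) id
    refine ⟨fun γ hγ => h2 γ (List.mem_cons_of_mem _ hγ),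
      fun p hp => (h3 p hp).step_middle hk hp hi hb' he, ?_⟩
    have hsign : (n ≤ b.val ∧ b.val < 2 * n - k) → val x (pos i) < val x b ∧
        (val x (pos i) < n ↔ val x b < n) := fun hb1 => he.val_sign hb1.1 (ne_of_val_ne (by
      rw [Fin.val_rev, pos_val]
      omega))
    have hset : (n ≤ b.val ∧ b.val < 2 * n - k) → Settled u x (pos i) →
        Avoids (val u (pos i)) (val x (pos i)) (val x b) ∧
          Settled u (x * refl (pos i, b)) (pos i) := by
      intro hb1 hs
      have h6 := hsign hb1
      refine ⟨hs.avoids h6.1 h6.2, ?_⟩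
      have h7 := (val_mul_refl x (show pos i < b by rw [Fin.lt_def, pos_val]; omega)).1
      exact hs.step (by rw [h7]; exact h6.1) (by rw [h7]; exact h6.2)
    rcases h5 with h5 | ⟨m, hm⟩ | ⟨h5, hL⟩
    · rcases hb with hb | rfl
      · obtain ⟨h6, h7⟩ := hset hb (h5.settled h4)
        exact ⟨h4.step_middle hk hi hb' he h6, Or.inr (Or.inr ⟨h7, h8.1⟩), h8.2⟩
      · obtain ⟨h6, h7⟩ := h5.step_rev hk hi h4
        exact ⟨h4.step_middle hk hi hb' he h6, Or.inr (Or.inr ⟨h7, h8.1⟩), h8.2⟩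
    · rcases hb with hb | rfl
      · obtain ⟨h6, h7⟩ := hm.step_third hk hi hb.1 hb.2 he h4
        exact ⟨h4.step_middle hk hi hb' he h6,
          Or.inr (h7.imp (fun h => ⟨m, h⟩) fun h => ⟨h, h8.1⟩), h8.2⟩
      · obtain ⟨h6, h7⟩ := hm.step_rev hk hi he h4
        exact ⟨h4.step_middle hk hi hb' he h6, Or.inr (Or.inl ⟨m, h7⟩), h8.2⟩
    · obtain ⟨h6, h7⟩ := hset (hL _ List.mem_cons_self) h5
      exact ⟨h4.step_middle hk hi hb' he h6, Or.inr (Or.inr ⟨h7, h8.1⟩), h8.2⟩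
  · have hmem : ∀ β ∈ (((List.finRange n).filter fun j => k ≤ j.val).map fun j =>
        (pos i, bar j)).reverse, β.1 = pos i ∧ (n ≤ β.2.val ∧ β.2.val < 2 * n - k) := by
      intro β hβ
      simp only [List.mem_reverse, List.mem_map, List.mem_filter, decide_eq_true_eq] at hβ
      obtain ⟨j, ⟨-, hj⟩, rfl⟩ := hβ
      have := j.isLt
      refine ⟨rfl, ?_⟩
      simp only [bar_val]
      omega
    refine ⟨fun β hβ => ?_, hp, hc, hu.imp id Or.inl, ?_⟩
    · rcases List.mem_append.1 hβ with hβ | hβ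
      · rw [List.mem_singleton.1 hβ]
        exact ⟨rfl, Or.inr rfl⟩
      · exact ⟨(hmem β hβ).1, Or.inl (hmem β hβ).2⟩
    · rw [List.singleton_append, List.pairwise_cons]
      refine ⟨fun β hβ => (hmem β hβ).2, ?_⟩
      rw [List.pairwise_iff_forall_sublist]
      exact fun {a b} hab => (hmem b (hab.subset (by simp))).2

theorem RPath.last_phase (hk : k ≤ n) (hi : i.val < k) {f c₀ c : ℕ} {x : W n}
    (h : RPath (gammaRow i).reverse x y q)
    (hp : ∀ p < pos i, Pending k (i.val + 1) u x p)
    (hc : Core k u x₀ x (pos i) f c₀ c)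
    (hv : Visible k u x (pos i) f c₀) :
    (∀ p < pos i, Pending k i.val u y p) ∧
      Core k u x₀ y (pos i) f c₀ c ∧ Visible k u y (pos i) f c₀ := by
  -- Rows not yet reached by the remaining roots keep a guard beyond i, as `step_last_lt` and
  -- `step_last_eq` require; rows already passed may have the guard i. The counter plays no role
  -- because this phase has no quantum steps.
  have key := h.invariant (c := 0) (I := fun L x _ =>
    L.Pairwise (fun β γ => γ.1 < β.1) ∧ (∀ β ∈ L, β.1 < pos i ∧ β.2 = Fin.rev (pos i)) ∧
    (∀ p < pos i, Pending k i.val u x p ∧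
      ((∃ β ∈ L, p ≤ β.1) → Pending k (i.val + 1) u x p)) ∧
    Core k u x₀ x (pos i) f c₀ c ∧ Visible k u x (pos i) f c₀) ?_ ?_ ?_
  · obtain ⟨-, -, h1, h2, h3⟩ := key
    exact ⟨fun p hp => (h1 p hp).1, h2, h3⟩
  · rintro β L x c ⟨h1, h2, h3, h4, h5⟩
    exact ⟨h1.of_cons, fun γ hγ => h2 γ (List.mem_cons_of_mem _ hγ), fun p hp => ⟨(h3 p hp).1,
      fun ⟨γ, hγ, hpγ⟩ => (h3 p hp).2 ⟨γ, List.mem_cons_of_mem _ hγ, hpγ⟩⟩, h4, h5⟩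
  · rintro ⟨j, b⟩ L x c ⟨h1, h2, h3, h4, h5⟩ he
    obtain ⟨hj, hb⟩ := h2 _ List.mem_cons_self
    simp only at hj hb he
    subst hb
    rw [List.pairwise_cons] at h1
    refine ⟨h1.2, fun γ hγ => h2 γ (List.mem_cons_of_mem _ hγ), fun p hp => ?_,
      h4.step_last hk hi hj h5 he⟩
    rcases lt_trichotomy p j with hpj | rfl | hpj
    · have := ((h3 p hp).2 ⟨_, List.mem_cons_self, hpj.le⟩).step_last_lt hk hj hi hpj he
      exact ⟨this.mono (Nat.le_succ _), fun _ => this⟩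
    · have := ((h3 p hp).2 ⟨_, List.mem_cons_self, le_rfl⟩).step_last_eq hk hj hi he
      exact ⟨this, fun ⟨γ, hγ, hpγ⟩ => absurd (h1.1 γ hγ) hpγ.not_gt⟩
    · have := (h3 p hp).1.step_last_gt hk hj hi hpj hp he
      exact ⟨this, fun ⟨γ, hγ, hpγ⟩ =>
        absurd ((h1.1 γ hγ).trans hpj) hpγ.not_gt⟩
  · refine ⟨?_, ?_, fun p hp' => ⟨(hp p hp').mono (Nat.le_succ _), fun _ => hp p hp'⟩, hc, hv⟩
    · rw [List.pairwise_reverse, gammaRow, List.pairwise_map]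
      exact pairwise_filter_finRange n _
    · intro β hβ
      simp only [gammaRow, List.mem_reverse, List.mem_map, List.mem_filter,
        decide_eq_true_eq] at hβ
      obtain ⟨j, ⟨-, hj⟩, rfl⟩ := hβ
      exact ⟨hj, rfl⟩

theorem last_phase_not_quantum {β : Root n} (hβ : β ∈ gammaRow i) {x : W n} (he : Edge x β) :
    ¬ x.1 β.2 < x.1 β.1 := by
  simp only [gammaRow, List.mem_map, List.mem_filter, decide_eq_true_eq] at hβ
  obtain ⟨j, ⟨-, hj⟩, rfl⟩ := hβ
  have hj' : j.val < i.val := hj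
  refine (he.2 ?_ (ne_of_val_ne ?_)).1.not_gt
  · rw [bar_val]; omega
  · rw [bar_val, Fin.val_rev, pos_val]; omega

/-- Quantum steps occur only in the first two phases, where every root starts at i, so their number
is the wrap count of row i. Later rows are untouched, while earlier rows stay pending with the guard
index lowered to i. -/
theorem RPath.segment (hk : k ≤ n) (hi : i.val < k) {x : W n}
    (h : RPath (gammaKI k i).reverse x y q)
    (hp : ∀ p : Letter n, p.val < i.val + 1 → Pending k (i.val + 1) u x p) :
    (∀ p : Letter n, p.val < i.val → Pending k i.val u y p) ∧ Progress k u y (pos i) q.length ∧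
      (∀ l, pos i < l → l.val < k → val y l = val x l) ∧ ∀ β ∈ q, β.1 = pos i := by
  rw [gammaKI, List.reverse_append, List.reverse_append, List.reverse_append,
    ← List.map_reverse, List.reverse_reverse] at h
  obtain ⟨x₁, q₁, q', h₁, h', rfl⟩ := h.split
  rw [← List.append_assoc] at h'
  obtain ⟨x₂, q₂, q₃, h₂, h₃, rfl⟩ := h'.split
  have hq₃ : q₃ = [] := by
    rw [List.eq_nil_iff_forall_not_mem]
    intro β hβ
    obtain ⟨hm, z, hz, hz'⟩ := h₃.mem_quantum β hβ
    exact last_phase_not_quantum (List.mem_reverse.1 hm) hz hz'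
  subst hq₃
  obtain ⟨f, hc, hu⟩ := (hp (pos i) (Nat.lt_succ_self _)).exists_core hk
  obtain ⟨p₁, c₁, u₁⟩ := h₁.first_phase hk hi (fun p hpi => hp p (Nat.lt_succ_of_lt hpi)) hc hu
  obtain ⟨p₂, c₂, u₂⟩ := h₂.middle_phase hk hi p₁ c₁ u₁
  obtain ⟨p₃, c₃, -⟩ := h₃.last_phase hk hi p₂ c₂ u₂
  refine ⟨p₃, ?_, c₃.fixed, fun β hβ => ?_⟩
  · rw [List.append_nil, List.length_append]
    exact c₃.progress
  · rw [List.append_nil] at hβ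
    rcases List.mem_append.1 hβ with hβ | hβ
    · have := (h₁.mem_quantum β hβ).1
      rw [List.mem_map] at this
      obtain ⟨j, -, rfl⟩ := this
      rfl
    · have := (h₂.mem_quantum β hβ).1
      rw [List.mem_append, List.reverse_singleton, List.mem_singleton, List.mem_reverse,
        List.mem_map] at this
      rcases this with rfl | ⟨j, -, rfl⟩ <;> rfl

end Segment

/-! ### Blocks of the chain -/

theorem filter_finRange_between {n k t : ℕ} (ht : t < k) (htn : t < n) :
    (List.finRange n).filter (fun i => t ≤ i.val ∧ i.val < k) =
      ⟨t, htn⟩ :: (List.finRange n).filter (fun i => t + 1 ≤ i.val ∧ i.val < k) := by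
  refine List.Perm.eq_of_pairwise (le := (· < ·)) ?_ (pairwise_filter_finRange n _) ?_ ?_
  · intro a b _ _ h1 h2
    exact absurd (h1.trans h2) (lt_irrefl _)
  · rw [List.pairwise_cons]
    refine ⟨fun j hj => ?_, pairwise_filter_finRange n _⟩
    simp only [List.mem_filter, decide_eq_true_eq] at hj
    exact hj.2.1
  · rw [List.perm_ext_iff_of_nodup ((List.nodup_finRange n).filter _)]
    · intro j
      simp only [List.mem_filter, List.mem_cons, List.mem_finRange, true_and, decide_eq_true_eq,
        Fin.ext_iff]
      omega
    · rw [List.nodup_cons]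
      refine ⟨by simp, (List.nodup_finRange n).filter _⟩

/-- The rows are treated downwards from the last. A finished row does not move again, so its arc
condition and wrap count persist to the end of the block. -/
theorem RPath.segments {n k : ℕ} (hk : k ≤ n) {u : W n} {t : ℕ} (ht : t ≤ k) {y : W n}
    {q : List (Root n)}
    (h : RPath (((List.finRange n).filter fun i => t ≤ i.val ∧ i.val < k).flatMap
      (gammaKI k)).reverse u y q) :
    (∀ p : Letter n, p.val < t → Pending k t u y p) ∧
    (∀ p l : Letter n, t ≤ p.val → p < l → l.val < k →
      ¬ InArc (val u p) (val y p) (val y l)) ∧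
    ∀ g : Letter n → ℕ, (q.map fun β => g β.1).sum =
      ∑ p : Fin n, if (t ≤ p.val ∧ p.val < k) ∧ val y (pos p) < val u (pos p)
        then g (pos p) else 0 := by
  induction ht using Nat.decreasingInduction generalizing y q with
  | self =>
    rw [List.filter_eq_nil_iff.2 (by intro a _; simp)] at h
    cases h
    refine ⟨fun p _ => Or.inl rfl, fun p l h1 h2 h3 => ?_, fun g => ?_⟩
    · rw [Fin.lt_def] at h2
      omega
    · simp
  | of_succ t ht ih =>
    have htn : t < n := by omega
    rw [filter_finRange_between ht htn, List.flatMap_cons, List.reverse_append] at h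
    obtain ⟨x, q₁, q₂, h₁, h₂, rfl⟩ := h.split
    obtain ⟨i1, i2, i3⟩ := ih h₁
    obtain ⟨s1, s2, s3, s4⟩ := h₂.segment (i := ⟨t, htn⟩) hk ht i1
    refine ⟨s1, fun p l hp hpl hl => ?_, fun g => ?_⟩
    · rcases eq_or_lt_of_le hp with hp | hp
      · have : p = pos ⟨t, htn⟩ := Fin.ext hp.symm
        subst this
        exact s2.1 l hpl hl
      · rw [s3 p hp (lt_trans hpl hl), s3 l (lt_trans hp hpl) hl]
        exact i2 p l hp hpl hl
    · rw [List.map_append, List.sum_append, i3]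
      have h4 : (q₂.map fun β => g β.1).sum =
          if val y (pos ⟨t, htn⟩) < val u (pos ⟨t, htn⟩) then g (pos ⟨t, htn⟩) else 0 := by
        rw [List.map_congr_left (g := fun _ => g (pos ⟨t, htn⟩)) fun β hβ => by rw [s4 β hβ],
          List.map_const', List.sum_replicate, s2.2]
        split_ifs <;> simp
      rw [h4, ← Finset.add_sum_erase _ _ (Finset.mem_univ (⟨t, htn⟩ : Fin n)),
        ← Finset.add_sum_erase Finset.univ (fun p : Fin n =>
          if (t ≤ p.val ∧ p.val < k) ∧ val y (pos p) < val u (pos p) then g (pos p) else 0)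
          (Finset.mem_univ (⟨t, htn⟩ : Fin n))]
      rw [if_neg (by simp), zero_add, add_comm]
      congr 1
      · exact if_congr (by simp [ht]) rfl rfl
      · refine Finset.sum_congr rfl fun p hp => ?_
        have hpt : p.val ≠ t := fun h => (Finset.mem_erase.1 hp).1 (Fin.ext h)
        by_cases h5 : t + 1 ≤ p.val ∧ p.val < k
        · rw [s3 (pos p) h5.1 h5.2]
          refine if_congr (and_congr_left fun _ => ?_) rfl rfl
          omega
        · rw [if_neg (fun h => h5 h.1), if_neg]
          omega

theorem RPath.gammaL {n k : ℕ} (hk : k ≤ n) {u y : W n} {q : List (Root n)}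
    (h : RPath (gammaL n k).reverse u y q) :
    (∀ p l : Letter n, p < l → l.val < k → ¬ InArc (val u p) (val y p) (val y l)) ∧
    ∀ g : Letter n → ℕ, (q.map fun β => g β.1).sum =
      ∑ p : Fin n, if p.val < k ∧ val y (pos p) < val u (pos p) then g (pos p) else 0 := by
  have h0 : TypeC.gammaL n k = ((List.finRange n).filter fun i => 0 ≤ i.val ∧ i.val < k).flatMap
      (gammaKI k) := by
    simp [TypeC.gammaL]
  rw [h0] at h
  obtain ⟨-, h1, h2⟩ := h.segments hk (Nat.zero_le k)
  refine ⟨fun p l => h1 p l (Nat.zero_le _), fun g => ?_⟩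
  rw [h2]
  simp

/-- Each Γ_i is the initial part of Γ_{ki}, so a path for Γ_r(k) is also one for Γ_l(k), and the arc
condition needs no second proof. -/
theorem gammaR_sublist_gammaL (n k : ℕ) : (gammaR n k).Sublist (gammaL n k) := by
  unfold gammaR gammaL
  generalize (List.finRange n).filter (fun i => decide (i.val < k)) = L
  induction L with
  | nil => simp
  | cons i L ih =>
    rw [List.flatMap_cons, List.flatMap_cons]
    refine List.Sublist.append ?_ ih
    simp only [gammaKI, List.append_assoc]
    exact List.sublist_append_left _ _

/-- All roots have the form ε_j + ε_i with j < i, so there are no quantum steps. By the count for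
Γ_l, no row wraps around. -/
theorem RPath.gammaR {n k : ℕ} (hk : k ≤ n) {u y : W n} {q : List (Root n)}
    (h : RPath (gammaR n k).reverse u y q) :
    (∀ p l : Letter n, p < l → l.val < k → ¬ InArc (val u p) (val y p) (val y l)) ∧ q = [] ∧
    ∀ p : Fin n, p.val < k → val u (pos p) ≤ val y (pos p) := by
  have hq : q = [] := by
    rw [List.eq_nil_iff_forall_not_mem]
    intro β hβ
    obtain ⟨hm, z, hz, hz'⟩ := h.mem_quantum β hβ
    rw [TypeC.gammaR, List.mem_reverse, List.mem_flatMap] at hm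
    obtain ⟨i, -, hi⟩ := hm
    exact last_phase_not_quantum hi hz hz'
  obtain ⟨h1, h2⟩ := (h.mono (gammaR_sublist_gammaL n k).reverse).gammaL hk
  refine ⟨h1, hq, fun p hp => ?_⟩
  have h3 := h2 fun _ => 1
  rw [hq, List.map_nil, List.sum_nil] at h3
  have h4 := (Finset.sum_eq_zero_iff.1 h3.symm) p (Finset.mem_univ p)
  by_contra h5
  rw [if_pos ⟨hp, not_le.1 h5⟩] at h4
  exact one_ne_zero h4

/-! ### The charge algorithm -/

theorem find?_reverse_finRange {m : ℕ} {p : Fin m → Bool} {q : Fin m} (hq : p q = true)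
    (h : ∀ q', p q' = true → q' ≤ q) : (List.finRange m).reverse.find? p = some q := by
  cases hf : (List.finRange m).reverse.find? p with
  | none =>
    rw [List.find?_eq_none] at hf
    exact absurd hq (hf q (by simp))
  | some a =>
    obtain ⟨ha, as, bs, hL, has⟩ := List.find?_eq_some_iff_append.1 hf
    have hmem : q ∈ (List.finRange m).reverse := by simp
    have hpw : ((List.finRange m).reverse).Pairwise (fun x y => y < x) := by
      rw [List.pairwise_reverse]
      exact List.pairwise_lt_finRange m
    rw [hL] at hmem hpw
    rcases List.mem_append.1 hmem with h1 | h1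
    · have := has q h1
      simp [hq] at this
    rcases List.mem_cons.1 h1 with h1 | h1
    · rw [h1]
    · have h2 := (List.pairwise_cons.1 (List.pairwise_append.1 hpw).2.1).1 q h1
      exact absurd (h a ha) h2.not_ge

theorem scan_eq_some {u : List ℕ} {A : Finset (Fin u.length)} {x : ℕ} {P : Fin u.length → Bool}
    {q : Fin u.length} (hA : q ∈ A) (hx : u.get q = x) (hP : P q = true)
    (h : ∀ q' ∈ A, u.get q' = x → P q' = true → q' ≤ q) : scan u A x P = some q := by
  refine find?_reverse_finRange ?_ fun q' hq' => ?_
  · rw [decide_eq_true_eq]; exact ⟨hA, hx, hP⟩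
  · rw [decide_eq_true_eq] at hq'
    exact h q' hq'.1 hq'.2.1 hq'.2.2

theorem scan_eq_none {u : List ℕ} {A : Finset (Fin u.length)} {x : ℕ} {P : Fin u.length → Bool}
    (h : ∀ q ∈ A, u.get q = x → ¬ P q = true) : scan u A x P = none := by
  rw [scan, List.find?_eq_none]
  intro q _ hq
  rw [decide_eq_true_eq] at hq
  exact h q hq.1 hq.2.1 hq.2.2

/-- The strict order of the biletters in the charge word. -/
def Before {n : ℕ} (x y : Letter n × ℕ) : Prop := y.1 < x.1 ∨ (y.1 = x.1 ∧ y.2 < x.2)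

theorem Before.asymm {n : ℕ} {x y : Letter n × ℕ} (h : Before x y) : ¬ Before y x := by
  simp only [Before, Fin.lt_def, Fin.ext_iff] at h ⊢
  omega

/-- The biletter in a position of the word of lower letters. -/
def biletterAt {n : ℕ} (S : List (Letter n × ℕ)) (q : Fin (S.map Prod.snd).length) :
    Letter n × ℕ :=
  S[q.val]'(by simpa using q.isLt)

/-- `S` is the charge word of a filling with rows of lengths `2 μ_i` and entries `X c i`, such that
every entry is the first one, in the circular order, from the entry in the previous column, among
the entries of its column which are not above it. -/
structure IsChargeWord {n : ℕ} (S : List (Letter n × ℕ)) (μ : Fin n → ℕ)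
    (X : ℕ → Fin n → Letter n) : Prop where
  anti : Antitone μ
  sorted : S.Pairwise Before
  mem_iff : ∀ k c, (k, c) ∈ S ↔ ∃ i, c < 2 * μ i ∧ X c i = k
  inj : ∀ c, Function.Injective (X c)
  first : ∀ i l, i < l → 0 < μ l → X 0 i < X 0 l
  arc : ∀ c i l, i < l → c + 1 < 2 * μ l → ¬ InArc (X c i).val (X (c + 1) i).val (X (c + 1) l).val
  up : ∀ j i, j < μ i → X (2 * j) i ≤ X (2 * j + 1) i

/-! ### Iterations of the charge algorithm recover the rows -/

namespace IsChargeWord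

variable {n : ℕ} {S : List (Letter n × ℕ)} {μ : Fin n → ℕ} {X : ℕ → Fin n → Letter n}

theorem get_eq (q : Fin (S.map Prod.snd).length) :
    (S.map Prod.snd).get q = (biletterAt S q).2 := by
  simp [biletterAt]

theorem lt_iff (h : IsChargeWord S μ X) {q q' : Fin (S.map Prod.snd).length} :
    q < q' ↔ Before (biletterAt S q) (biletterAt S q') := by
  have key : ∀ q q' : Fin (S.map Prod.snd).length, q < q' →
      Before (biletterAt S q) (biletterAt S q') := fun q q' hq =>
    List.pairwise_iff_getElem.1 h.sorted _ _ _ _ hq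
  refine ⟨key q q', fun hb => ?_⟩
  rcases lt_trichotomy q q' with h1 | rfl | h1
  · exact h1
  · exact absurd hb hb.asymm
  · exact absurd hb (key _ _ h1).asymm

theorem le_of_not_before (h : IsChargeWord S μ X) {q q' : Fin (S.map Prod.snd).length}
    (hb : ¬ Before (biletterAt S q') (biletterAt S q)) : q ≤ q' := by
  rw [← h.lt_iff] at hb
  exact not_lt.1 hb

theorem biletterAt_injective (h : IsChargeWord S μ X) : Function.Injective (biletterAt S) := by
  intro q q' hq
  have h1 : ¬ Before (biletterAt S q) (biletterAt S q') := by
    rw [hq]; exact fun hb => hb.asymm hb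
  have h2 : ¬ Before (biletterAt S q') (biletterAt S q) := by
    rw [hq]; exact fun hb => hb.asymm hb
  exact le_antisymm (h.le_of_not_before h2) (h.le_of_not_before h1)

theorem exists_position (h : IsChargeWord S μ X) {c : ℕ} {i : Fin n} (hc : c < 2 * μ i) :
    ∃ q, biletterAt S q = (X c i, c) := by
  obtain ⟨t, ht, hS⟩ := List.mem_iff_getElem.1 ((h.mem_iff _ _).2 ⟨i, hc, rfl⟩)
  exact ⟨⟨t, by simpa using ht⟩, hS⟩

theorem exists_row (h : IsChargeWord S μ X) (q : Fin (S.map Prod.snd).length) :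
    ∃ i, (biletterAt S q).2 < 2 * μ i ∧ X (biletterAt S q).2 i = (biletterAt S q).1 :=
  (h.mem_iff _ _).1 (List.getElem_mem _)

/-- The positions of the entries in the rows from `r` on. -/
def rowsFrom (S : List (Letter n × ℕ)) (μ : Fin n → ℕ) (X : ℕ → Fin n → Letter n) (r : ℕ) :
    Finset (Fin (S.map Prod.snd).length) :=
  open Classical in Finset.univ.filter fun q => ∃ i : Fin n, r ≤ i.val ∧
    (biletterAt S q).2 < 2 * μ i ∧ X (biletterAt S q).2 i = (biletterAt S q).1

theorem mem_rowsFrom {r : ℕ} {q : Fin (S.map Prod.snd).length} :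
    q ∈ rowsFrom S μ X r ↔ ∃ i : Fin n, r ≤ i.val ∧
      (biletterAt S q).2 < 2 * μ i ∧ X (biletterAt S q).2 i = (biletterAt S q).1 := by
  simp [rowsFrom]

/-- Scanning left from the last selected entry, and then from the right end, finds the circularly
first available entry of the next column. With rows before i removed, the arc condition says that
this is the entry of row i; for the first letter, the column is increasing. -/
theorem select_step (h : IsChargeWord S μ X) {i : Fin n} {t : ℕ} (ht : t < 2 * μ i)
    {prev : Option (Fin (S.map Prod.snd).length)}
    (hprev : (t = 0 ∧ prev = none) ∨
      ∃ q c, prev = some q ∧ t = c + 1 ∧ biletterAt S q = (X c i, c))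
    {q : Fin (S.map Prod.snd).length} (hq : biletterAt S q = (X t i, t)) :
    (scan (S.map Prod.snd) (rowsFrom S μ X i.val) t fun q' => ∀ p ∈ prev, q' < p).or
      (scan (S.map Prod.snd) (rowsFrom S μ X i.val) t fun _ => true) = some q := by
  have hqA : q ∈ rowsFrom S μ X i.val := mem_rowsFrom.2 ⟨i, le_rfl, by rw [hq]; exact ⟨ht, rfl⟩⟩
  have hqt : (S.map Prod.snd).get q = t := by rw [get_eq, hq]
  have hcand : ∀ q' ∈ rowsFrom S μ X i.val, (S.map Prod.snd).get q' = t →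
      ∃ l, i ≤ l ∧ t < 2 * μ l ∧ biletterAt S q' = (X t l, t) := by
    intro q' hA hx
    obtain ⟨l, h1, h2, h3⟩ := mem_rowsFrom.1 hA
    rw [get_eq] at hx
    rw [hx] at h2 h3
    exact ⟨l, h1, h2, Prod.ext h3.symm hx⟩
  have hle : ∀ q' l, biletterAt S q' = (X t l, t) → X t i ≤ X t l → q' ≤ q := by
    intro q' l h1 h2
    apply h.le_of_not_before
    rw [hq, h1]
    simp only [Before, Fin.lt_def, Fin.le_def] at h2 ⊢
    omega
  rcases hprev with ⟨rfl, rfl⟩ | ⟨p, c, rfl, rfl, hp⟩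
  · rw [scan_eq_some hqA hqt (by simp), Option.some_or]
    intro q' hA hx _
    obtain ⟨l, h1, h2, h3⟩ := hcand q' hA hx
    refine hle q' l h3 ?_
    rcases h1.eq_or_lt with rfl | h1
    · exact le_rfl
    · exact (h.first i l h1 (by omega)).le
  · have harc : ∀ l, i ≤ l → c + 1 < 2 * μ l →
        ¬ InArc (X c i).val (X (c + 1) i).val (X (c + 1) l).val ∨ l = i := by
      intro l h1 h2
      rcases h1.eq_or_lt with rfl | h1
      · exact Or.inr rfl
      · exact Or.inl (h.arc c i l h1 h2)
    -- Equality counts as lying to the left: among equal entries the word lists the larger column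
    -- label first. This matches the closed lower end of the arc.
    have hlt : ∀ q' l, biletterAt S q' = (X (c + 1) l, c + 1) →
        (q' < p ↔ (X c i).val ≤ (X (c + 1) l).val) := by
      intro q' l h1
      rw [h.lt_iff, hp, h1]
      simp only [Before, Fin.lt_def, Fin.ext_iff]
      omega
    by_cases hab : (X c i).val ≤ (X (c + 1) i).val
    · rw [scan_eq_some hqA hqt, Option.some_or]
      · rw [decide_eq_true_eq]
        rintro _ ⟨⟩
        exact (hlt q i hq).2 hab
      · intro q' hA hx hP
        obtain ⟨l, h1, h2, h3⟩ := hcand q' hA hx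
        rw [decide_eq_true_eq] at hP
        have h4 := (hlt q' l h3).1 (hP p rfl)
        refine hle q' l h3 ?_
        rcases harc l h1 h2 with h5 | rfl
        · rw [InArc, if_pos hab] at h5
          rw [Fin.le_def]
          omega
        · exact le_rfl
    · have hcases : ∀ q' ∈ rowsFrom S μ X i.val, (S.map Prod.snd).get q' = c + 1 →
          ∃ l, biletterAt S q' = (X (c + 1) l, c + 1) ∧
            (X (c + 1) l).val < (X c i).val ∧ X (c + 1) i ≤ X (c + 1) l := by
        intro q' hA hx
        obtain ⟨l, h1, h2, h3⟩ := hcand q' hA hx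
        refine ⟨l, h3, ?_⟩
        rcases harc l h1 h2 with h5 | rfl
        · rw [InArc, if_neg hab] at h5
          rw [Fin.le_def]
          omega
        · exact ⟨by omega, le_rfl⟩
      rw [scan_eq_none, Option.none_or, scan_eq_some hqA hqt rfl]
      · intro q' hA hx _
        obtain ⟨l, h3, h4, h5⟩ := hcases q' hA hx
        exact hle q' l h3 h5
      · intro q' hA hx hP
        obtain ⟨l, h3, h4, h5⟩ := hcases q' hA hx
        rw [decide_eq_true_eq] at hP
        have := (hlt q' l h3).1 (hP p rfl)
        omega

/-- The rows from i on are no longer than row i, so the iteration stops exactly where row i ends. -/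
theorem scan_eq_none_of_le (h : IsChargeWord S μ X) {i : Fin n} {t : ℕ} (ht : 2 * μ i ≤ t)
    {P : Fin (S.map Prod.snd).length → Bool} :
    scan (S.map Prod.snd) (rowsFrom S μ X i.val) t P = none := by
  refine scan_eq_none fun q hq hx _ => ?_
  obtain ⟨l, h1, h2, -⟩ := mem_rowsFrom.1 hq
  rw [get_eq] at hx
  have := h.anti (show i ≤ l from h1)
  omega

theorem selectFrom_spec (h : IsChargeWord S μ X) {i : Fin n} (m t : ℕ) (ht : t ≤ 2 * μ i)
    (hm : 2 * μ i ≤ m + t) {prev : Option (Fin (S.map Prod.snd).length)}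
    (hprev : (t = 0 ∧ prev = none) ∨
      ∃ q c, prev = some q ∧ t = c + 1 ∧ biletterAt S q = (X c i, c)) :
    (selectFrom (S.map Prod.snd) (rowsFrom S μ X i.val) m prev t).map (biletterAt S) =
      (List.range (2 * μ i - t)).map fun j => (X (t + j) i, t + j) := by
  induction m generalizing t prev with
  | zero =>
    rw [show 2 * μ i - t = 0 by omega]
    rfl
  | succ m ih =>
    rw [selectFrom]
    rcases ht.eq_or_lt with ht' | ht'
    · rw [h.scan_eq_none_of_le ht'.ge, h.scan_eq_none_of_le ht'.ge, ht', Nat.sub_self]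
      rfl
    · obtain ⟨q, hq⟩ := h.exists_position ht'
      rw [h.select_step ht' hprev hq]
      simp only [List.map_cons, hq]
      rw [ih (t + 1) ht' (by omega) (Or.inr ⟨q, t, rfl, rfl, hq⟩),
        show 2 * μ i - t = (2 * μ i - (t + 1)) + 1 by omega, List.range_succ_eq_map]
      simp only [List.map_cons, List.map_map, add_zero]
      congr 1
      refine List.map_congr_left fun j _ => ?_
      simp only [Function.comp_apply]
      rw [show t + 1 + j = t + j.succ by omega]

theorem two_mul_le_length (h : IsChargeWord S μ X) (i : Fin n) : 2 * μ i ≤ S.length := by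
  have : ((List.range (2 * μ i)).map fun c => (X c i, c)).length ≤ S.length := by
    refine (List.Nodup.subperm ?_ ?_).length_le
    · exact List.nodup_range.map fun a b hab => (Prod.ext_iff.1 hab).2
    · intro x hx
      obtain ⟨c, hc, rfl⟩ := List.mem_map.1 hx
      exact (h.mem_iff _ _).2 ⟨i, List.mem_range.1 hc, rfl⟩
  simpa using this

theorem selection_spec (h : IsChargeWord S μ X) (i : Fin n) :
    (selection (S.map Prod.snd) (rowsFrom S μ X i.val)).map (biletterAt S) =
      (List.range (2 * μ i)).map fun c => (X c i, c) := by
  have h1 := h.selectFrom_spec (i := i) (S.map Prod.snd).length 0 (Nat.zero_le _)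
    (by simpa using h.two_mul_le_length i) (Or.inl ⟨rfl, rfl⟩)
  rw [selection, h1]
  simp

theorem rowsFrom_sdiff (h : IsChargeWord S μ X) (i : Fin n) :
    rowsFrom S μ X i.val \ (selection (S.map Prod.snd) (rowsFrom S μ X i.val)).toFinset =
      rowsFrom S μ X (i.val + 1) := by
  have hsel : ∀ q, q ∈ selection (S.map Prod.snd) (rowsFrom S μ X i.val) ↔
      (biletterAt S q).2 < 2 * μ i ∧ X (biletterAt S q).2 i = (biletterAt S q).1 := by
    intro q
    rw [← List.mem_map_of_injective h.biletterAt_injective, h.selection_spec, List.mem_map]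
    constructor
    · rintro ⟨c, hc, hq⟩
      rw [← hq]
      exact ⟨List.mem_range.1 hc, rfl⟩
    · rintro ⟨h1, h2⟩
      exact ⟨_, List.mem_range.2 h1, Prod.ext h2 rfl⟩
  ext q
  rw [Finset.mem_sdiff, List.mem_toFinset, hsel, mem_rowsFrom, mem_rowsFrom]
  constructor
  · rintro ⟨⟨l, h1, h2⟩, h3⟩
    rcases h1.eq_or_lt with h1 | h1
    · rw [← Fin.ext h1] at h2
      exact absurd h2 h3
    · exact ⟨l, h1, h2⟩
  · rintro ⟨l, h1, h2, h3⟩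
    refine ⟨⟨l, by omega, h2, h3⟩, fun h4 => ?_⟩
    have := h.inj _ (h3.trans h4.2.symm)
    rw [this] at h1
    omega

/-- Each iteration removes exactly one row. Empty rows come last and produce no iteration, so it is
enough that the bound m covers the nonempty rows. -/
theorem iterationsFrom_spec (h : IsChargeWord S μ X) (m r : ℕ)
    (hm : ((List.finRange n).filter fun i => r ≤ i.val ∧ 0 < μ i).length ≤ m) :
    (iterationsFrom (S.map Prod.snd) m (rowsFrom S μ X r)).map (List.map (biletterAt S)) =
      ((List.finRange n).filter fun i => r ≤ i.val ∧ 0 < μ i).map fun i =>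
        (List.range (2 * μ i)).map fun c => (X c i, c) := by
  induction m generalizing r with
  | zero =>
    rw [List.length_eq_zero_iff.1 (Nat.le_zero.1 hm)]
    rfl
  | succ m ih =>
    rw [iterationsFrom]
    by_cases hr : ∃ hrn : r < n, 0 < μ ⟨r, hrn⟩
    · obtain ⟨hrn, hr⟩ := hr
      have hfil : ((List.finRange n).filter fun i => r ≤ i.val ∧ 0 < μ i) =
          ⟨r, hrn⟩ :: (List.finRange n).filter fun i => r + 1 ≤ i.val ∧ 0 < μ i := by
        have h1 := congrArg (List.filter fun i => decide (0 < μ i))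
          (filter_finRange_between (k := n) hrn hrn)
        rw [List.filter_cons_of_pos (by simpa using hr), List.filter_filter,
          List.filter_filter] at h1
        convert h1 using 3
        · simp [and_comm, Bool.and_comm]
        · funext i
          simp [Bool.and_comm]
      rw [hfil] at hm ⊢
      have hne : rowsFrom S μ X r ≠ ∅ := by
        obtain ⟨q, hq⟩ := h.exists_position (c := 0) (i := ⟨r, hrn⟩) (by omega)
        refine Finset.ne_empty_of_mem (a := q) (mem_rowsFrom.2 ⟨⟨r, hrn⟩, le_rfl, ?_⟩)
        rw [hq]
        exact ⟨by omega, rfl⟩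
      rw [if_neg hne, List.map_cons, List.map_cons, h.selection_spec ⟨r, hrn⟩,
        h.rowsFrom_sdiff ⟨r, hrn⟩, ih (r + 1) (by simpa using hm)]
    · have hnot : ∀ i : Fin n, r ≤ i.val → μ i = 0 := by
        intro i hi
        by_contra h0
        have hrn : r < n := lt_of_le_of_lt hi i.isLt
        exact hr ⟨hrn, lt_of_lt_of_le (Nat.pos_of_ne_zero h0)
          (h.anti (show (⟨r, hrn⟩ : Fin n) ≤ i from hi))⟩
      rw [if_pos, List.filter_eq_nil_iff.2]
      · rfl
      · intro i _
        simp only [decide_eq_true_eq, not_and]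
        intro hi
        rw [hnot i hi]
        exact lt_irrefl 0
      · rw [Finset.eq_empty_iff_forall_notMem]
        intro q hq
        obtain ⟨i, h1, h2, -⟩ := mem_rowsFrom.1 hq
        rw [hnot i h1] at h2
        omega

theorem iterations_spec (h : IsChargeWord S μ X) :
    (iterations (S.map Prod.snd)).map (List.map (biletterAt S)) =
      ((List.finRange n).filter fun i => 0 < μ i).map fun i =>
        (List.range (2 * μ i)).map fun c => (X c i, c) := by
  have h0 : rowsFrom S μ X 0 = Finset.univ := by
    rw [Finset.eq_univ_iff_forall]
    intro q
    obtain ⟨i, hi⟩ := h.exists_row q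
    exact mem_rowsFrom.2 ⟨i, Nat.zero_le _, hi⟩
  have h1 := h.iterationsFrom_spec (S.map Prod.snd).length 0 ?_
  · rw [h0] at h1
    rw [iterations, h1]
    simp
  · have : (((List.finRange n).filter fun i => 0 ≤ i.val ∧ 0 < μ i).map fun i =>
        (X 0 i, 0)).length ≤ S.length := by
      refine (List.Nodup.subperm ?_ ?_).length_le
      · exact ((List.nodup_finRange n).filter _).map fun a b hab =>
          h.inj 0 (Prod.ext_iff.1 hab).1
      · intro x hx
        obtain ⟨i, hi, rfl⟩ := List.mem_map.1 hx
        rw [List.mem_filter, decide_eq_true_eq] at hi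
        exact (h.mem_iff _ _).2 ⟨i, by omega, rfl⟩
    simpa using this

theorem length_of_map_eq {s : List (Fin (S.map Prod.snd).length)} {i : Fin n}
    (hs : s.map (biletterAt S) = (List.range (2 * μ i)).map fun c => (X c i, c)) :
    s.length = 2 * μ i := by
  simpa using congrArg List.length hs

theorem biletterAt_getElem {s : List (Fin (S.map Prod.snd).length)} {i : Fin n}
    (hs : s.map (biletterAt S) = (List.range (2 * μ i)).map fun c => (X c i, c))
    {t : ℕ} (ht : t < s.length) : biletterAt S s[t] = (X t i, t) := by
  have h1 : (s.map (biletterAt S))[t]? = some (biletterAt S s[t]) := by simp [ht]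
  rw [hs] at h1
  rw [length_of_map_eq hs] at ht
  simpa [ht] using h1.symm

theorem count_eq (h : IsChargeWord S μ X) (c : ℕ) :
    (S.map Prod.snd).count c = ((List.finRange n).filter fun i => c < 2 * μ i).length := by
  have h1 : (S.filter fun x => x.2 = c).Perm
      (((List.finRange n).filter fun i => c < 2 * μ i).map fun i => (X c i, c)) := by
    rw [List.perm_ext_iff_of_nodup]
    · rintro ⟨k, d⟩
      simp only [List.mem_filter, decide_eq_true_eq, List.mem_map, h.mem_iff, List.mem_finRange,
        true_and, Prod.mk.injEq]
      constructor
      · rintro ⟨⟨i, h1, h2⟩, rfl⟩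
        exact ⟨i, h1, h2, rfl⟩
      · rintro ⟨i, h1, h2, rfl⟩
        exact ⟨⟨i, h1, h2⟩, rfl⟩
    · refine List.Nodup.filter _ (h.sorted.imp fun {a b} hab => ?_)
      rintro rfl
      exact hab.asymm hab
    · exact ((List.nodup_finRange n).filter _).map fun a b hab =>
        h.inj c (Prod.ext_iff.1 hab).1
  have h2 := h1.length_eq
  rw [List.length_map] at h2
  rw [← h2, List.count, List.countP_map, List.countP_eq_length_filter]
  congr 1

/-- The counts depend only on the shape. The condition that j' is to the left of j is the inequality
between C_l^j and C_r^j in each row, equality included. -/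
theorem hasCharge (h : IsChargeWord S μ X) : HasCharge (S.map Prod.snd) := by
  refine ⟨fun j => ?_, fun j => ?_, fun s hs j hj => ?_⟩
  · rw [h.count_eq, h.count_eq]
    congr 2
    ext i
    simp only [decide_eq_decide]
    omega
  · rw [h.count_eq, h.count_eq]
    refine (List.monotone_filter_right _ fun i hi => ?_).length_le
    rw [decide_eq_true_eq] at hi ⊢
    omega
  · have h1 := List.mem_map_of_mem (f := List.map (biletterAt S)) hs
    rw [h.iterations_spec, List.mem_map] at h1
    obtain ⟨i, -, hi⟩ := h1
    have hlen := length_of_map_eq hi.symm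
    rw [h.lt_iff, biletterAt_getElem hi.symm, biletterAt_getElem hi.symm]
    have := h.up j i (by omega)
    simp only [Before, Fin.lt_def, Fin.le_def, Fin.ext_iff] at this ⊢
    omega

/-- To the right means a smaller entry here: with equal entries, the later label would stand to the
left. -/
theorem contribution_eq (h : IsChargeWord S μ X) {s : List (Fin (S.map Prod.snd).length)}
    {i : Fin n} (hs : s.map (biletterAt S) = (List.range (2 * μ i)).map fun c => (X c i, c)) :
    contribution s = ∑ j ∈ Finset.range (μ i),
      if j + 1 < μ i ∧ X (2 * j + 2) i < X (2 * j + 1) i then μ i - (j + 1) else 0 := by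
  have hlen := length_of_map_eq hs
  have hhalf : s.length / 2 = μ i := by omega
  rw [contribution, hhalf]
  refine Finset.sum_congr rfl fun j _ => if_congr ?_ rfl rfl
  have hb : ∀ hj : 2 * j + 2 < s.length,
      (s[2 * j + 1] < s[2 * j + 2] ↔ X (2 * j + 2) i < X (2 * j + 1) i) := by
    intro hj
    rw [h.lt_iff, biletterAt_getElem hs, biletterAt_getElem hs]
    simp only [Before, Fin.lt_def, Fin.ext_iff]
    omega
  constructor
  · rintro ⟨h1, h2⟩
    exact ⟨by omega, (hb h1).1 h2⟩
  · rintro ⟨h1, h2⟩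
    exact ⟨by omega, (hb (by omega)).2 h2⟩

theorem charge_eq (h : IsChargeWord S μ X) : charge (S.map Prod.snd) =
    ∑ i, ∑ j ∈ Finset.range (μ i),
      if j + 1 < μ i ∧ X (2 * j + 2) i < X (2 * j + 1) i then μ i - (j + 1) else 0 := by
  set T : Fin n → ℕ := fun i => ∑ j ∈ Finset.range (μ i),
    if j + 1 < μ i ∧ X (2 * j + 2) i < X (2 * j + 1) i then μ i - (j + 1) else 0 with hT
  have key : ∀ (its : List (List (Fin (S.map Prod.snd).length))) (L : List (Fin n)),
      its.map (List.map (biletterAt S)) =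
        L.map (fun i => (List.range (2 * μ i)).map fun c => (X c i, c)) →
      its.map contribution = L.map T := by
    intro its
    induction its with
    | nil =>
      intro L hL
      rw [List.map_nil, eq_comm, List.map_eq_nil_iff] at hL
      rw [hL]
      rfl
    | cons s its ih =>
      intro L hL
      cases L with
      | nil => simp at hL
      | cons i L =>
        rw [List.map_cons, List.map_cons, List.cons.injEq] at hL
        rw [List.map_cons, List.map_cons, ih L hL.2, h.contribution_eq hL.1]
  rw [charge, key _ _ h.iterations_spec]
  rw [← List.sum_toFinset _ ((List.nodup_finRange n).filter _), List.toFinset_filter,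
    List.toFinset_finRange, Finset.sum_filter]
  refine Finset.sum_congr rfl fun i _ => ?_
  split_ifs with h0
  · rfl
  · rw [decide_eq_true_eq, Nat.pos_iff_ne_zero, not_not] at h0
    simp [hT, h0]

end IsChargeWord

/-! ### The structure of the chain of a partition -/

section Chain

variable {n : ℕ}

theorem lt_colHeight_iff {μ : Fin n → ℕ} (hμ : Antitone μ) (i : Fin n) (j : ℕ) :
    i.val < colHeight μ j ↔ j < μ i := by
  constructor
  · intro h
    by_contra hj
    have : colHeight μ j ≤ (Finset.Iio i).card := by
      refine Finset.card_le_card fun l hl => ?_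
      simp only [Finset.mem_filter, Finset.mem_univ, true_and] at hl
      rw [Finset.mem_Iio]
      by_contra hil
      exact hj (lt_of_lt_of_le hl (hμ (not_lt.1 hil)))
    rw [Fin.card_Iio] at this
    omega
  · intro h
    have : (Finset.Iic i).card ≤ colHeight μ j := by
      refine Finset.card_le_card fun l hl => ?_
      rw [Finset.mem_Iic] at hl
      simp only [Finset.mem_filter, Finset.mem_univ, true_and]
      exact lt_of_lt_of_le h (hμ hl)
    rw [Fin.card_Iic] at this
    omega

theorem colHeight_le (μ : Fin n → ℕ) (j : ℕ) : colHeight μ j ≤ n := by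
  exact (Finset.card_filter_le _ _).trans_eq (Finset.card_fin n)

theorem colHeight_anti (μ : Fin n → ℕ) {j j' : ℕ} (h : j ≤ j') :
    colHeight μ j' ≤ colHeight μ j := by
  refine Finset.card_le_card fun l hl => ?_
  simp only [Finset.mem_filter, Finset.mem_univ, true_and] at hl ⊢
  omega

theorem le_numCols (μ : Fin n → ℕ) (i : Fin n) : μ i ≤ numCols μ :=
  Finset.le_sup (f := μ) (Finset.mem_univ i)

/-- The initial part `Γ^{μ_1} ⋯ Γ^{t+1}` of the chain. -/
def chainFrom (μ : Fin n → ℕ) (t : ℕ) : List (Root n) :=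
  ((List.range (numCols μ)).reverse.filter fun m => t ≤ m).flatMap fun m => gamma n (colHeight μ m)

theorem chainFrom_zero (μ : Fin n → ℕ) : chainFrom μ 0 = muChain μ := by
  simp [chainFrom, muChain]

theorem chainFrom_of_le {μ : Fin n → ℕ} {t : ℕ} (h : numCols μ ≤ t) : chainFrom μ t = [] := by
  rw [chainFrom, List.filter_eq_nil_iff.2, List.flatMap_nil]
  intro m hm
  rw [List.mem_reverse, List.mem_range] at hm
  simp
  omega

theorem filter_reverse_range {N t : ℕ} (ht : t < N) :
    (List.range N).reverse.filter (fun m => t ≤ m) =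
      (List.range N).reverse.filter (fun m => t + 1 ≤ m) ++ [t] := by
  have hr : (List.range N).reverse.Pairwise (· > ·) := by
    rw [List.pairwise_reverse]
    exact List.pairwise_lt_range
  have hn : (List.range N).reverse.Nodup := List.nodup_reverse.2 List.nodup_range
  refine List.Perm.eq_of_pairwise (le := (· > ·)) ?_ (hr.filter _) ?_ ?_
  · intro a b _ _ h1 h2
    omega
  · rw [List.pairwise_append]
    refine ⟨hr.filter _, List.pairwise_singleton _ _, fun a ha b hb => ?_⟩
    rw [List.mem_singleton] at hb
    simp only [List.mem_filter, decide_eq_true_eq] at ha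
    omega
  · rw [List.perm_ext_iff_of_nodup (hn.filter _)]
    · intro m
      simp only [List.mem_filter, List.mem_append, List.mem_singleton, List.mem_reverse,
        List.mem_range, decide_eq_true_eq]
      omega
    · rw [List.nodup_append]
      refine ⟨hn.filter _, List.nodup_singleton _, fun a ha b hb => ?_⟩
      rw [List.mem_singleton] at hb
      simp only [List.mem_filter, decide_eq_true_eq] at ha
      omega

theorem chainFrom_eq_append {μ : Fin n → ℕ} {t : ℕ} (ht : t < numCols μ) :
    chainFrom μ t = chainFrom μ (t + 1) ++ gammaR n (colHeight μ t) ++ gammaL n (colHeight μ t) := by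
  rw [chainFrom, filter_reverse_range ht, List.flatMap_append, List.append_assoc]
  simp [chainFrom, gamma]

theorem exists_muChain_eq (μ : Fin n → ℕ) {t : ℕ} (ht : t ≤ numCols μ) :
    ∃ R, muChain μ = chainFrom μ t ++ R := by
  induction t with
  | zero => exact ⟨[], by rw [chainFrom_zero, List.append_nil]⟩
  | succ t ih =>
    obtain ⟨R, hR⟩ := ih (by omega)
    exact ⟨gammaR n (colHeight μ t) ++ (gammaL n (colHeight μ t) ++ R), by
      rw [hR, chainFrom_eq_append ht]; simp⟩

theorem isPosRoot_of_mem_gammaRow {i : Fin n} {β : Root n} (h : β ∈ gammaRow i) :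
    IsPosRoot β := by
  simp only [gammaRow, List.mem_map, List.mem_filter, decide_eq_true_eq] at h
  obtain ⟨j, ⟨-, hj⟩, rfl⟩ := h
  have hj' : j.val < i.val := hj
  simp only [IsPosRoot, Fin.lt_def, Fin.le_def, Fin.val_rev, bar_val, pos_val]
  omega

theorem isPosRoot_of_mem_gammaKI {k : ℕ} {i : Fin n} (hi : i.val < k) {β : Root n}
    (h : β ∈ gammaKI k i) : IsPosRoot β := by
  simp only [gammaKI, List.mem_append, List.mem_map, List.mem_filter, List.mem_reverse,
    List.mem_singleton, decide_eq_true_eq] at h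
  rcases h with ((h | ⟨j, ⟨-, hj⟩, rfl⟩) | rfl) | ⟨j, ⟨-, hj⟩, rfl⟩
  · exact isPosRoot_of_mem_gammaRow h
  all_goals
    simp only [IsPosRoot, Fin.lt_def, Fin.le_def, Fin.val_rev, bar_val, pos_val]
    omega

theorem isPosRoot_of_mem_muChain {μ : Fin n → ℕ} : ∀ β ∈ muChain μ, IsPosRoot β := by
  intro β hβ
  simp only [muChain, gamma, gammaR, gammaL, List.mem_flatMap, List.mem_append, List.mem_filter,
    decide_eq_true_eq] at hβ
  obtain ⟨j, -, ⟨i, ⟨-, hi⟩, h⟩ | ⟨i, ⟨-, hi⟩, h⟩⟩ := hβ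
  · exact isPosRoot_of_mem_gammaRow h
  · exact isPosRoot_of_mem_gammaKI hi h

/-! ### Affine levels -/

/-- The roots `(i, ī)` and `(i, l)` with `k ≤ l`, which label the quantum steps. -/
def IsQuantumRoot (k : ℕ) (i : Fin n) (β : Root n) : Prop :=
  β.1 = pos i ∧ (β.2 = bar i ∨ ∃ l : Fin n, k ≤ l.val ∧ β.2 = pos l)

theorem pos_ne_bar (i j : Fin n) : pos i ≠ bar j := by
  have := i.isLt
  have := j.isLt
  apply ne_of_val_ne
  rw [pos_val, bar_val]
  omega

theorem pos_injective : Function.Injective (pos : Fin n → Letter n) := fun _ _ h =>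
  Fin.ext (Fin.ext_iff.1 h :)

theorem bar_injective : Function.Injective (bar : Fin n → Letter n) := fun _ _ h =>
  pos_injective (Fin.rev_injective h)

theorem IsQuantumRoot.notMem_gammaRow {k : ℕ} {i : Fin n} {β : Root n} (h : IsQuantumRoot k i β)
    (i' : Fin n) : β ∉ gammaRow i' := by
  intro hm
  simp only [gammaRow, List.mem_map, List.mem_filter, decide_eq_true_eq] at hm
  obtain ⟨j, ⟨-, hj⟩, rfl⟩ := hm
  obtain ⟨h1, h2 | ⟨l, -, h2⟩⟩ := h
  · have e1 := pos_injective h1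
    have e2 := bar_injective h2
    rw [e1, e2] at hj
    exact lt_irrefl _ hj
  · exact pos_ne_bar _ _ h2.symm

/-- The inequality k' ≤ k is used for roots (i, l): as l ≥ k ≥ k', the root is still present in the
segment for the shorter column. -/
theorem IsQuantumRoot.count_gammaKI {k : ℕ} {i : Fin n} {β : Root n} (h : IsQuantumRoot k i β)
    {k' : ℕ} (hk : k' ≤ k) (hi : i.val < k') (i' : Fin n) :
    (gammaKI k' i').count β = if i' = i then 1 else 0 := by
  split_ifs with hii
  · subst hii
    have h0 := List.count_eq_zero_of_not_mem (h.notMem_gammaRow i')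
    have h1 : (((List.finRange n).filter fun j => k' ≤ j.val).map
        fun j => (pos i', bar j)).count β = 0 := by
      refine List.count_eq_zero_of_not_mem fun hm => ?_
      simp only [List.mem_map, List.mem_filter, decide_eq_true_eq] at hm
      obtain ⟨j, ⟨-, hj⟩, rfl⟩ := hm
      obtain ⟨-, h2 | ⟨l, -, h2⟩⟩ := h
      · rw [bar_injective h2] at hj
        omega
      · exact pos_ne_bar _ _ h2.symm
    obtain ⟨a, b⟩ := β
    obtain ⟨h2, h3⟩ := h
    simp only at h2 h3
    subst h2
    rw [gammaKI, List.count_append, List.count_append, List.count_append, h0, h1]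
    rcases h3 with rfl | ⟨l, hl, rfl⟩
    · rw [List.count_eq_zero_of_not_mem (l := List.map _ _)]
      · simp
      · simp only [List.mem_map, not_exists, not_and]
        intro j _ hj
        exact pos_ne_bar _ _ (Prod.ext_iff.1 hj).2
    · rw [List.count_eq_one_of_mem (l := List.map _ _)]
      · rw [List.count_eq_zero_of_not_mem]
        rw [List.mem_singleton]
        intro hj
        exact pos_ne_bar _ _ (Prod.ext_iff.1 hj).2
      · refine (List.nodup_reverse.2 ((List.nodup_finRange n).filter _)).map fun a b hab => ?_
        exact pos_injective (Prod.ext_iff.1 hab).2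
      · refine List.mem_map.2 ⟨l, ?_, rfl⟩
        rw [List.mem_reverse, List.mem_filter, decide_eq_true_eq]
        exact ⟨List.mem_finRange l, hk.trans hl⟩
  · refine List.count_eq_zero_of_not_mem fun hm => ?_
    simp only [gammaKI, List.mem_append, List.mem_map, List.mem_filter, List.mem_reverse,
      List.mem_singleton, decide_eq_true_eq] at hm
    rcases hm with ((hm | ⟨j, ⟨-, hj⟩, rfl⟩) | rfl) | ⟨j, ⟨-, hj⟩, rfl⟩
    · exact h.notMem_gammaRow i' hm
    all_goals exact hii (pos_injective h.1)

theorem IsQuantumRoot.count_gammaR {k : ℕ} {i : Fin n} {β : Root n} (h : IsQuantumRoot k i β)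
    (k' : ℕ) : (gammaR n k').count β = 0 := by
  refine List.count_eq_zero_of_not_mem fun hm => ?_
  rw [gammaR, List.mem_flatMap] at hm
  obtain ⟨i', -, hm⟩ := hm
  exact h.notMem_gammaRow i' hm

theorem IsQuantumRoot.count_gammaL {k : ℕ} {i : Fin n} {β : Root n} (h : IsQuantumRoot k i β)
    {k' : ℕ} (hk : k' ≤ k) : (gammaL n k').count β = if i.val < k' then 1 else 0 := by
  rw [gammaL]
  split_ifs with hi
  · rw [List.count_flatMap, List.map_congr_left (g := fun i' => if i' = i then 1 else 0)]
    · rw [← List.sum_toFinset _ ((List.nodup_finRange n).filter _)]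
      rw [Finset.sum_ite_eq' _ i]
      simp [hi]
    · intro i' _
      rw [Function.comp_apply, h.count_gammaKI hk hi]
  · refine List.count_eq_zero_of_not_mem fun hm => ?_
    simp only [List.mem_flatMap, List.mem_filter, decide_eq_true_eq] at hm
    obtain ⟨i', ⟨-, hi'⟩, hm⟩ := hm
    simp only [gammaKI, List.mem_append, List.mem_map, List.mem_filter, List.mem_reverse,
      List.mem_singleton, decide_eq_true_eq] at hm
    rcases hm with ((hm | ⟨j, ⟨-, hj⟩, rfl⟩) | rfl) | ⟨j, ⟨-, hj⟩, rfl⟩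
    · exact h.notMem_gammaRow i' hm
    all_goals
      have := pos_injective h.1
      rw [this] at hi'
      exact hi hi'

/-- Each block Γ_l belonging to a column that meets row i contributes one occurrence, and Γ_r none.
Among the columns indexed from t on, counted from 0, there are μ_i - t such columns. -/
theorem IsQuantumRoot.count_chainFrom {μ : Fin n → ℕ} (hμ : Antitone μ) {m : ℕ} {i : Fin n}
    {β : Root n} (h : IsQuantumRoot (colHeight μ m) i β) {t : ℕ} (ht : t ≤ numCols μ)
    (hm : m ≤ t) : (chainFrom μ t).count β = μ i - t := by
  induction ht using Nat.decreasingInduction with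
  | self =>
    rw [chainFrom_of_le le_rfl, List.count_nil]
    have := le_numCols μ i
    omega
  | of_succ t ht ih =>
    rw [chainFrom_eq_append ht, List.count_append, List.count_append, ih (by omega),
      h.count_gammaR, h.count_gammaL (colHeight_anti μ hm)]
    simp only [lt_colHeight_iff hμ]
    split_ifs <;> omega

theorem card_filter_get_eq {α : Type*} [DecidableEq α] [BEq α] [LawfulBEq α] (L : List α) (b : α) (p : ℕ)
    (hp : p ≤ L.length) : (Finset.univ.filter fun i : Fin L.length =>
      i.val < p ∧ L.get i = b).card = (L.take p).count b := by
  induction p with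
  | zero => simp
  | succ p ih =>
    have h1 : (Finset.univ.filter fun i : Fin L.length => i.val < p + 1 ∧ L.get i = b) =
        (Finset.univ.filter fun i : Fin L.length => i.val < p ∧ L.get i = b) ∪
          (Finset.univ.filter fun i : Fin L.length => i = ⟨p, hp⟩ ∧ L.get i = b) := by
      ext i
      simp only [Finset.mem_filter, Finset.mem_univ, true_and, Finset.mem_union, Fin.ext_iff,
        ← or_and_right]
      refine and_congr_left fun _ => ?_
      omega
    rw [h1, Finset.card_union_of_disjoint, ih (by omega), List.take_add_one,
      List.count_append]
    · congr 1
      rw [List.getElem?_eq_getElem hp, Option.toList_some, List.count_singleton]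
      by_cases hb : L[p] = b
      · rw [if_pos (by simpa using hb), Finset.card_eq_one]
        refine ⟨⟨p, hp⟩, ?_⟩
        ext i
        simp only [Finset.mem_filter, Finset.mem_univ, true_and, Finset.mem_singleton]
        refine ⟨fun h => h.1, ?_⟩
        rintro rfl
        exact ⟨rfl, hb⟩
      · rw [if_neg (by simpa using hb), Finset.card_eq_zero, Finset.filter_eq_empty_iff]
        rintro i - ⟨rfl, h⟩
        exact hb h
    · rw [Finset.disjoint_filter]
      rintro i - ⟨h, -⟩ ⟨rfl, -⟩
      exact lt_irrefl _ h

/-- The earlier blocks contain the root μ_i - (m + 1) times, and its own block adds the occurrence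
at j. -/
theorem affineLevel_eq {μ : Fin n → ℕ} (hμ : Antitone μ) {m : ℕ} (hm : m < numCols μ)
    {j : Fin (muChain μ).length} {i : Fin n}
    (hj : (chainFrom μ (m + 1) ++ gammaR n (colHeight μ m)).length ≤ j.val)
    (hj' : j.val < (chainFrom μ m).length)
    (h : IsQuantumRoot (colHeight μ m) i ((muChain μ).get j)) :
    affineLevel (muChain μ) j = μ i - m ∧ m < μ i := by
  have h1 : affineLevel (muChain μ) j =
      ((muChain μ).take (j.val + 1)).count ((muChain μ).get j) := by
    rw [← card_filter_get_eq _ _ (j.val + 1) j.isLt, affineLevel]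
    congr 1
    refine Finset.filter_congr fun i _ => ?_
    rw [Fin.le_def, Nat.lt_succ_iff]
  obtain ⟨R, hR⟩ := exists_muChain_eq μ hm.le
  set β := (muChain μ).get j with hβ
  set A := chainFrom μ (m + 1) ++ gammaR n (colHeight μ m) with hA
  have hC : chainFrom μ m = A ++ gammaL n (colHeight μ m) := chainFrom_eq_append hm
  have hlen : (chainFrom μ m).length = A.length + (gammaL n (colHeight μ m)).length := by
    rw [hC, List.length_append]
  have hcL := h.count_gammaL le_rfl
  have hcA : A.count β = μ i - (m + 1) := by
    rw [hA, List.count_append, h.count_gammaR, h.count_chainFrom hμ hm (Nat.le_succ m), add_zero]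
  have htake' : ∀ p, A.length ≤ p → p ≤ (chainFrom μ m).length → (muChain μ).take p =
      A ++ (gammaL n (colHeight μ m)).take (p - A.length) := by
    intro p h2 h3
    rw [hR, hC, List.append_assoc, List.take_append, List.take_of_length_le h2,
      List.take_append_of_le_length (by omega)]
  have htake := htake' (j.val + 1) (by omega) hj'
  have hle : ((gammaL n (colHeight μ m)).take (j.val + 1 - A.length)).count β ≤
      (gammaL n (colHeight μ m)).count β := (List.take_sublist _ _).count_le _
  have hmem : β ∈ (gammaL n (colHeight μ m)).take (j.val + 1 - A.length) := by
    have hb : β = (gammaL n (colHeight μ m))[j.val - A.length]'(by omega) := by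
      rw [hβ, List.get_eq_getElem]
      simp only [hR, hC]
      rw [List.getElem_append_left (by rw [← hC]; omega), List.getElem_append_right hj]
    rw [hb]
    refine List.mem_iff_getElem.2 ⟨j.val - A.length, ?_, ?_⟩
    · rw [List.length_take]
      omega
    · rw [List.getElem_take]
  -- The prefix of the block up to and including j contains the root at least once, and the whole
  -- block at most once.
  have hpos := List.count_pos_iff.2 hmem
  rw [hcL] at hle
  have hi : i.val < colHeight μ m := by
    by_contra hi
    rw [if_neg hi] at hle
    omega
  rw [if_pos hi] at hle
  have hmi := (lt_colHeight_iff hμ i m).1 hi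
  rw [h1, htake, List.count_append, hcA]
  omega

end Chain

section Final

variable {n : ℕ} {μ : Fin n → ℕ} {w : W n} {J : Finset (Fin (muChain μ).length)}

/-! ### The states between the blocks -/

/-- The element `π_r^{t}` reached after the part `Γ^{μ_1} ⋯ Γ^{t+1}` of the chain. -/
def stateR (μ : Fin n → ℕ) (w : W n) (J : Finset (Fin (muChain μ).length)) (t : ℕ) : W n :=
  partialProd (muChain μ) w J (chainFrom μ t).length

/-- The element `π_l^{t+1}`. -/
def stateL (μ : Fin n → ℕ) (w : W n) (J : Finset (Fin (muChain μ).length)) (t : ℕ) : W n :=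
  partialProd (muChain μ) w J
    ((chainFrom μ (t + 1)).length + (gammaR n (colHeight μ t)).length)

theorem stateR_zero (hJ : IsAdmissible (muChain μ) w J) : stateR μ w J 0 = 1 := by
  rw [stateR, chainFrom_zero]
  exact (hJ.key isPosRoot_of_mem_muChain).1

theorem exists_rpath_gammaR (hJ : IsAdmissible (muChain μ) w J) {t : ℕ} (ht : t < numCols μ) :
    ∃ q, RPath (gammaR n (colHeight μ t)).reverse (stateL μ w J t) (stateR μ w J (t + 1)) q ∧
      ∀ g : Root n → ℕ, ∑ j ∈ (negFoldings (muChain μ) w J).filter (fun j =>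
        (chainFrom μ (t + 1)).length ≤ j.val ∧
        j.val < (chainFrom μ (t + 1)).length + (gammaR n (colHeight μ t)).length),
        g ((muChain μ).get j) = (q.map g).sum := by
  obtain ⟨R, hR⟩ := exists_muChain_eq μ ht.le
  refine hJ.exists_rpath isPosRoot_of_mem_muChain (chainFrom μ (t + 1)) _
    (gammaL n (colHeight μ t) ++ R) ?_
  rw [hR, chainFrom_eq_append ht]
  simp

theorem exists_rpath_gammaL (hJ : IsAdmissible (muChain μ) w J) {t : ℕ} (ht : t < numCols μ) :
    ∃ q, RPath (gammaL n (colHeight μ t)).reverse (stateR μ w J t) (stateL μ w J t) q ∧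
      ∀ g : Root n → ℕ, ∑ j ∈ (negFoldings (muChain μ) w J).filter (fun j =>
        (chainFrom μ (t + 1) ++ gammaR n (colHeight μ t)).length ≤ j.val ∧
        j.val < (chainFrom μ t).length), g ((muChain μ).get j) = (q.map g).sum := by
  obtain ⟨R, hR⟩ := exists_muChain_eq μ ht.le
  have := hJ.exists_rpath isPosRoot_of_mem_muChain
    (chainFrom μ (t + 1) ++ gammaR n (colHeight μ t)) (gammaL n (colHeight μ t)) R
    (by rw [hR, chainFrom_eq_append ht])
  rw [← List.length_append, ← chainFrom_eq_append ht, List.length_append (bs := gammaR _ _)] at this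
  rw [List.length_append]
  exact this

theorem stateL_arc (hJ : IsAdmissible (muChain μ) w J) {t : ℕ} (ht : t < numCols μ)
    {p l : Letter n} (hpl : p < l) (hl : l.val < colHeight μ t) :
    ¬ InArc (val (stateR μ w J t) p) (val (stateL μ w J t) p) (val (stateL μ w J t) l) := by
  obtain ⟨q, hq, -⟩ := exists_rpath_gammaL hJ ht
  exact (hq.gammaL (colHeight_le μ t)).1 p l hpl hl

theorem stateR_arc (hJ : IsAdmissible (muChain μ) w J) {t : ℕ} (ht : t < numCols μ)
    {p l : Letter n} (hpl : p < l) (hl : l.val < colHeight μ t) :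
    ¬ InArc (val (stateL μ w J t) p) (val (stateR μ w J (t + 1)) p)
      (val (stateR μ w J (t + 1)) l) := by
  obtain ⟨q, hq, -⟩ := exists_rpath_gammaR hJ ht
  exact (hq.gammaR (colHeight_le μ t)).1 p l hpl hl

theorem stateL_le_stateR (hJ : IsAdmissible (muChain μ) w J) {t : ℕ} (ht : t < numCols μ)
    {p : Fin n} (hp : p.val < colHeight μ t) :
    val (stateL μ w J t) (pos p) ≤ val (stateR μ w J (t + 1)) (pos p) := by
  obtain ⟨q, hq, -⟩ := exists_rpath_gammaR hJ ht
  exact (hq.gammaR (colHeight_le μ t)).2.2 p hp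

theorem val_one (p : Letter n) : val (1 : W n) p = p.val := rfl

/-- The first block starts from the identity, so u(p) = p. Once all rows from p on have values at
least p, the arc condition puts the smallest of them in row p, and the rows beyond have values at
least p + 1. -/
theorem stateL_zero_ge (hJ : IsAdmissible (muChain μ) w J) (h0 : 0 < numCols μ) (p : ℕ) :
    ∀ l : Letter n, p ≤ l.val → l.val < colHeight μ 0 →
      p ≤ val (stateL μ w J 0) l := by
  induction p with
  | zero => exact fun _ _ _ => Nat.zero_le _
  | succ p ih =>
    intro l hpl hl
    have hp : (⟨p, by omega⟩ : Letter n) < l := hpl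
    have h1 := ih ⟨p, by omega⟩ le_rfl (by simp only; omega)
    have h2 := ih l (by omega) hl
    have h3 := stateL_arc hJ h0 hp hl
    have h4 := val_ne (stateL μ w J 0) hp.ne
    rw [stateR_zero hJ, val_one, InArc, if_pos h1] at h3
    simp only at h3
    omega

theorem stateL_zero_lt (hJ : IsAdmissible (muChain μ) w J) (h0 : 0 < numCols μ) {p l : Letter n}
    (hpl : p < l) (hl : l.val < colHeight μ 0) :
    val (stateL μ w J 0) p < val (stateL μ w J 0) l := by
  have hpl' : p.val < l.val := hpl
  have h1 := stateL_zero_ge hJ h0 p.val p le_rfl (by omega)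
  have h2 := stateL_zero_ge hJ h0 p.val l hpl'.le hl
  have h3 := stateL_arc hJ h0 hpl hl
  have h4 := val_ne (stateL μ w J 0) hpl.ne
  rw [stateR_zero hJ, val_one, InArc, if_pos h1] at h3
  omega

/-! ### The level -/

/-- The roots (j, ī) and (i, j̄) with distinct rows never label quantum steps; the two remaining
kinds belong to the row of the segment. -/
theorem exists_isQuantumRoot {k : ℕ} {β : Root n} (hβ : β ∈ gammaL n k) {x : W n}
    (he : Edge x β) (hq : x.1 β.2 < x.1 β.1) : ∃ i : Fin n, IsQuantumRoot k i β := by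
  simp only [gammaL, List.mem_flatMap, List.mem_filter, decide_eq_true_eq] at hβ
  obtain ⟨i, ⟨-, hi⟩, hm⟩ := hβ
  simp only [gammaKI, List.mem_append, List.mem_map, List.mem_filter, List.mem_reverse,
    List.mem_singleton, decide_eq_true_eq] at hm
  rcases hm with ((hm | ⟨j, ⟨-, hj⟩, rfl⟩) | rfl) | ⟨j, ⟨-, hj⟩, rfl⟩
  · exact absurd hq (last_phase_not_quantum hm he)
  · refine absurd hq (he.2 ?_ (ne_of_val_ne ?_)).1.not_gt
    · rw [bar_val]; omega
    · rw [bar_val, Fin.val_rev, pos_val]; omega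
  · exact ⟨i, rfl, Or.inl rfl⟩
  · exact ⟨i, rfl, Or.inr ⟨j, hj, rfl⟩⟩

/-- The contribution of the block `Γ^{t+1}` to the level. -/
def blockLevel (μ : Fin n → ℕ) (w : W n) (J : Finset (Fin (muChain μ).length)) (t : ℕ) : ℕ :=
  ∑ p : Fin n, if t < μ p ∧ val (stateL μ w J t) (pos p) < val (stateR μ w J t) (pos p)
    then μ p - t else 0

theorem sum_affineLevel_block (hμ : Antitone μ) (hJ : IsAdmissible (muChain μ) w J) {t : ℕ}
    (ht : t < numCols μ) :
    ∑ j ∈ (negFoldings (muChain μ) w J).filter (fun j =>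
        (chainFrom μ (t + 1) ++ gammaR n (colHeight μ t)).length ≤ j.val ∧
        j.val < (chainFrom μ t).length), affineLevel (muChain μ) j = blockLevel μ w J t := by
  obtain ⟨q, hq, hsum⟩ := exists_rpath_gammaL hJ ht
  -- The affine level of a quantum root in this block depends only on its row, so it is a function
  -- of the first letter of the label. The value 0 on barred letters is a dummy.
  set g : Letter n → ℕ := fun a => if h : a.val < n then μ ⟨a.val, h⟩ - t else 0 with hg
  have hgpos : ∀ i : Fin n, g (pos i) = μ i - t := fun i => by
    exact dif_pos i.isLt
  rw [blockLevel, Finset.sum_congr rfl (g := fun j => g ((muChain μ).get j).1)]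
  · rw [hsum fun β => g β.1, (hq.gammaL (colHeight_le μ t)).2 g]
    refine Finset.sum_congr rfl fun p _ => ?_
    rw [hgpos]
    simp only [lt_colHeight_iff hμ]
  · intro j hj
    rw [Finset.mem_filter] at hj
    obtain ⟨hj, h1, h2⟩ := hj
    have hjJ := ((mem_negFoldings isPosRoot_of_mem_muChain).1 hj).1
    obtain ⟨he, hiff⟩ := (hJ.key isPosRoot_of_mem_muChain).2 j hjJ
    have hmem : (muChain μ).get j ∈ gammaL n (colHeight μ t) := by
      obtain ⟨R, hR⟩ := exists_muChain_eq μ ht.le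
      rw [chainFrom_eq_append ht] at hR h2
      rw [List.get_eq_getElem]
      simp only [hR]
      rw [List.getElem_append_left h2, List.getElem_append_right h1]
      exact List.getElem_mem _
    obtain ⟨i, hi⟩ := exists_isQuantumRoot hmem he (hiff.1 hj)
    rw [(affineLevel_eq hμ ht h1 h2 hi).1, hi.1, hgpos]

theorem sum_affineLevel_chainFrom (hμ : Antitone μ) (hJ : IsAdmissible (muChain μ) w J) {t : ℕ}
    (ht : t ≤ numCols μ) :
    ∑ j ∈ (negFoldings (muChain μ) w J).filter (fun j => j.val < (chainFrom μ t).length),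
      affineLevel (muChain μ) j = ∑ m ∈ Finset.Ico t (numCols μ), blockLevel μ w J m := by
  induction ht using Nat.decreasingInduction with
  | self => rw [chainFrom_of_le le_rfl]; simp
  | of_succ t ht ih =>
    have hlen : (chainFrom μ t).length = (chainFrom μ (t + 1)).length +
        (gammaR n (colHeight μ t)).length + (gammaL n (colHeight μ t)).length := by
      rw [chainFrom_eq_append ht, List.length_append, List.length_append]
    obtain ⟨q, hq, hsum⟩ := exists_rpath_gammaR hJ ht
    have hq0 := (hq.gammaR (colHeight_le μ t)).2.1
    have hempty : (negFoldings (muChain μ) w J).filter (fun j =>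
        (chainFrom μ (t + 1)).length ≤ j.val ∧
        j.val < (chainFrom μ (t + 1)).length + (gammaR n (colHeight μ t)).length) = ∅ := by
      have := hsum fun _ => 1
      rw [hq0] at this
      simpa using this
    rw [Finset.sum_eq_sum_Ico_succ_bot ht, ← ih, ← sum_affineLevel_block hμ hJ ht, add_comm,
      ← Finset.sum_union]
    · refine Finset.sum_congr ?_ fun _ _ => rfl
      ext j
      simp only [Finset.mem_filter, Finset.mem_union, List.length_append, ← and_or_left]
      refine and_congr_right fun hj => ⟨fun h => ?_, fun h => by omega⟩
      by_contra h'
      have : j ∈ (∅ : Finset (Fin (muChain μ).length)) := by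
        rw [← hempty, Finset.mem_filter]
        exact ⟨hj, by omega, by omega⟩
      simp at this
    · rw [Finset.disjoint_filter]
      intro j _ h1 h2
      rw [List.length_append] at h2
      omega

/-- The shift by one is harmless. Block 0 starts from the identity, whose entries can only grow
there, so it contributes 0; the block with index `numCols μ` is empty. -/
theorem level_eq (hμ : Antitone μ) (hJ : IsAdmissible (muChain μ) w J) :
    level (muChain μ) w J = ∑ j ∈ Finset.range (numCols μ), blockLevel μ w J (j + 1) := by
  have h1 := sum_affineLevel_chainFrom hμ hJ (Nat.zero_le _)
  rw [chainFrom_zero, Finset.filter_true_of_mem fun j _ => j.isLt] at h1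
  have h2 : blockLevel μ w J (numCols μ) = 0 := by
    refine Finset.sum_eq_zero fun p _ => if_neg fun h => ?_
    exact absurd h.1 (le_numCols μ p).not_gt
  have h3 : blockLevel μ w J 0 = 0 := by
    refine Finset.sum_eq_zero fun p _ => if_neg fun h => ?_
    have h4 := stateL_zero_ge hJ (lt_of_lt_of_le h.1 (le_numCols μ p)) p.val (pos p) le_rfl
      ((lt_colHeight_iff hμ p 0).2 h.1)
    rw [stateR_zero hJ, val_one, pos_val] at h
    omega
  rw [level, h1, ← Finset.range_eq_Ico]
  have h4 := Finset.sum_range_succ (blockLevel μ w J) (numCols μ)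
  rw [Finset.sum_range_succ' (blockLevel μ w J)] at h4
  omega

end Final

section Final

variable {n : ℕ} {μ : Fin n → ℕ} {w : W n} {J : Finset (Fin (muChain μ).length)}

/-! ### The filling -/

theorem filter_finRange_eq_take (n k : ℕ) :
    (List.finRange n).filter (fun i => i.val < k) = (List.finRange n).take k := by
  conv_lhs => rw [← List.take_append_drop k (List.finRange n)]
  rw [List.filter_append, List.filter_eq_self.2, List.filter_eq_nil_iff.2, List.append_nil]
  · intro i hi
    obtain ⟨t, ht, rfl⟩ := List.mem_iff_getElem.1 hi
    simp
  · intro i hi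
    obtain ⟨t, ht, rfl⟩ := List.mem_iff_getElem.1 hi
    simp at ht ⊢
    omega

theorem length_window (u : W n) {k : ℕ} (hk : k ≤ n) : (window u k).length = k := by
  rw [window, filter_finRange_eq_take]
  simpa using hk

theorem window_getElem? (u : W n) {k : ℕ} (i : Fin n) (hi : i.val < k) :
    (window u k)[i.val]? = some (u.1 (pos i)) := by
  rw [window, filter_finRange_eq_take, List.getElem?_map, List.getElem?_take_of_lt hi,
    List.getElem?_eq_getElem (by simp)]
  simp

theorem mem_window (u : W n) {k : ℕ} {a : Letter n} :
    a ∈ window u k ↔ ∃ i : Fin n, i.val < k ∧ u.1 (pos i) = a := by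
  simp [window]

theorem nodup_window (u : W n) (k : ℕ) : (window u k).Nodup :=
  ((List.nodup_finRange n).filter _).map (u.1.injective.comp pos_injective)

/-- The element whose first entries form the column with the label coded by `c`. -/
def columnState (μ : Fin n → ℕ) (w : W n) (J : Finset (Fin (muChain μ).length)) (c : ℕ) : W n :=
  if c % 2 = 0 then stateL μ w J (c / 2) else stateR μ w J (c / 2 + 1)

theorem columnState_two_mul (j : ℕ) : columnState μ w J (2 * j) = stateL μ w J j := by
  rw [columnState, if_pos (by omega), Nat.mul_div_cancel_left _ two_pos]

theorem columnState_two_mul_add_one (j : ℕ) :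
    columnState μ w J (2 * j + 1) = stateR μ w J (j + 1) := by
  rw [columnState, if_neg (by omega), show (2 * j + 1) / 2 = j by omega]

theorem flatMap_pair {α : Type*} (f g : ℕ → α) (N : ℕ) :
    (List.range N).flatMap (fun j => [f j, g j]) =
      (List.range (2 * N)).map fun c => if c % 2 = 0 then f (c / 2) else g (c / 2) := by
  induction N with
  | zero => rfl
  | succ N ih =>
    rw [List.range_succ, List.flatMap_append, ih, Nat.mul_succ, List.range_succ, List.range_succ]
    have h1 : (2 * N + 1) / 2 = N := by omega
    have h2 : ¬ (2 * N + 1) % 2 = 0 := by omega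
    simp [h1]

theorem fillingMap_eq : fillingMap μ w J = (List.range (2 * numCols μ)).map fun c =>
    window (columnState μ w J c) (colHeight μ (c / 2)) := by
  rw [fillingMap, flatMap_pair]
  refine List.map_congr_left fun c _ => ?_
  rw [columnState]
  split_ifs <;> rfl

theorem length_fillingMap : (fillingMap μ w J).length = 2 * numCols μ := by
  simp [fillingMap_eq]

theorem colHeight_eq_zero {j : ℕ} (h : numCols μ ≤ j) : colHeight μ j = 0 := by
  rw [colHeight, Finset.card_eq_zero, Finset.filter_eq_empty_iff]
  intro i _
  exact ((le_numCols μ i).trans h).not_gt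

theorem getD_fillingMap (c : ℕ) : (fillingMap μ w J).getD c [] =
    window (columnState μ w J c) (colHeight μ (c / 2)) := by
  rw [fillingMap_eq, List.getD_eq_getElem?_getD, List.getElem?_map]
  by_cases hc : c < 2 * numCols μ
  · simp [hc]
  · rw [colHeight_eq_zero (by omega)]
    simp [hc, window]

theorem lt_colHeight_half_iff (hμ : Antitone μ) (i : Fin n) (c : ℕ) :
    i.val < colHeight μ (c / 2) ↔ c < 2 * μ i := by
  rw [lt_colHeight_iff hμ]
  omega

theorem mem_cells (hμ : Antitone μ) {c : ℕ} {i : Fin n} :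
    (⟨c, i.val⟩ : Σ _ : ℕ, ℕ) ∈ cells (fillingMap μ w J) ↔ c < 2 * μ i := by
  rw [cells, Finset.mem_sigma, Finset.mem_range, Finset.mem_range, length_fillingMap,
    getD_fillingMap, length_window _ (colHeight_le μ _), lt_colHeight_half_iff hμ]
  have := le_numCols μ i
  simp only
  omega

/-- The row i consists of 2μ_i cells, and those to the left in the display are the later columns c +
1, …, 2μ_i - 1. -/
theorem arm_fillingMap (hμ : Antitone μ) (c : ℕ) (i : Fin n) :
    arm (fillingMap μ w J) ⟨c, i.val⟩ = 2 * μ i - (c + 1) := by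
  rw [← Nat.card_Ico, arm]
  symm
  refine Finset.card_bij (fun d _ => ⟨d, i.val⟩) ?_ ?_ ?_
  · intro d hd
    rw [Finset.mem_Ico] at hd
    rw [Finset.mem_filter, mem_cells hμ]
    exact ⟨hd.2, rfl, hd.1⟩
  · intro d _ d' _ h
    simpa using h
  · rintro ⟨d, r⟩ h
    rw [Finset.mem_filter] at h
    obtain ⟨h1, rfl, h3⟩ := h
    rw [mem_cells hμ] at h1
    exact ⟨d, Finset.mem_Ico.2 ⟨h3, h1⟩, rfl⟩

theorem isDescent_fillingMap (hμ : Antitone μ) {c : ℕ} {i : Fin n} (hc : c < 2 * μ i) :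
    IsDescent (fillingMap μ w J) c i.val ↔ c + 1 < 2 * μ i ∧
      (columnState μ w J (c + 1)).1 (pos i) < (columnState μ w J c).1 (pos i) := by
  rw [IsDescent, getD_fillingMap, getD_fillingMap,
    window_getElem? _ i ((lt_colHeight_half_iff hμ i c).2 hc)]
  by_cases h : c + 1 < 2 * μ i
  · rw [window_getElem? _ i ((lt_colHeight_half_iff hμ i (c + 1)).2 h)]
    simp [h]
  · have : (window (columnState μ w J (c + 1)) (colHeight μ ((c + 1) / 2)))[i.val]? = none := by
      rw [List.getElem?_eq_none_iff, length_window _ (colHeight_le μ _)]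
      rw [← lt_colHeight_half_iff hμ] at h
      exact not_lt.1 h
    simp [h, this]

theorem sum_range_eq_sum_fin {h : ℕ} (hn : h ≤ n) (f : ℕ → ℕ) :
    ∑ i ∈ Finset.range h, f i = ∑ i : Fin n, if i.val < h then f i.val else 0 := by
  rw [Fin.sum_univ_eq_sum_range (fun i => if i < h then f i else 0) n, ← Finset.sum_filter]
  refine Finset.sum_congr ?_ fun _ _ => rfl
  ext i
  simp only [Finset.mem_range, Finset.mem_filter]
  omega

theorem sum_range_two_mul (f : ℕ → ℕ) (N : ℕ) :
    ∑ c ∈ Finset.range (2 * N), f c = ∑ j ∈ Finset.range N, (f (2 * j) + f (2 * j + 1)) := by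
  induction N with
  | zero => rfl
  | succ N ih =>
    rw [Nat.mul_succ, Finset.sum_range_succ, Finset.sum_range_succ, ih, Finset.sum_range_succ,
      add_assoc]

theorem columnState_up (hμ : Antitone μ) (hJ : IsAdmissible (muChain μ) w J) {j : ℕ} {i : Fin n}
    (hj : j < μ i) : (columnState μ w J (2 * j)).1 (pos i) ≤
      (columnState μ w J (2 * j + 1)).1 (pos i) := by
  rw [columnState_two_mul, columnState_two_mul_add_one]
  exact stateL_le_stateR hJ (lt_of_lt_of_le hj (le_numCols μ i)) ((lt_colHeight_iff hμ i j).2 hj)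

/-- Even columns are some C_l, whose left neighbours C_r are at least as large, so they have no
descents. In the odd column 2j + 1 the arm in row i is 2(μ_i - (j + 1)), which explains the factor
2. -/
theorem sum_arm (hμ : Antitone μ) (hJ : IsAdmissible (muChain μ) w J) :
    ∑ x ∈ Des (fillingMap μ w J), arm (fillingMap μ w J) x =
      2 * ∑ j ∈ Finset.range (numCols μ), blockLevel μ w J (j + 1) := by
  classical
  have h1 : ∑ x ∈ Des (fillingMap μ w J), arm (fillingMap μ w J) x =
      ∑ c ∈ Finset.range (2 * numCols μ), ∑ i : Fin n, if c + 1 < 2 * μ i ∧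
        (columnState μ w J (c + 1)).1 (pos i) < (columnState μ w J c).1 (pos i)
        then 2 * μ i - (c + 1) else 0 := by
    rw [Des, Finset.sum_filter, cells, Finset.sum_sigma, length_fillingMap]
    refine Finset.sum_congr rfl fun c _ => ?_
    simp only
    rw [getD_fillingMap, length_window _ (colHeight_le μ _),
      sum_range_eq_sum_fin (colHeight_le μ _)]
    refine Finset.sum_congr rfl fun i _ => ?_
    by_cases hc : c < 2 * μ i
    · rw [if_pos ((lt_colHeight_half_iff hμ i c).2 hc), arm_fillingMap hμ]
      exact if_congr (isDescent_fillingMap hμ hc) rfl rfl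
    · rw [if_neg (fun h => hc ((lt_colHeight_half_iff hμ i c).1 h)), if_neg]
      omega
  rw [h1, sum_range_two_mul, Finset.mul_sum]
  refine Finset.sum_congr rfl fun j _ => ?_
  rw [Finset.sum_eq_zero, zero_add, blockLevel, Finset.mul_sum]
  · refine Finset.sum_congr rfl fun i _ => ?_
    rw [show 2 * j + 1 + 1 = 2 * (j + 1) by ring, columnState_two_mul,
      columnState_two_mul_add_one, mul_ite, mul_zero, ← Nat.mul_sub]
    refine if_congr (and_congr ?_ Iff.rfl) rfl rfl
    omega
  · intro i _
    rw [if_neg]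
    rintro ⟨h2, h3⟩
    exact (columnState_up hμ hJ (show j < μ i by omega)).not_gt h3

/-! ### The charge word -/

theorem mem_biletters {τ : Filling n} {k : Letter n} {c : ℕ} :
    (k, c) ∈ biletters τ ↔ ∃ C, τ[c]? = some C ∧ k ∈ C := by
  simp only [biletters, List.mem_flatMap, List.mem_map, Prod.exists, List.mem_zipIdx_iff_getElem?,
    Prod.mk.injEq]
  constructor
  · rintro ⟨C, d, h1, k', h2, rfl, rfl⟩
    exact ⟨C, h1, h2⟩
  · rintro ⟨C, h1, h2⟩
    exact ⟨C, c, h1, k, h2, rfl, rfl⟩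

theorem nodup_biletters {τ : Filling n} (h : ∀ C ∈ τ, C.Nodup) : (biletters τ).Nodup := by
  rw [biletters, List.nodup_flatMap]
  constructor
  · intro x hx
    refine (h _ (List.fst_mem_of_mem_zipIdx hx)).map fun a b hab => (Prod.ext_iff.1 hab).1
  · have h1 : (τ.zipIdx.map Prod.snd).Nodup := by
      rw [List.zipIdx_map_snd]
      exact List.nodup_range'
    rw [List.Nodup, List.pairwise_map] at h1
    refine h1.imp fun {x y} hxy => ?_
    rw [Function.onFun, List.disjoint_left]
    intro z hz hz'
    obtain ⟨a, -, rfl⟩ := List.mem_map.1 hz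
    obtain ⟨b, -, hb⟩ := List.mem_map.1 hz'
    exact hxy (Prod.ext_iff.1 hb).2.symm

/-- No column repeats an entry, so no biletter occurs twice and the sorting order is strict. -/
theorem pairwise_cw {τ : Filling n} (h : ∀ C ∈ τ, C.Nodup) : (cw τ).Pairwise Before := by
  have h1 : (cw τ).Nodup := (List.perm_insertionSort _ _).nodup_iff.2 (nodup_biletters h)
  have : Std.Total (α := Letter n × ℕ) fun x y => y.1 < x.1 ∨ (y.1 = x.1 ∧ y.2 ≤ x.2) :=
    ⟨fun x y => by simp only [Fin.lt_def, Fin.ext_iff]; omega⟩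
  have : IsTrans (Letter n × ℕ) fun x y => y.1 < x.1 ∨ (y.1 = x.1 ∧ y.2 ≤ x.2) :=
    ⟨fun x y z => by simp only [Fin.lt_def, Fin.ext_iff]; omega⟩
  have h2 : (cw τ).Pairwise fun x y => y.1 < x.1 ∨ (y.1 = x.1 ∧ y.2 ≤ x.2) :=
    List.pairwise_insertionSort _ _
  refine (h1.and h2).imp fun {x y} hxy => ?_
  obtain ⟨hne, h3 | ⟨h3, h4⟩⟩ := hxy
  · exact Or.inl h3
  · exact Or.inr ⟨h3, lt_of_le_of_ne h4 fun h5 => hne (Prod.ext h3.symm h5.symm)⟩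

/-- The word depends only on the sets of entries in the columns, so the unsorted rows may serve as X
although the word is formed from the sorted filling. The arc condition alternates between Γ_r blocks
(even c) and Γ_l blocks (odd c). -/
theorem isChargeWord (hμ : Antitone μ) (hJ : IsAdmissible (muChain μ) w J) :
    IsChargeWord (cw (ord (fillingMap μ w J))) μ fun c i => (columnState μ w J c).1 (pos i) where
  anti := hμ
  sorted := by
    refine pairwise_cw fun C hC => ?_
    simp only [ord, fillingMap_eq, List.mem_map] at hC
    obtain ⟨_, ⟨c, -, rfl⟩, rfl⟩ := hC
    exact (List.perm_insertionSort _ _).nodup_iff.2 (nodup_window _ _)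
  mem_iff k c := by
    rw [cw, (List.perm_insertionSort _ _).mem_iff, mem_biletters]
    simp only [ord, List.getElem?_map, Option.map_eq_some_iff]
    constructor
    · rintro ⟨_, ⟨C, hC, rfl⟩, hk⟩
      rw [(List.perm_insertionSort _ _).mem_iff] at hk
      have h1 := getD_fillingMap (μ := μ) (w := w) (J := J) c
      rw [List.getD_eq_getElem?_getD, hC, Option.getD_some] at h1
      rw [h1, mem_window] at hk
      obtain ⟨i, hi, hk⟩ := hk
      exact ⟨i, (lt_colHeight_half_iff hμ i c).1 hi, hk⟩
    · rintro ⟨i, hi, rfl⟩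
      have h1 : c < (fillingMap μ w J).length := by
        have := le_numCols μ i
        rw [length_fillingMap]
        omega
      refine ⟨_, ⟨_, List.getElem?_eq_getElem h1, rfl⟩, ?_⟩
      rw [(List.perm_insertionSort _ _).mem_iff]
      have h2 := getD_fillingMap (μ := μ) (w := w) (J := J) c
      rw [List.getD_eq_getElem _ _ h1] at h2
      rw [h2, mem_window]
      exact ⟨i, (lt_colHeight_half_iff hμ i c).2 hi, rfl⟩
  inj c := (columnState μ w J c).1.injective.comp pos_injective
  first i l hil hl := by
    have h0 := lt_of_lt_of_le hl (le_numCols μ l)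
    have := columnState_two_mul (μ := μ) (w := w) (J := J) 0
    rw [mul_zero] at this
    rw [this]
    exact stateL_zero_lt hJ h0 (p := pos i) (l := pos l) hil ((lt_colHeight_iff hμ l 0).2 hl)
  arc c i l hil hc := by
    have hl := (lt_colHeight_half_iff hμ l (c + 1)).2 hc
    have hcN : c + 1 < 2 * numCols μ := lt_of_lt_of_le hc (by
      have := le_numCols μ l
      omega)
    rcases Nat.even_or_odd' c with ⟨j, rfl | rfl⟩
    · rw [columnState_two_mul, columnState_two_mul_add_one]
      rw [show (2 * j + 1) / 2 = j by omega] at hl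
      exact stateR_arc hJ (by omega) (p := pos i) (l := pos l) hil hl
    · rw [columnState_two_mul_add_one, show 2 * j + 1 + 1 = 2 * (j + 1) by ring,
        columnState_two_mul]
      rw [show (2 * j + 1 + 1) / 2 = j + 1 by omega] at hl
      exact stateL_arc hJ (by omega) (p := pos i) (l := pos l) hil hl
  up _ _ hj := columnState_up hμ hJ hj

/-- The charge is collected row by row and the level block by block; the proof exchanges the two
sums and pads the rows to a common length with zeros. -/
theorem charge_cw₂ (hμ : Antitone μ) (hJ : IsAdmissible (muChain μ) w J) :
    charge (cw₂ (ord (fillingMap μ w J))) =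
      ∑ j ∈ Finset.range (numCols μ), blockLevel μ w J (j + 1) := by
  rw [cw₂, (isChargeWord hμ hJ).charge_eq]
  simp only [blockLevel]
  rw [Finset.sum_comm]
  refine Finset.sum_congr rfl fun i _ => ?_
  have h1 : ∀ j, (if j + 1 < μ i ∧ (columnState μ w J (2 * j + 2)).1 (pos i) <
      (columnState μ w J (2 * j + 1)).1 (pos i) then μ i - (j + 1) else 0) =
      if j + 1 < μ i ∧ val (stateL μ w J (j + 1)) (pos i) < val (stateR μ w J (j + 1)) (pos i)
        then μ i - (j + 1) else 0 := by
    intro j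
    rw [show 2 * j + 2 = 2 * (j + 1) by ring, columnState_two_mul, columnState_two_mul_add_one]
    rfl
  simp only [h1]
  refine Finset.sum_subset (Finset.range_mono (le_numCols μ i)) fun j _ hj => if_neg fun h => ?_
  rw [Finset.mem_range] at hj
  omega

end Final

end TypeC

theorem mainTheorem2 (n : ℕ) (μ : Fin n → ℕ) (hμ : Antitone μ) (w : TypeC.W n)
    (J : Finset (Fin (TypeC.muChain μ).length))
    (hJ : TypeC.IsAdmissible (TypeC.muChain μ) w J) :
    let σ : TypeC.Filling n := TypeC.fillingMap μ w J
    let τ : TypeC.Filling n := TypeC.ord σ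
    (TypeC.level (TypeC.muChain μ) w J : ℚ)
        = (1 / 2 : ℚ) * ∑ c ∈ TypeC.Des σ, (TypeC.arm σ c : ℚ) ∧
      TypeC.HasCharge (TypeC.cw₂ τ) ∧
      (1 / 2 : ℚ) * ∑ c ∈ TypeC.Des σ, (TypeC.arm σ c : ℚ)
        = (TypeC.charge (TypeC.cw₂ τ) : ℚ) := by
  intro σ τ
  -- All three quantities are compared with the natural number ∑ `blockLevel`; by `sum_arm` the
  -- total arm is twice this number.
  have h1 : (1 / 2 : ℚ) * ∑ c ∈ TypeC.Des σ, (TypeC.arm σ c : ℚ) =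
      ((∑ j ∈ Finset.range (TypeC.numCols μ), TypeC.blockLevel μ w J (j + 1) : ℕ) : ℚ) := by
    rw [← Nat.cast_sum, TypeC.sum_arm hμ hJ]
    push_cast
    ring
  refine ⟨?_, (TypeC.isChargeWord hμ hJ).hasCharge, ?_⟩
  · rw [h1, TypeC.level_eq hμ hJ]
  · rw [h1, TypeC.charge_cw₂ hμ hJ]
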